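/- **Notation.** For $n\ge 0$, $p\ge 1$ put $\zeta_n(p;x)=\sum_{k=1}^n \frac{x^k}{k^p}$ and $t_n(p;x)=\sum_{k=1}^n\frac{x^k}{(k-1/2)^p}$. For a root of unity $x$ and $p\ge1$ with $(p,x)\ne(1,1)$ let $$\mathrm{Li}_p(x)=\lim_{n\to\infty}\zeta_n(p;x),\qquad \mathrm{ti}_p(x)=\lim_{n\to\infty}t_n(p;x),$$ and for $x\neq1$ let $\phi(s;x)=\sum_{k=0}^\infty\frac{x^k}{k+s}$. In the divergent cases use the regularised values $$\mathrm{Li}_1(1)=0,\qquad \mathrm{ti}_1(1)=\lim_{n}\big(t_n(1;1)-H_n\big)=2\log 2,\qquad \phi(s;1)=\lim_n\Big(\sum_{k=0}^{n-1}\tfrac1{k+s}-H_n\Big)=-\psi(s)-\gamma,$$ where $H_n=\sum_{k=1}^n 1/k$. Put $\Phi(s;x)=\phi(s;x)-\phi(-s;x^{-1})-\frac1s$ (so $\Phi(s;1)=\pi\cot \pi s$); $\phi^{(j)}(s;x)$ is the $j$-th derivative in $s$. Put $$A_k=(-1)^k\mathrm{Li}_{k+1}(x)-\mathrm{Li}_{k+1}(x^{-1}),\qquad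 B_k=(-1)^k\mathrm{ti}_{k+1}(x)-x\,\mathrm{ti}_{k+1}(x^{-1}).$$ All summation indices $k,k_1,k_2,k_3$ are $\ge0$; empty sums are $0$; $\sum_\sigma$ is the sum over the two permutations $\sigma$ of $\{1,2\}$; infinite series are limits of partial sums. **Theorem.** Let $x,x_1,x_2$ be roots of unity, $p_1,p_2\ge1$, $z=xx_1x_2$. Let $r_1,r_2,r_3$ be rational functions over $\mathbb C$ with sets of poles $S_1,S_2,S_3$. Suppose that each $r_i(s)$ is $O(s^{-2})$ as $s\to\infty$, or that $z\ne1$ and $r_i(s)=O(s^{-1})$. Let $r_1$ have a pole of order at most $q\ge0$ at $0$ and no pole at a nonzero integer; let $r_2$ have a pole of order at most $q_1\ge0$ at $-1/2$ and no pole at an integer or at $-n-1/2$ with $n\ge1$; let $r_3$ have a pole of order at most $q_2\ge0$ at $0$ and no pole at a nonzero integer or at $-n-1/2$ with $n\ge0$. Put $R_1(s)=s^qr_1(s)$, $R_2(s)=(s+1/2)^{q_1}r_2(s)$, $R_3(s)=s^{q_2}r_3(s)$ (continued analytically to $0$, $-1/2$, $0$). Then in each of the following three identities every infinite series on the right converges,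 and the identity holds. (1) \begin{align*} &-\sum_{\alpha\in S_1\setminus\{0\}}\mathrm{Res}\left(\frac{\Phi(s;x)\phi^{(p_1-1)}(s;x_1)\phi^{(p_2-1)}(s;x_2)}{(p_1-1)!(p_2-1)!}(-1)^{p_1+p_2}r_1(s),\alpha\right)\\ &=\sum_{n=1}^\infty z^{-n}\left(\mathrm{Li}_{p_1}(x_1)-\zeta_{n-1}(p_1;x_1)\right)\left(\mathrm{Li}_{p_2}(x_2)-\zeta_{n-1}(p_2;x_2)\right)r_1(n)+\sum_{n=1}^\infty z^n\frac{r_1^{(p_1+p_2)}(-n)}{(p_1+p_2)!}\\ &+\sum_\sigma\sum_{n=1}^\infty\sum_{k=0}^{p_{\sigma(1)}}\binom{k+p_{\sigma(2)}-1}{p_{\sigma(2)}-1}z^n\left((-1)^k\mathrm{Li}_{k+p_{\sigma(2)}}(x_{\sigma(2)})+(-1)^{p_{\sigma(2)}}\zeta_n(k+p_{\sigma(2)};x_{\sigma(2)}^{-1})\right)\frac{r_1^{(p_{\sigma(1)}-k)}(-n)}{(p_{\sigma(1)}-k)!}\\ &+\sum_{n=1}^\infty z^n\left(\mathrm{Li}_{p_1}(x_1)+(-1)^{p_1}\zeta_n(p_1;x_1^{-1})\right)\left(\mathrm{Li}_{p_2}(x_2)+(-1)^{p_2}\zeta_n(p_2;x_2^{-1})\right)r_1(-n)\\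 &+\sum_\sigma\sum_{n=1}^\infty\ \sum_{k_1+k_2\le p_{\sigma(1)}-1}A_{k_1}\binom{k_2+p_{\sigma(2)}-1}{p_{\sigma(2)}-1}\left((-1)^{k_2}\mathrm{Li}_{k_2+p_{\sigma(2)}}(x_{\sigma(2)})+(-1)^{p_{\sigma(2)}}\zeta_n(k_2+p_{\sigma(2)};x_{\sigma(2)}^{-1})\right)\frac{z^n r_1^{(p_{\sigma(1)}-k_1-k_2-1)}(-n)}{(p_{\sigma(1)}-k_1-k_2-1)!}\\ &+\sum_{n=1}^\infty\sum_{k=0}^{p_1+p_2-1}A_k\frac{z^n r_1^{(p_1+p_2-k-1)}(-n)}{(p_1+p_2-k-1)!}+\frac{R_1^{(p_1+p_2+q)}(0)}{(p_1+p_2+q)!}\\ &+\sum_\sigma\sum_{k=0}^{p_{\sigma(1)}+q}\binom{k+p_{\sigma(2)}-1}{p_{\sigma(2)}-1}(-1)^k\mathrm{Li}_{k+p_{\sigma(2)}}(x_{\sigma(2)})\frac{R_1^{(p_{\sigma(1)}+q-k)}(0)}{(p_{\sigma(1)}+q-k)!}\\ &+\sum_{k_1+k_2\le q}\binom{k_1+p_1-1}{p_1-1}\binom{k_2+p_2-1}{p_2-1}(-1)^{k_1+k_2}\mathrm{Li}_{k_1+p_1}(x_1)\mathrm{Li}_{k_2+p_2}(x_2)\frac{R_1^{(q-k_1-k_2)}(0)}{(q-k_1-k_2)!}\\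 &+\sum_{k=0}^{p_1+p_2+q-1}A_k\frac{R_1^{(p_1+p_2+q-k-1)}(0)}{(p_1+p_2+q-k-1)!}\\ &+\sum_\sigma\ \sum_{k_1+k_2\le p_{\sigma(1)}+q-1}A_{k_1}\binom{k_2+p_{\sigma(2)}-1}{p_{\sigma(2)}-1}(-1)^{k_2}\mathrm{Li}_{k_2+p_{\sigma(2)}}(x_{\sigma(2)})\frac{R_1^{(p_{\sigma(1)}+q-k_1-k_2-1)}(0)}{(p_{\sigma(1)}+q-k_1-k_2-1)!}\\ &+\sum_{k_1+k_2+k_3\le q-1}A_{k_1}\binom{k_2+p_1-1}{p_1-1}\binom{k_3+p_2-1}{p_2-1}(-1)^{k_2+k_3}\mathrm{Li}_{k_2+p_1}(x_1)\mathrm{Li}_{k_3+p_2}(x_2)\frac{R_1^{(q-k_1-k_2-k_3-1)}(0)}{(q-k_1-k_2-k_3-1)!}. \end{align*} (2) \begin{align*} &-\sum_{\alpha\in S_2\setminus\{-1/2\}}\mathrm{Res}\left(\frac{\Phi(s;x)\phi^{(p_1-1)}(s+\frac12;x_1)\phi^{(p_2-1)}(s+\frac12;x_2)}{(p_1-1)!(p_2-1)!}(-1)^{p_1+p_2}r_2(s),\alpha\right)\\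 &=\sum_{n=1}^\infty z^{-n}(x_1x_2)^{-1}\left(\mathrm{ti}_{p_1}(x_1)-t_n(p_1;x_1)\right)\left(\mathrm{ti}_{p_2}(x_2)-t_n(p_2;x_2)\right)r_2(n)\\ &+\sum_{n=0}^\infty z^n\left(\mathrm{ti}_{p_1}(x_1)x_1^{-1}+(-1)^{p_1}t_n(p_1;x_1^{-1})\right)\left(\mathrm{ti}_{p_2}(x_2)x_2^{-1}+(-1)^{p_2}t_n(p_2;x_2^{-1})\right)r_2(-n)\\ &+\sum_{n=1}^\infty\sum_{k=0}^{p_1+p_2-1}B_k\frac{z^n r_2^{(p_1+p_2-k-1)}(-n-1/2)}{(p_1+p_2-k-1)!}\\ &+\sum_\sigma\sum_{n=1}^\infty\ \sum_{k_1+k_2\le p_{\sigma(1)}-1}B_{k_1}\binom{k_2+p_{\sigma(2)}-1}{p_{\sigma(2)}-1}z^n\left((-1)^{k_2}\mathrm{Li}_{k_2+p_{\sigma(2)}}(x_{\sigma(2)})+(-1)^{p_{\sigma(2)}}\zeta_n(k_2+p_{\sigma(2)};x_{\sigma(2)}^{-1})\right)\frac{r_2^{(p_{\sigma(1)}-k_1-k_2-1)}(-n-1/2)}{(p_{\sigma(1)}-k_1-k_2-1)!}\\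 &+\sum_{k=0}^{p_1+p_2+q_1-1}B_k\frac{R_2^{(p_1+p_2+q_1-k-1)}(-1/2)}{(p_1+p_2+q_1-k-1)!}\\ &+\sum_\sigma\ \sum_{k_1+k_2\le p_{\sigma(1)}+q_1-1}B_{k_1}\binom{k_2+p_{\sigma(2)}-1}{p_{\sigma(2)}-1}(-1)^{k_2}\mathrm{Li}_{k_2+p_{\sigma(2)}}(x_{\sigma(2)})\frac{R_2^{(p_{\sigma(1)}+q_1-k_1-k_2-1)}(-1/2)}{(p_{\sigma(1)}+q_1-k_1-k_2-1)!}\\ &+\sum_{k_1+k_2+k_3\le q_1-1}B_{k_1}\binom{k_2+p_1-1}{p_1-1}\binom{k_3+p_2-1}{p_2-1}(-1)^{k_2+k_3}\mathrm{Li}_{k_2+p_1}(x_1)\mathrm{Li}_{k_3+p_2}(x_2)\frac{R_2^{(q_1-k_1-k_2-k_3-1)}(-1/2)}{(q_1-k_1-k_2-k_3-1)!}. \end{align*} (3) \begin{align*} &-\sum_{\alpha\in S_3\setminus\{0\}}\mathrm{Res}\left(\frac{\Phi(s;x)\phi^{(p_1-1)}(s+\frac12;x_1)\phi^{(p_2-1)}(s+\frac12;x_2)}{(p_1-1)!(p_2-1)!}(-1)^{p_1+p_2}r_3(s),\alpha\right)\\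 &=\sum_{n=1}^\infty z^{-n}(x_1x_2)^{-1}\left(\mathrm{ti}_{p_1}(x_1)-t_n(p_1;x_1)\right)\left(\mathrm{ti}_{p_2}(x_2)-t_n(p_2;x_2)\right)r_3(n)\\ &+\sum_{n=1}^\infty z^n\left(\mathrm{ti}_{p_1}(x_1)x_1^{-1}+(-1)^{p_1}t_n(p_1;x_1^{-1})\right)\left(\mathrm{ti}_{p_2}(x_2)x_2^{-1}+(-1)^{p_2}t_n(p_2;x_2^{-1})\right)r_3(-n)\\ &+\sum_{n=0}^\infty\sum_{k=0}^{p_1+p_2-1}B_k\frac{z^n r_3^{(p_1+p_2-k-1)}(-n-1/2)}{(p_1+p_2-k-1)!}\\ &+\sum_\sigma\sum_{n=0}^\infty\ \sum_{k_1+k_2\le p_{\sigma(1)}-1}B_{k_1}\binom{k_2+p_{\sigma(2)}-1}{p_{\sigma(2)}-1}\left((-1)^{k_2}\mathrm{Li}_{k_2+p_{\sigma(2)}}(x_{\sigma(2)})+(-1)^{p_{\sigma(2)}}\zeta_n(k_2+p_{\sigma(2)};x_{\sigma(2)}^{-1})\right)\frac{z^n r_3^{(p_{\sigma(1)}-k_1-k_2-1)}(-n-1/2)}{(p_{\sigma(1)}-k_1-k_2-1)!}\\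 &+\sum_{k_1+k_2\le q_2}(x_1x_2)^{-1}\binom{k_1+p_1-1}{p_1-1}\binom{k_2+p_2-1}{p_2-1}\mathrm{ti}_{k_1+p_1}(x_1)\mathrm{ti}_{k_2+p_2}(x_2)\frac{(-1)^{k_1+k_2}R_3^{(q_2-k_1-k_2)}(0)}{(q_2-k_1-k_2)!}\\ &+\sum_{k_1+k_2+k_3\le q_2-1}A_{k_1}\binom{k_2+p_1-1}{p_1-1}\binom{k_3+p_2-1}{p_2-1}(-1)^{k_2+k_3}\mathrm{ti}_{k_2+p_1}(x_1)\mathrm{ti}_{k_3+p_2}(x_2)\frac{(x_1x_2)^{-1}R_3^{(q_2-k_1-k_2-k_3-1)}(0)}{(q_2-k_1-k_2-k_3-1)!}. \end{align*} -/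

import Mathlib

open Filter Topology Finset

namespace CyclotomicResidue

noncomputable section

/-- The finite sum `ζ_n(p;x) = ∑_{k=1}^n x^k / k^p`. -/
def zetaFin (n p : ℕ) (x : ℂ) : ℂ := ∑ k ∈ Icc 1 n, x ^ k / (k : ℂ) ^ p

/-- The finite sum `t_n(p;x) = ∑_{k=1}^n x^k / (k-1/2)^p`. -/
def tFin (n p : ℕ) (x : ℂ) : ℂ := ∑ k ∈ Icc 1 n, x ^ k / ((k : ℂ) - 1 / 2) ^ p

/-- The term subtracted from the `n`-th partial sums of the weight `p` series with parameter `x`: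
it is `0` whenever `(p, x) ≠ (1, 1)`, i.e. whenever the series converges, and it is the harmonic
number `H_n` in the divergent case `(p, x) = (1, 1)`. -/
def counterterm (n p : ℕ) (x : ℂ) : ℂ :=
  open Classical in if p = 1 ∧ x = 1 then ∑ k ∈ Icc 1 n, 1 / (k : ℂ) else 0

/-- The polylogarithm `Li_p(x) = lim_n ζ_n(p;x)` for `(p, x) ≠ (1, 1)`; the regularised value
at `(1, 1)` is `lim_n (H_n - H_n) = 0`. -/
def Li (p : ℕ) (x : ℂ) : ℂ := limUnder atTop fun n : ℕ => zetaFin n p x - counterterm n p x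

/-- The `t`-polylogarithm `ti_p(x) = lim_n t_n(p;x)` for `(p, x) ≠ (1, 1)`; the regularised value
at `(1, 1)` is `lim_n (t_n(1;1) - H_n) = 2 log 2`. -/
def ti (p : ℕ) (x : ℂ) : ℂ := limUnder atTop fun n : ℕ => tFin n p x - counterterm n p x

/-- The generalized digamma function `φ(s;x) = ∑_{k≥0} x^k/(k+s)` (limit of partial sums) for
`x ≠ 1`; for `x = 1`, where this series diverges, the regularised value
`φ(s;1) = lim_n (∑_{k<n} 1/(k+s) - H_n) = -ψ(s) - γ`. -/
def phi (s x : ℂ) : ℂ :=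
  limUnder atTop fun n : ℕ => (∑ k ∈ range n, x ^ k / ((k : ℂ) + s)) - counterterm n 1 x

/-- The extended trigonometric function `Φ(s;x) = φ(s;x) - φ(-s;x⁻¹) - 1/s`
(so that `Φ(s;1) = π cot(πs)`). -/
def Phi (s x : ℂ) : ℂ := phi s x - phi (-s) x⁻¹ - 1 / s

/-- The kernel `Φ(s;x) φ^{(p₁-1)}(s+h;x₁) φ^{(p₂-1)}(s+h;x₂) (-1)^{p₁+p₂} / ((p₁-1)!(p₂-1)!)`,
where `p = (p₁, p₂)`, `y = (x₁, x₂)` and the derivatives are taken in the first variable. -/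
def kernel (h x : ℂ) (p : Fin 2 → ℕ) (y : Fin 2 → ℂ) (s : ℂ) : ℂ :=
  Phi s x * iteratedDeriv (p 0 - 1) (fun w => phi w (y 0)) (s + h)
      * iteratedDeriv (p 1 - 1) (fun w => phi w (y 1)) (s + h)
    / (((p 0 - 1).factorial : ℂ) * ((p 1 - 1).factorial : ℂ)) * (-1) ^ (p 0 + p 1)

/-- The residue at an isolated singularity: the value, for all small radii `ε > 0`, of
`(2πi)⁻¹ ∮_{|s-α|=ε} f(s) ds`. -/
def residue (f : ℂ → ℂ) (α : ℂ) : ℂ :=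
  limUnder (𝓝[>] (0 : ℝ)) fun ε : ℝ =>
    (2 * (Real.pi : ℂ) * Complex.I)⁻¹ * ∮ s in C(α, ε), f s

/-- The value `r(s)` of a rational function (in lowest terms). -/
def ev (r : RatFunc ℂ) (s : ℂ) : ℂ := r.eval (RingHom.id ℂ) s

/-- The set of poles of a rational function. -/
def poles (r : RatFunc ℂ) : Finset ℂ := open Classical in r.denom.roots.toFinset

/-- `r` has at `a` a pole of order at most `q` (no pole, if `q = 0`). -/
def PoleOrderLE (r : RatFunc ℂ) (a : ℂ) (q : ℕ) : Prop := r.denom.rootMultiplicity a ≤ q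

/-- The decay at infinity: `r(s) = O(s⁻²)`; if the product `z` of the three roots of unity
is not `1`, then `r(s) = O(s⁻¹)` is enough. -/
def Decays (r : RatFunc ℂ) (z : ℂ) : Prop :=
  (ev r =O[Bornology.cobounded ℂ] fun s => s ^ (-2 : ℤ)) ∨
    (z ≠ 1 ∧ ev r =O[Bornology.cobounded ℂ] fun s => s ^ (-1 : ℤ))

/-- The Taylor coefficient `r^{(m)}(a) / m!`. -/
def taylorCoeff (r : RatFunc ℂ) (m : ℕ) (a : ℂ) : ℂ :=
  iteratedDeriv m (ev r) a / (m.factorial : ℂ)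

/-- `(-1)^k Li_{k+1}(x) - Li_{k+1}(x⁻¹)`. -/
def cLi (x : ℂ) (k : ℕ) : ℂ := (-1) ^ k * Li (k + 1) x - Li (k + 1) x⁻¹

/-- `(-1)^k ti_{k+1}(x) - x ti_{k+1}(x⁻¹)`. -/
def cTi (x : ℂ) (k : ℕ) : ℂ := (-1) ^ k * ti (k + 1) x - x * ti (k + 1) x⁻¹

/-- The series `∑_{n=n₀}^∞ a_n` converges (as a limit of partial sums) and has sum `S`. -/
def SeriesFrom (n₀ : ℕ) (a : ℕ → ℂ) (S : ℂ) : Prop :=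
  Tendsto (fun N => ∑ n ∈ Ico n₀ N, a n) atTop (𝓝 S)

end

end CyclotomicResidue

open CyclotomicResidue

/-! The formulas are the residue theorem for `kernel · r` on the circles |s| = M + 1/4, in the limit
M → ∞. These circles keep a distance of at least 1/4 from all integers and half-integers, hence from
all singularities of the kernel. Once the circle integrals tend to 0
(`tendsto_circleIntegral_kernel`), the residues inside sum to 0 in the limit
(`tendsto_sum_residues`). The residues at the poles of r where the kernel is regular go to one side,
and all others are computed.

Residues. The building block is the regularised Lerch series `lerch p x s` of x^k/(k+s)^p. Up to
sign and factorial it is a derivative of φ, and its values at 1 and 1/2 give Li and ti. The shift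
equation `lerch_eq_add` splits φ near -n into a simple pole, a finite head that produces ζ_n, and a
tail that produces Li. The relation Φ(s+m;x) = x^(-m) Φ(s;x) carries one expansion of Φ to all
integers (coefficients A_k) and to all points -n-1/2 (coefficients B_k). Laurent series are then
multiplied as formal power series: in `coeff_polar_mul_polar` every choice of a polar or a regular
part from each factor becomes one group of terms of the formula.

Vanishing of the integrals. On the circles each factor of the kernel is O(M^(1/8)), and O(s⁻²) for r
beats the total growth M^(3/8). If z ≠ 1, at least one of x, x₁, x₂ is not 1. Summation by parts
shows that the corresponding factor is O(|Im s|^(-1/2)), which is integrable along the circle, so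
that O(s⁻¹) is enough.

Convergence. The limit of the residue sums controls only the total, while each series has to
converge by itself. Its terms have the form z^n u_n v_n with u slowly varying (`Slow`) and v a
decaying Taylor coefficient of r (`Tame`). For z = 1 they are O(n^(-3/2)); for z ≠ 1 summation by
parts applies (`exists_seriesFrom_slow_mul_tame`). -/

namespace CyclotomicResidue

/-! ### The regularised Lerch series: convergence and derivatives -/

/-- The partial sums `∑_{k<n} x^k/(k+s)^p`, regularised if `(p, x) = (1, 1)`. -/
noncomputable def lerchSum (n p : ℕ) (x s : ℂ) : ℂ :=
  (∑ k ∈ range n, x ^ k / ((k : ℂ) + s) ^ p) - counterterm n p x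

/-- The regularised value of `∑_{k≥0} x^k/(k+s)^p`. -/
noncomputable def lerch (p : ℕ) (x s : ℂ) : ℂ := limUnder atTop fun n : ℕ => lerchSum n p x s

/-- The domain of `φ(·;x)`: the complement of the nonpositive integers. -/
def lerchDomain : Set ℂ := {s | ∀ k : ℕ, (k : ℂ) + s ≠ 0}

lemma isOpen_lerchDomain : IsOpen lerchDomain := by
  have h := Complex.isClosedEmbedding_intCast.isClosedMap (Set.range fun k : ℕ => -(k : ℤ))
    (isClosed_discrete _)
  rw [← isOpen_compl_iff] at h
  convert h using 1
  ext s
  simp only [lerchDomain, Set.mem_ofPred_eq, Set.mem_compl_iff, Set.mem_image, Set.mem_range,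
    exists_exists_eq_and, Int.cast_neg, Int.cast_natCast, not_exists]
  refine forall_congr' fun k => not_congr ⟨fun h => ?_, fun h => ?_⟩
  · linear_combination -h
  · linear_combination -h

lemma phi_eq_lerch (s x : ℂ) : phi s x = lerch 1 x s := by
  simp [phi, lerch, lerchSum]

lemma counterterm_one_one (n : ℕ) : counterterm n 1 1 = ∑ k ∈ range n, 1 / ((k : ℂ) + 1) := by
  rw [counterterm, if_pos ⟨rfl, rfl⟩, ← Ico_add_one_right_eq_Icc, sum_Ico_eq_sum_range]
  simp [add_comm]

lemma counterterm_of_ne {n p : ℕ} {x : ℂ} (h : ¬(p = 1 ∧ x = 1)) : counterterm n p x = 0 :=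
  if_neg h

lemma lerchSum_one_one (n : ℕ) (s : ℂ) :
    lerchSum n 1 1 s = ∑ k ∈ range n, (1 / ((k : ℂ) + s) - 1 / ((k : ℂ) + 1)) := by
  rw [lerchSum, counterterm_one_one, sum_sub_distrib]
  simp

/-- Summation by parts. For x ≠ 1 it replaces the terms x^k/(k+s), which are only conditionally
summable, by differences of order k⁻². -/
lemma one_sub_mul_lerchSum {x : ℂ} (hx : x ≠ 1) (n : ℕ) (s : ℂ) :
    (1 - x) * lerchSum n 1 x s = 1 / s - x ^ n / (n + s)
      + ∑ k ∈ range n, x ^ (k + 1) * (1 / ((k : ℂ) + 1 + s) - 1 / (k + s)) := by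
  rw [lerchSum, counterterm_of_ne (by simp [hx]), sub_zero]
  have h := Finset.sum_range_sub' (fun k : ℕ => x ^ k / ((k : ℂ) + s)) n
  simp only [Nat.cast_zero, zero_add, pow_zero] at h
  rw [← h, ← sum_add_distrib, mul_sum]
  refine sum_congr rfl fun k _ => ?_
  push_cast
  ring

lemma norm_natCast_add_ge {ρ : ℝ} {s : ℂ} (hs : ‖s‖ ≤ ρ) {k : ℕ} (hk : 2 * ρ ≤ k) :
    (k : ℝ) / 2 ≤ ‖(k : ℂ) + s‖ := by
  have := norm_sub_le_norm_add (k : ℂ) s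
  rw [Complex.norm_natCast] at this
  linarith

lemma tendstoUniformlyOn_sum_of_sq_bound {f : ℕ → ℂ → ℂ} {ρ C : ℝ}
    (h : ∀ᶠ k : ℕ in atTop, ∀ s ∈ Metric.closedBall (0 : ℂ) ρ, ‖f k s‖ ≤ C * (1 / (k : ℝ) ^ 2)) :
    TendstoUniformlyOn (fun n s => ∑ k ∈ range n, f k s) (fun s => ∑' k, f k s) atTop
      (Metric.closedBall (0 : ℂ) ρ) :=
  tendstoUniformlyOn_tsum_nat_eventually
    ((Real.summable_one_div_nat_pow.mpr one_lt_two).mul_left C) h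

lemma norm_inv_sub_inv_le {ρ : ℝ} (hρ : 0 < ρ) {a b : ℂ} (ha : ‖a‖ ≤ ρ) (hb : ‖b‖ ≤ ρ) {k : ℕ}
    (hk : 2 * ρ ≤ k) :
    ‖1 / ((k : ℂ) + a) - 1 / ((k : ℂ) + b)‖ ≤ 8 * ρ * (1 / (k : ℝ) ^ 2) := by
  have h1 := norm_natCast_add_ge ha hk
  have h2 := norm_natCast_add_ge hb hk
  have hk0 : (0 : ℝ) < k := by linarith
  have e1 : (k : ℂ) + a ≠ 0 := norm_pos_iff.mp (by linarith)
  have e2 : (k : ℂ) + b ≠ 0 := norm_pos_iff.mp (by linarith)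
  have : 1 / ((k : ℂ) + a) - 1 / ((k : ℂ) + b) = (b - a) / (((k : ℂ) + a) * ((k : ℂ) + b)) := by
    field_simp
    ring
  rw [this, norm_div, norm_mul]
  have h3 : ‖b - a‖ ≤ 2 * ρ := (norm_sub_le _ _).trans (by linarith)
  calc ‖b - a‖ / (‖(k : ℂ) + a‖ * ‖(k : ℂ) + b‖) ≤ 2 * ρ / ((k : ℝ) / 2 * ((k : ℝ) / 2)) := by
        gcongr
    _ = 8 * ρ * (1 / (k : ℝ) ^ 2) := by
        field_simp
        ring

/-- For x = 1 the counterterm makes the terms O(k⁻²); for x ≠ 1 summation by parts does. The ball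
may contain poles: only the tail in k matters for uniformity, and the finitely many terms with a
vanishing denominator take a fixed default value. -/
lemma exists_tendstoUniformlyOn_lerchSum {x : ℂ} (hx : ‖x‖ = 1) {ρ : ℝ} (hρ : 0 < ρ) :
    ∃ g : ℂ → ℂ, TendstoUniformlyOn (fun n s => lerchSum n 1 x s) g atTop
      (Metric.closedBall (0 : ℂ) ρ) := by
  -- Radius ρ + 1 instead of ρ, since the denominators are shifted by s, by 1 and by 1 + s.
  have hlarge : ∀ᶠ k : ℕ in atTop, 2 * (ρ + 1) ≤ (k : ℝ) :=
    tendsto_natCast_atTop_atTop.eventually_ge_atTop _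
  by_cases h1 : x = 1
  · subst h1
    simp only [lerchSum_one_one]
    refine ⟨_, tendstoUniformlyOn_sum_of_sq_bound (C := 8 * (ρ + 1)) ?_⟩
    filter_upwards [hlarge] with k hk s hs
    rw [mem_closedBall_zero_iff] at hs
    exact norm_inv_sub_inv_le (by linarith) (by linarith) (by simp; linarith) hk
  · have hsum : TendstoUniformlyOn
        (fun n s => ∑ k ∈ range n, x ^ (k + 1) * (1 / ((k : ℂ) + 1 + s) - 1 / (k + s)))
        (fun s => ∑' k : ℕ, x ^ (k + 1) * (1 / ((k : ℂ) + 1 + s) - 1 / (k + s))) atTop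
        (Metric.closedBall (0 : ℂ) ρ) := by
      refine tendstoUniformlyOn_sum_of_sq_bound (C := 8 * (ρ + 1)) ?_
      filter_upwards [hlarge] with k hk s hs
      rw [mem_closedBall_zero_iff] at hs
      rw [norm_mul, norm_pow, hx, one_pow, one_mul, add_assoc]
      refine norm_inv_sub_inv_le (by linarith) ?_ (by linarith) hk
      exact (norm_add_le _ _).trans (by simp; linarith)
    have hbd : TendstoUniformlyOn (fun (n : ℕ) (s : ℂ) => x ^ n / (n + s)) (fun _ => 0) atTop
        (Metric.closedBall (0 : ℂ) ρ) := by
      rw [Metric.tendstoUniformlyOn_iff]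
      intro ε hε
      filter_upwards [hlarge, tendsto_natCast_atTop_atTop.eventually_gt_atTop (2 / ε)]
        with n hn hn2 s hs
      rw [mem_closedBall_zero_iff] at hs
      have h2 := norm_natCast_add_ge hs (k := n) (by linarith)
      rw [dist_zero_left, norm_div, norm_pow, hx, one_pow]
      have : 0 < (n : ℝ) := by linarith
      have h3 : 1 / ε < (n : ℝ) / 2 := by
        have : 2 / ε = 2 * (1 / ε) := by ring
        linarith
      rw [div_lt_comm₀ (by linarith) hε]
      linarith
    have hfst : TendstoUniformlyOn (fun (_ : ℕ) (s : ℂ) => 1 / s) (fun s => 1 / s) atTop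
        (Metric.closedBall (0 : ℂ) ρ) := by
      rw [Metric.tendstoUniformlyOn_iff]
      intro ε hε
      exact Eventually.of_forall fun n s _ => by simpa using hε
    have h := ((hfst.sub hbd).add hsum)
    have hc := (uniformContinuous_const_smul ((1 - x)⁻¹)).comp_tendstoUniformlyOn h
    refine ⟨_, hc.congr (Eventually.of_forall fun n s _ => ?_)⟩
    have : 1 - x ≠ 0 := sub_ne_zero.mpr (Ne.symm h1)
    simp only [Function.comp, Pi.add_apply, Pi.sub_apply, smul_eq_mul]
    rw [← one_sub_mul_lerchSum h1, inv_mul_cancel_left₀ this]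

lemma tendsto_lerchSum_one {x : ℂ} (hx : ‖x‖ = 1) (s : ℂ) :
    Tendsto (fun n => lerchSum n 1 x s) atTop (𝓝 (lerch 1 x s)) := by
  obtain ⟨g, hg⟩ := exists_tendstoUniformlyOn_lerchSum hx (ρ := ‖s‖ + 1) (by positivity)
  exact tendsto_nhds_limUnder ⟨g s, hg.tendsto_at (by simp)⟩

lemma tendstoLocallyUniformlyOn_lerchSum {x : ℂ} (hx : ‖x‖ = 1) (U : Set ℂ) :
    TendstoLocallyUniformlyOn (fun n => lerchSum n 1 x) (lerch 1 x) atTop U := by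
  refine tendstoLocallyUniformlyOn_of_forall_exists_nhds fun s _ => ?_
  obtain ⟨g, hg⟩ := exists_tendstoUniformlyOn_lerchSum hx (ρ := ‖s‖ + 1) (by positivity)
  refine ⟨Metric.closedBall 0 (‖s‖ + 1), mem_nhdsWithin_of_mem_nhds ?_, hg.congr_right ?_⟩
  · exact mem_of_superset (Metric.isOpen_ball.mem_nhds (by simp)) Metric.ball_subset_closedBall
  · intro w hw
    exact tendsto_nhds_unique (hg.tendsto_at hw) (tendsto_lerchSum_one hx w)

lemma iteratedDeriv_inv_natCast_add (i k : ℕ) (s : ℂ) :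
    iteratedDeriv i (fun w : ℂ => ((k : ℂ) + w)⁻¹) s
      = (-1) ^ i * i.factorial * (1 / ((k : ℂ) + s) ^ (i + 1)) := by
  have h := iter_deriv_inv_linear i (1 : ℂ) (k : ℂ)
  simp only [one_mul, one_pow, mul_one] at h
  rw [iteratedDeriv_eq_iterate]
  simp only [add_comm (k : ℂ)]
  rw [h]
  have : (-1 - (i : ℤ)) = -((i + 1 : ℕ) : ℤ) := by push_cast; ring
  simp only [this, zpow_neg, zpow_natCast, one_div]

lemma iteratedDeriv_lerchSum (i n : ℕ) (x : ℂ) {s : ℂ} (hs : s ∈ lerchDomain) :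
    iteratedDeriv i (lerchSum n 1 x) s = (-1) ^ i * i.factorial * lerchSum n (i + 1) x s := by
  have hd : ∀ k ∈ range n, ContDiffAt ℂ i (fun w : ℂ => x ^ k * ((k : ℂ) + w)⁻¹) s := fun k _ =>
    contDiffAt_const.mul ((contDiffAt_const.add contDiffAt_id).inv (hs k))
  have h1 : lerchSum n 1 x
      = fun w => (∑ k ∈ range n, x ^ k * ((k : ℂ) + w)⁻¹) - counterterm n 1 x := by
    ext w
    simp [lerchSum, div_eq_mul_inv]
  rw [h1, iteratedDeriv_fun_sub (ContDiffAt.sum hd) contDiffAt_const, iteratedDeriv_fun_sum hd,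
    iteratedDeriv_const, lerchSum, mul_sub, mul_sum]
  congr 1
  · refine sum_congr rfl fun k _ => ?_
    rw [iteratedDeriv_const_mul_field, iteratedDeriv_inv_natCast_add]
    ring
  -- The counterterm is constant in s: it survives only for i = 0. For i ≥ 1 its derivative
  -- vanishes, and so does the counterterm of weight i + 1 on the right.
  · rcases i with _ | i
    · simp
    · rw [counterterm_of_ne (p := i + 1 + 1) (by simp)]
      simp

lemma differentiableOn_lerchSum (n p : ℕ) (x : ℂ) :
    DifferentiableOn ℂ (lerchSum n p x) lerchDomain := by
  intro s hs
  refine DifferentiableAt.differentiableWithinAt ?_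
  unfold lerchSum
  refine DifferentiableAt.sub_const (DifferentiableAt.fun_sum fun k _ => ?_) _
  exact (differentiableAt_const _).div (by fun_prop) (pow_ne_zero _ (hs k))

/-- Weierstrass: locally uniform limits of holomorphic functions may be differentiated termwise.
Weights p ≥ 2 thus need no convergence argument of their own. -/
lemma tendstoLocallyUniformlyOn_iteratedDeriv_lerchSum {x : ℂ} (hx : ‖x‖ = 1) (i : ℕ) :
    TendstoLocallyUniformlyOn (fun n => iteratedDeriv i (lerchSum n 1 x))
      (iteratedDeriv i (lerch 1 x)) atTop lerchDomain := by
  induction i with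
  | zero => simpa using tendstoLocallyUniformlyOn_lerchSum hx _
  | succ i ih =>
    have hd : ∀ n, DifferentiableOn ℂ (iteratedDeriv i (lerchSum n 1 x)) lerchDomain := fun n =>
      ((differentiableOn_lerchSum n (i + 1) x).const_mul _).congr
        fun s hs => iteratedDeriv_lerchSum i n x hs
    simpa only [iteratedDeriv_succ, Function.comp_def] using
      ih.deriv (Eventually.of_forall hd) isOpen_lerchDomain

lemma differentiableOn_lerch_one {x : ℂ} (hx : ‖x‖ = 1) :
    DifferentiableOn ℂ (lerch 1 x) lerchDomain :=
  (tendstoLocallyUniformlyOn_lerchSum hx _).differentiableOn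
    (Eventually.of_forall fun n => differentiableOn_lerchSum n 1 x) isOpen_lerchDomain

lemma analyticAt_lerch_one {x s : ℂ} (hx : ‖x‖ = 1) (hs : s ∈ lerchDomain) :
    AnalyticAt ℂ (lerch 1 x) s :=
  (differentiableOn_lerch_one hx).analyticAt (isOpen_lerchDomain.mem_nhds hs)

/-- The partial sums of weight p are, up to the nonzero factor (-1)^(p-1) (p-1)!, the derivatives of
order p - 1 of those of weight 1. -/
lemma tendsto_lerchSum {x s : ℂ} (hx : ‖x‖ = 1) (hs : s ∈ lerchDomain) {p : ℕ} (hp : 1 ≤ p) :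
    Tendsto (fun n => lerchSum n p x s) atTop (𝓝 (lerch p x s)) := by
  obtain ⟨i, rfl⟩ := Nat.exists_eq_add_of_le' hp
  have h := (tendstoLocallyUniformlyOn_iteratedDeriv_lerchSum hx i).tendsto_at hs
  simp only [iteratedDeriv_lerchSum i _ x hs] at h
  have h2 := h.const_mul ((-1 : ℂ) ^ i * i.factorial)⁻¹
  have h0 : (-1 : ℂ) ^ i * i.factorial ≠ 0 :=
    mul_ne_zero (by simp) (Nat.cast_ne_zero.mpr i.factorial_ne_zero)
  simp only [inv_mul_cancel_left₀ h0] at h2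
  exact tendsto_nhds_limUnder ⟨_, h2⟩

lemma iteratedDeriv_lerch_one {x s : ℂ} (hx : ‖x‖ = 1) (hs : s ∈ lerchDomain) (i : ℕ) :
    iteratedDeriv i (lerch 1 x) s = (-1) ^ i * i.factorial * lerch (i + 1) x s := by
  have h := (tendstoLocallyUniformlyOn_iteratedDeriv_lerchSum hx i).tendsto_at hs
  simp only [iteratedDeriv_lerchSum i _ x hs] at h
  exact tendsto_nhds_unique h ((tendsto_lerchSum hx hs (Nat.le_add_left 1 i)).const_mul _)

/-! ### The shift equation; Li and ti as values of the Lerch series -/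

/-- The counterterm is nonzero only for x = 1, so powers of x pass through the regularisation. -/
lemma mul_counterterm (n p : ℕ) (x : ℂ) : x * counterterm n p x = counterterm n p x := by
  by_cases h : p = 1 ∧ x = 1
  · rw [h.2, one_mul]
  · rw [counterterm_of_ne h, mul_zero]

lemma tendsto_counterterm_succ_sub (p : ℕ) (x : ℂ) :
    Tendsto (fun n => counterterm (n + 1) p x - counterterm n p x) atTop (𝓝 0) := by
  by_cases h : p = 1 ∧ x = 1
  · obtain ⟨rfl, rfl⟩ := h
    simp only [counterterm_one_one, sum_range_succ, add_sub_cancel_left]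
    exact tendsto_one_div_add_atTop_nhds_zero_nat
  · simp [counterterm_of_ne h]

lemma add_natCast_mem_lerchDomain {s : ℂ} (hs : s ∈ lerchDomain) (n : ℕ) :
    s + n ∈ lerchDomain := fun k => by
  have := hs (k + n)
  push_cast at this
  rwa [← add_assoc, add_right_comm]

/-- Splitting off the term k = 0 changes the length of the partial sum by one. The resulting
mismatch of the counterterms is at most 1/(n+1), so regularised values obey the same equation as
convergent ones. -/
lemma lerch_eq_add {x s : ℂ} (hx : ‖x‖ = 1) (hs : s ∈ lerchDomain) {p : ℕ} (hp : 1 ≤ p) :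
    lerch p x s = 1 / s ^ p + x * lerch p x (s + 1) := by
  have hs' : s + 1 ∈ lerchDomain := by simpa using add_natCast_mem_lerchDomain hs 1
  have h1 := (tendsto_lerchSum hx hs hp).comp (tendsto_add_atTop_nat 1)
  have h2 := (((tendsto_lerchSum hx hs' hp).const_mul x).const_add (1 / s ^ p)).sub
    (tendsto_counterterm_succ_sub p x)
  rw [sub_zero] at h2
  refine tendsto_nhds_unique h1 (h2.congr fun n => ?_)
  simp only [Function.comp, lerchSum, sum_range_succ', mul_sub, mul_counterterm, mul_sum]
  have : ∑ k ∈ range n, x * (x ^ k / ((k : ℂ) + (s + 1)) ^ p)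
      = ∑ k ∈ range n, x ^ (k + 1) / (((k + 1 : ℕ) : ℂ) + s) ^ p :=
    sum_congr rfl fun k _ => by push_cast; ring
  rw [this]
  simp
  ring

lemma lerch_eq_sum_add {x s : ℂ} (hx : ‖x‖ = 1) (hs : s ∈ lerchDomain) {p : ℕ} (hp : 1 ≤ p)
    (n : ℕ) :
    lerch p x s = (∑ k ∈ range n, x ^ k / ((k : ℂ) + s) ^ p) + x ^ n * lerch p x (s + n) := by
  induction n with
  | zero => simp
  | succ n ih =>
    rw [ih, sum_range_succ, lerch_eq_add hx (add_natCast_mem_lerchDomain hs n) hp]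
    push_cast
    rw [add_comm (n : ℂ) s, ← add_assoc s]
    ring

lemma one_mem_lerchDomain : (1 : ℂ) ∈ lerchDomain := fun k => Nat.cast_add_one_ne_zero k

lemma mem_lerchDomain_of_re_pos {s : ℂ} (hs : 0 < s.re) : s ∈ lerchDomain := fun k h => by
  have := congrArg Complex.re h
  simp at this
  have : (0 : ℝ) ≤ k := k.cast_nonneg
  linarith

lemma half_mem_lerchDomain : (1 / 2 : ℂ) ∈ lerchDomain :=
  mem_lerchDomain_of_re_pos (by norm_num)

lemma sum_Icc_one_eq_sum_range (f : ℕ → ℂ) (n : ℕ) :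
    ∑ k ∈ Icc 1 n, f k = ∑ k ∈ range n, f (k + 1) := by
  rw [← Ico_add_one_right_eq_Icc, sum_Ico_eq_sum_range]
  simp [add_comm]

lemma zetaFin_eq (n p : ℕ) (x : ℂ) :
    zetaFin n p x = x * ∑ k ∈ range n, x ^ k / ((k : ℂ) + 1) ^ p := by
  rw [zetaFin, sum_Icc_one_eq_sum_range, mul_sum]
  exact sum_congr rfl fun k _ => by push_cast; ring

lemma tFin_eq (n p : ℕ) (x : ℂ) :
    tFin n p x = x * ∑ k ∈ range n, x ^ k / ((k : ℂ) + 1 / 2) ^ p := by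
  rw [tFin, sum_Icc_one_eq_sum_range, mul_sum]
  refine sum_congr rfl fun k _ => ?_
  have : ((k + 1 : ℕ) : ℂ) - 1 / 2 = k + 1 / 2 := by push_cast; ring
  rw [this]
  ring

lemma Li_eq {x : ℂ} (hx : ‖x‖ = 1) {p : ℕ} (hp : 1 ≤ p) : Li p x = x * lerch p x 1 := by
  refine Tendsto.limUnder_eq (((tendsto_lerchSum hx one_mem_lerchDomain hp).const_mul x).congr ?_)
  intro n
  rw [lerchSum, mul_sub, mul_counterterm, zetaFin_eq]

lemma ti_eq {x : ℂ} (hx : ‖x‖ = 1) {p : ℕ} (hp : 1 ≤ p) : ti p x = x * lerch p x (1 / 2) := by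
  refine Tendsto.limUnder_eq (((tendsto_lerchSum hx half_mem_lerchDomain hp).const_mul x).congr ?_)
  intro n
  rw [lerchSum, mul_sub, mul_counterterm, tFin_eq]

/-! ### Principal parts and the residue theorem -/

/-- The principal part `∑_{i<m} a_i (s-α)^{-i-2} + c (s-α)⁻¹`. -/
noncomputable def principalPart (m : ℕ) (a : ℕ → ℂ) (c α s : ℂ) : ℂ :=
  (∑ i ∈ range m, a i * (s - α) ^ (-(i + 2 : ℤ))) + c * (s - α)⁻¹

/-- Near `α`, the function `f` is the sum of a principal part with residue `c` and of an analytic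
function. -/
def HasResidue (f : ℂ → ℂ) (α c : ℂ) : Prop :=
  ∃ (m : ℕ) (a : ℕ → ℂ) (g : ℂ → ℂ), AnalyticAt ℂ g α ∧
    ∀ᶠ s in 𝓝[≠] α, f s = principalPart m a c α s + g s

lemma differentiableAt_principalPart (m : ℕ) (a : ℕ → ℂ) (c : ℂ) {α s : ℂ} (hs : s ≠ α) :
    DifferentiableAt ℂ (principalPart m a c α) s := by
  have h : s - α ≠ 0 := sub_ne_zero.mpr hs
  unfold principalPart
  refine DifferentiableAt.add (DifferentiableAt.fun_sum fun i _ => ?_) ?_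
  · exact (DifferentiableAt.zpow (f := fun s => s - α) (by fun_prop) (Or.inl h)).const_mul _
  · exact (DifferentiableAt.inv (h := fun s => s - α) (by fun_prop) h).const_mul _

lemma analyticAt_principalPart (m : ℕ) (a : ℕ → ℂ) (c : ℂ) {α s : ℂ} (hs : s ≠ α) :
    AnalyticAt ℂ (principalPart m a c α) s :=
  DifferentiableOn.analyticAt (s := {α}ᶜ)
    (fun _ hw => (differentiableAt_principalPart m a c hw).differentiableWithinAt)
    (isOpen_compl_singleton.mem_nhds hs)

/-- Powers with exponent at most -2 have primitives and contribute nothing. The pole may be any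
point of the disc, as the residue theorem requires. -/
lemma circleIntegral_principalPart (m : ℕ) (a : ℕ → ℂ) (c : ℂ) {α w : ℂ} {R : ℝ}
    (hα : α ∈ Metric.ball w R) :
    ∮ s in C(w, R), principalPart m a c α s = 2 * Real.pi * Complex.I * c := by
  have hR : 0 < R := Metric.pos_of_mem_ball hα
  have hne : ∀ s ∈ Metric.sphere w R, s - α ≠ 0 := fun s hs h => by
    rw [sub_eq_zero.mp h, Metric.mem_sphere] at hs
    rw [Metric.mem_ball] at hα
    exact hα.ne hs
  have hz : ∀ n : ℤ, CircleIntegrable (fun s => (s - α) ^ n) w R := fun n =>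
    ContinuousOn.circleIntegrable hR.le
      (ContinuousOn.zpow₀ (by fun_prop) n fun s hs => Or.inl (hne s hs))
  have hi : CircleIntegrable (fun s => (s - α)⁻¹) w R := by simpa using hz (-1)
  unfold principalPart
  rw [circleIntegral.integral_add, circleIntegral.integral_fun_sum]
  · have h0 : ∀ i ∈ range m, ∮ s in C(w, R), a i * (s - α) ^ (-(i + 2 : ℤ)) = 0 := fun i _ => by
      rw [circleIntegral.integral_const_mul, circleIntegral.integral_sub_zpow_of_ne (by omega),
        mul_zero]
    rw [sum_eq_zero h0, circleIntegral.integral_const_mul,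
      circleIntegral.integral_sub_inv_of_mem_ball hα]
    ring
  · exact fun i _ => (hz _).const_fun_smul (a := a i)
  · exact CircleIntegrable.fun_sum _ fun i _ => (hz _).const_fun_smul (a := a i)
  · exact hi.const_fun_smul (a := c)

/-- For all small radii the normalised integral is exactly c, so the limit defining `residue` exists
and is c. -/
lemma HasResidue.residue_eq {f : ℂ → ℂ} {α c : ℂ} (h : HasResidue f α c) : residue f α = c := by
  obtain ⟨m, a, g, hg, hf⟩ := h
  refine Tendsto.limUnder_eq (tendsto_const_nhds.congr' ?_)
  have h1 := eventually_nhdsWithin_iff.mp hf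
  obtain ⟨δ, hδ, hball⟩ := Metric.eventually_nhds_iff_ball.mp (h1.and hg.eventually_analyticAt)
  filter_upwards [Ioo_mem_nhdsGT hδ] with ε hε
  have hsub : ∀ s ∈ Metric.closedBall α ε, s ∈ Metric.ball α δ := fun s hs =>
    Metric.closedBall_subset_ball hε.2 hs
  have hgc : ContinuousOn g (Metric.closedBall α ε) := fun s hs =>
    (hball s (hsub s hs)).2.continuousAt.continuousWithinAt
  have hne : ∀ s ∈ Metric.sphere α ε, s ≠ α := fun s hs h => by
    rw [h, Metric.mem_sphere, dist_self] at hs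
    exact hε.1.ne hs
  rw [circleIntegral.integral_congr hε.1.le
      (g := fun s => principalPart m a c α s + g s)
      (fun s hs => (hball s (hsub s (Metric.sphere_subset_closedBall hs))).1 (hne s hs)),
    circleIntegral.integral_add, circleIntegral_principalPart m a c (Metric.mem_ball_self hε.1),
    Complex.circleIntegral_eq_zero_of_differentiable_on_off_countable hε.1.le
      Set.countable_empty hgc fun s hs =>
        (hball s (hsub s (Metric.ball_subset_closedBall hs.1))).2.differentiableAt]
  · have : (2 * (Real.pi : ℂ) * Complex.I) ≠ 0 := Complex.two_pi_I_ne_zero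
    rw [add_zero, inv_mul_cancel_left₀ this]
  · exact ContinuousOn.circleIntegrable hε.1.le fun s hs =>
      (differentiableAt_principalPart m a c (hne s hs)).continuousAt.continuousWithinAt
  · exact ContinuousOn.circleIntegrable hε.1.le (hgc.mono Metric.sphere_subset_closedBall)

/-- The residue theorem for a disc. -/
theorem circleIntegral_eq_sum_residues {w : ℂ} {R : ℝ} (hR : 0 ≤ R) (c : ℂ → ℂ) (S : Finset ℂ)
    (hS : ∀ α ∈ S, α ∈ Metric.ball w R) : ∀ f : ℂ → ℂ,
    (∀ s ∈ Metric.closedBall w R, s ∉ S → DifferentiableAt ℂ f s) →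
    (∀ α ∈ S, HasResidue f α (c α)) →
    ∮ s in C(w, R), f s = 2 * Real.pi * Complex.I * ∑ α ∈ S, c α := by
  classical
  induction S using Finset.induction_on with
  | empty =>
    intro f hf _
    rw [Complex.circleIntegral_eq_zero_of_differentiable_on_off_countable hR Set.countable_empty
      (fun s hs => (hf s hs (by simp)).continuousAt.continuousWithinAt)
      (fun s hs => hf s (Metric.ball_subset_closedBall hs.1) (by simp))]
    simp
  | insert α S hα ih =>
    intro f hf hres
    obtain ⟨m, a, g, hg, hfg⟩ := hres α (mem_insert_self α S)
    set P := principalPart m a (c α) α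
    have hαball := hS α (mem_insert_self α S)
    have hsphere : ∀ s ∈ Metric.sphere w R, ∀ β ∈ insert α S, s ≠ β := fun s hs β hβ h => by
      have := hS β hβ
      rw [← h, Metric.mem_ball] at this
      rw [Metric.mem_sphere] at hs
      exact this.ne hs
    -- Removing the principal part at α leaves a removable singularity, filled in by the value g α.
    -- Since P is analytic at the other points of S, the residues there are unchanged and the
    -- induction hypothesis applies to f'.
    set f' : ℂ → ℂ := Function.update (fun s => f s - P s) α (g α) with hf'
    have hoff : ∀ s, s ≠ α → f' s = f s - P s := fun s hs => Function.update_of_ne hs _ _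
    have hoff' : ∀ s, s ≠ α → f' =ᶠ[𝓝 s] fun s => f s - P s := fun s hs => by
      filter_upwards [isOpen_compl_singleton.mem_nhds hs] with t ht using hoff t ht
    have hat : f' =ᶠ[𝓝 α] g := by
      filter_upwards [eventually_nhdsWithin_iff.mp hfg] with s hs
      by_cases h : s = α
      · rw [h, hf', Function.update_self]
      · rw [hoff s h, hs h]
        ring
    have key := ih (fun β hβ => hS β (mem_insert_of_mem hβ)) f' (fun s hs hsS => by
        by_cases h : s = α
        · rw [h]
          exact hat.differentiableAt_iff.mpr hg.differentiableAt
        · rw [(hoff' s h).differentiableAt_iff]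
          exact (hf s hs (by simp [h, hsS])).sub (differentiableAt_principalPart m a _ h))
      (fun β hβ => by
        have hβα : β ≠ α := fun h => hα (h ▸ hβ)
        obtain ⟨m', a', g', hg', hfg'⟩ := hres β (mem_insert_of_mem hβ)
        refine ⟨m', a', fun s => g' s - P s,
          hg'.sub (analyticAt_principalPart m a _ hβα), ?_⟩
        filter_upwards [hfg', nhdsWithin_le_nhds (hoff' β hβα)] with s h1 h2
        rw [h2, h1]
        ring)
    have hfP : ∮ s in C(w, R), f s = ∮ s in C(w, R), (f' s + P s) :=
      circleIntegral.integral_congr hR fun s hs => by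
        simp only [hoff s (hsphere s hs α (mem_insert_self α S))]
        ring
    rw [hfP, circleIntegral.integral_add, key, circleIntegral_principalPart m a _ hαball,
      sum_insert hα]
    · ring
    · refine ContinuousOn.circleIntegrable hR fun s hs => ?_
      have hsα := hsphere s hs α (mem_insert_self α S)
      refine ContinuousAt.continuousWithinAt (DifferentiableAt.continuousAt (𝕜 := ℂ) ?_)
      rw [(hoff' s hsα).differentiableAt_iff]
      exact (hf s (Metric.sphere_subset_closedBall hs) fun h => hsphere s hs s h rfl).sub
        (differentiableAt_principalPart m a _ hsα)
    · exact ContinuousOn.circleIntegrable hR fun s hs =>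
        (differentiableAt_principalPart m a _
          (hsphere s hs α (mem_insert_self α S))).continuousAt.continuousWithinAt

/-! ### Taylor coefficients as formal power series -/

/-- The `n`-th Taylor coefficient of `f` at `a`. -/
noncomputable def taylor (f : ℂ → ℂ) (a : ℂ) (n : ℕ) : ℂ := iteratedDeriv n f a / (n.factorial : ℂ)

lemma taylor_zero (f : ℂ → ℂ) (a : ℂ) : taylor f a 0 = f a := by simp [taylor]

lemma taylor_add {f g : ℂ → ℂ} {a : ℂ} (hf : AnalyticAt ℂ f a) (hg : AnalyticAt ℂ g a) (n : ℕ) :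
    taylor (fun s => f s + g s) a n = taylor f a n + taylor g a n := by
  rw [taylor, iteratedDeriv_fun_add hf.contDiffAt hg.contDiffAt, add_div, taylor, taylor]

lemma taylor_const_mul (c : ℂ) (f : ℂ → ℂ) (a : ℂ) (n : ℕ) :
    taylor (fun s => c * f s) a n = c * taylor f a n := by
  rw [taylor, iteratedDeriv_const_mul_field, mul_div_assoc, taylor]

lemma taylor_sum {ι : Type*} {f : ι → ℂ → ℂ} {a : ℂ} {I : Finset ι}
    (hf : ∀ i ∈ I, AnalyticAt ℂ (f i) a) (n : ℕ) :
    taylor (fun s => ∑ i ∈ I, f i s) a n = ∑ i ∈ I, taylor (f i) a n := by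
  rw [taylor, iteratedDeriv_fun_sum fun i hi => (hf i hi).contDiffAt, sum_div]
  rfl

lemma taylor_iteratedDeriv (f : ℂ → ℂ) (a : ℂ) (m n : ℕ) :
    taylor (iteratedDeriv m f) a n
      = (m.factorial : ℂ) * ((n + m).choose m : ℂ) * taylor f a (n + m) := by
  have h : iteratedDeriv n (iteratedDeriv m f) = iteratedDeriv (n + m) f := by
    simp only [iteratedDeriv_eq_iterate, Function.iterate_add_apply]
  have h1 : ((n + m).factorial : ℂ) = (n + m).choose m * m.factorial * n.factorial := by
    rw [← Nat.add_choose_mul_factorial_mul_factorial n m, ← Nat.choose_symm_add]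
    push_cast
    ring
  have h2 : (n.factorial : ℂ) ≠ 0 := Nat.cast_ne_zero.mpr n.factorial_ne_zero
  have h3 : ((n + m).factorial : ℂ) ≠ 0 := Nat.cast_ne_zero.mpr (n + m).factorial_ne_zero
  rw [taylor, h, taylor]
  field_simp
  rw [h1]
  ring

/-- The Taylor series of `f` at `a`. -/
noncomputable def taylorSeries (f : ℂ → ℂ) (a : ℂ) : PowerSeries ℂ := PowerSeries.mk (taylor f a)

lemma coeff_taylorSeries (f : ℂ → ℂ) (a : ℂ) (n : ℕ) :
    PowerSeries.coeff n (taylorSeries f a) = taylor f a n := PowerSeries.coeff_mk _ _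

/-- This is the Leibniz rule; it reduces the residues of products to algebra in the ring of formal
power series. -/
lemma taylorSeries_mul {f g : ℂ → ℂ} {a : ℂ} (hf : AnalyticAt ℂ f a) (hg : AnalyticAt ℂ g a) :
    taylorSeries (fun s => f s * g s) a = taylorSeries f a * taylorSeries g a := by
  ext n
  rw [PowerSeries.coeff_mul, Finset.Nat.sum_antidiagonal_eq_sum_range_succ_mk, coeff_taylorSeries,
    taylor, iteratedDeriv_fun_mul hf.contDiffAt hg.contDiffAt, sum_div]
  refine sum_congr rfl fun i hi => ?_
  have hin : i ≤ n := Nat.lt_succ_iff.mp (mem_range.mp hi)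
  rw [coeff_taylorSeries, coeff_taylorSeries, taylor, taylor, Nat.cast_choose ℂ hin]
  have h1 : ∀ k : ℕ, (k.factorial : ℂ) ≠ 0 := fun k => Nat.cast_ne_zero.mpr k.factorial_ne_zero
  field_simp [h1]

lemma taylorSeries_add {f g : ℂ → ℂ} {a : ℂ} (hf : AnalyticAt ℂ f a) (hg : AnalyticAt ℂ g a) :
    taylorSeries (fun s => f s + g s) a = taylorSeries f a + taylorSeries g a := by
  ext n
  simp only [map_add, coeff_taylorSeries, taylor_add hf hg]

lemma taylorSeries_const (c a : ℂ) : taylorSeries (fun _ => c) a = PowerSeries.C c := by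
  ext n
  rw [coeff_taylorSeries, taylor, iteratedDeriv_const, PowerSeries.coeff_C]
  split_ifs <;> simp_all

lemma taylorSeries_sub_self (a : ℂ) : taylorSeries (fun s => s - a) a = PowerSeries.X := by
  ext n
  rw [coeff_taylorSeries, taylor, PowerSeries.coeff_X]
  rcases n with _ | _ | n
  · simp
  · simp
  · rw [iteratedDeriv_succ', iteratedDeriv_succ']
    simp

lemma taylorSeries_sub_self_pow (a : ℂ) (n : ℕ) :
    taylorSeries (fun s => (s - a) ^ n) a = PowerSeries.X ^ n := by
  induction n with
  | zero => simpa using taylorSeries_const 1 a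
  | succ n ih =>
    simp only [pow_succ]
    rw [taylorSeries_mul (by fun_prop) (by fun_prop), ih, taylorSeries_sub_self]

/-- Compare coefficients in f(s) = f(a) + (s-a) · `dslope f a s`. -/
lemma taylor_dslope {f : ℂ → ℂ} {a : ℂ} (hf : AnalyticAt ℂ f a) (n : ℕ) :
    taylor (dslope f a) a n = taylor f a (n + 1) := by
  have hd : AnalyticAt ℂ (dslope f a) a :=
    hf.hasFPowerSeriesAt.has_fpower_series_dslope_fslope.analyticAt
  have h : taylorSeries f a = taylorSeries (fun s => f a + (s - a) * dslope f a s) a := by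
    congr 1
    ext s
    have := sub_smul_dslope f a s
    rw [smul_eq_mul] at this
    rw [this]
    ring
  rw [taylorSeries_add analyticAt_const (by fun_prop), taylorSeries_mul (by fun_prop) hd,
    taylorSeries_sub_self, taylorSeries_const] at h
  have h2 := congrArg (PowerSeries.coeff (n + 1)) h
  rw [map_add, PowerSeries.coeff_succ_X_mul, coeff_taylorSeries, coeff_taylorSeries,
    PowerSeries.coeff_C, if_neg n.succ_ne_zero, zero_add] at h2
  exact h2.symm

/-- Induction on the order of the pole: the leading term G(α)(s-α)^(-m-1) is split off, and G is
replaced by its slope function, which lowers the order and shifts the Taylor coefficients by one. -/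
lemma hasResidue_of_eventuallyEq_inv_pow_mul {α : ℂ} (m : ℕ) : ∀ {f G : ℂ → ℂ},
    AnalyticAt ℂ G α → (∀ᶠ s in 𝓝[≠] α, f s = ((s - α) ^ (m + 1))⁻¹ * G s) →
    HasResidue f α (taylor G α m) := by
  induction m with
  | zero =>
    intro f G hG hf
    refine ⟨0, 0, dslope G α,
      hG.hasFPowerSeriesAt.has_fpower_series_dslope_fslope.analyticAt, ?_⟩
    filter_upwards [hf, self_mem_nhdsWithin] with s hs hsα
    have hne : s - α ≠ 0 := sub_ne_zero.mpr hsα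
    have := sub_smul_dslope G α s
    rw [smul_eq_mul] at this
    rw [hs, principalPart, range_zero, sum_empty, taylor_zero, ← sub_add_cancel (G s) (G α), ← this]
    field_simp
    ring
  | succ m ih =>
    intro f G hG hf
    have hd := hG.hasFPowerSeriesAt.has_fpower_series_dslope_fslope.analyticAt
    obtain ⟨k, a, g, hg, hfg⟩ := ih (f := fun s => f s - G α * ((s - α) ^ (m + 2))⁻¹) hd (by
      filter_upwards [hf, self_mem_nhdsWithin] with s hs hsα
      have hne : s - α ≠ 0 := sub_ne_zero.mpr hsα
      have := sub_smul_dslope G α s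
      rw [smul_eq_mul] at this
      rw [hs, ← sub_add_cancel (G s) (G α), ← this]
      field_simp
      ring)
    rw [taylor_dslope hG] at hfg
    -- The split-off term has exponent -(m+2), which is the entry i = m of a principal part. The
    -- length k + m + 1 has room for it and for the k old coefficients.
    refine ⟨k + m + 1, fun i => (if i < k then a i else 0) + if i = m then G α else 0, g, hg, ?_⟩
    filter_upwards [hfg] with s hs
    rw [sub_eq_iff_eq_add] at hs
    simp only [hs, principalPart, add_mul, sum_add_distrib, ite_mul, zero_mul]
    rw [sum_ite_eq' (range (k + m + 1)), if_pos (mem_range.mpr (by omega)), ← sum_filter]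
    have h1 : (range (k + m + 1)).filter (· < k) = range k := by
      ext i
      simp only [mem_filter, mem_range]
      omega
    have h2 : (s - α) ^ (-(m + 2 : ℤ)) = ((s - α) ^ (m + 2))⁻¹ := by
      rw [zpow_neg]
      norm_cast
    rw [h1, h2]
    ring

/-! ### Laurent expansions of φ and Φ -/

lemma phi_eq_lerch_one (x : ℂ) : (fun w => phi w x) = lerch 1 x := by
  ext w
  exact phi_eq_lerch w x

lemma norm_inv_eq_one {x : ℂ} (hx : ‖x‖ = 1) : ‖x⁻¹‖ = 1 := by rw [norm_inv, hx, inv_one]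

lemma ne_zero_of_norm_eq_one {x : ℂ} (hx : ‖x‖ = 1) : x ≠ 0 := fun h => by simp [h] at hx

/-- The normalised derivative `(-1)^(p-1) φ^{(p-1)}(s;x) / (p-1)!`. -/
noncomputable def lerchDeriv (p : ℕ) (x s : ℂ) : ℂ :=
  (-1) ^ (p - 1) * ((p - 1).factorial : ℂ)⁻¹ * iteratedDeriv (p - 1) (lerch 1 x) s

lemma kernel_eq {p : Fin 2 → ℕ} (hp : ∀ j, 1 ≤ p j) (h x : ℂ) (y : Fin 2 → ℂ) (s : ℂ) :
    kernel h x p y s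
      = Phi s x * lerchDeriv (p 0) (y 0) (s + h) * lerchDeriv (p 1) (y 1) (s + h) := by
  obtain ⟨m, hm⟩ := Nat.exists_eq_add_of_le' (hp 0)
  obtain ⟨n, hn⟩ := Nat.exists_eq_add_of_le' (hp 1)
  simp only [kernel, lerchDeriv, phi_eq_lerch_one, hm, hn, Nat.add_sub_cancel]
  -- The sign of the kernel distributes over the two φ factors and cancels the signs of their
  -- derivatives.
  have : (-1 : ℂ) ^ (m + 1 + (n + 1)) = (-1) ^ m * (-1) ^ n := by ring
  rw [this, div_eq_mul_inv, mul_inv]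
  ring

lemma lerchDeriv_eq_lerch {x s : ℂ} (hx : ‖x‖ = 1) (hs : s ∈ lerchDomain) {p : ℕ} (hp : 1 ≤ p) :
    lerchDeriv p x s = lerch p x s := by
  obtain ⟨m, rfl⟩ := Nat.exists_eq_add_of_le' hp
  have h0 : (m.factorial : ℂ) ≠ 0 := Nat.cast_ne_zero.mpr m.factorial_ne_zero
  rw [lerchDeriv, Nat.add_sub_cancel, iteratedDeriv_lerch_one hx hs]
  have h1 : (-1 : ℂ) ^ m * (-1) ^ m = 1 := by rw [← mul_pow]; simp
  field_simp
  linear_combination lerch (m + 1) x s * h1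

lemma taylor_comp_add_const (f : ℂ → ℂ) (c a : ℂ) (n : ℕ) :
    taylor (fun s => f (s + c)) a n = taylor f (a + c) n := by
  rw [taylor, iteratedDeriv_comp_add_const, taylor]

lemma taylor_comp_const_sub (f : ℂ → ℂ) (c a : ℂ) (n : ℕ) :
    taylor (fun s => f (c - s)) a n = (-1) ^ n * taylor f (c - a) n := by
  simp only [taylor, iteratedDeriv_comp_const_sub, smul_eq_mul, mul_div_assoc]

lemma taylor_lerch_one {x b : ℂ} (hx : ‖x‖ = 1) (hb : b ∈ lerchDomain) (i : ℕ) :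
    taylor (lerch 1 x) b i = (-1) ^ i * lerch (i + 1) x b := by
  have h0 : (i.factorial : ℂ) ≠ 0 := Nat.cast_ne_zero.mpr i.factorial_ne_zero
  rw [taylor, iteratedDeriv_lerch_one hx hb]
  field_simp

lemma taylor_normalised_iteratedDeriv (f : ℂ → ℂ) (a : ℂ) (m i : ℕ) :
    taylor (fun s => (-1) ^ m * ((m.factorial : ℂ))⁻¹ * iteratedDeriv m f s) a i
      = (-1) ^ m * ((i + m).choose m : ℂ) * taylor f a (i + m) := by
  have h0 : (m.factorial : ℂ) ≠ 0 := Nat.cast_ne_zero.mpr m.factorial_ne_zero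
  rw [taylor_const_mul, taylor_iteratedDeriv]
  field_simp

lemma analyticAt_iteratedDeriv {f : ℂ → ℂ} {a : ℂ} (hf : AnalyticAt ℂ f a) (m : ℕ) :
    AnalyticAt ℂ (iteratedDeriv m f) a := by
  induction m with
  | zero => simpa using hf
  | succ m ih =>
    rw [iteratedDeriv_succ]
    exact ih.deriv

lemma analyticAt_lerchDeriv {x s : ℂ} (hx : ‖x‖ = 1) (hs : s ∈ lerchDomain) (p : ℕ) :
    AnalyticAt ℂ (lerchDeriv p x) s := by
  have := analyticAt_iteratedDeriv (analyticAt_lerch_one hx hs) (p - 1)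
  unfold lerchDeriv
  fun_prop

lemma taylor_lerchDeriv {x b : ℂ} (hx : ‖x‖ = 1) (hb : b ∈ lerchDomain) {p : ℕ} (hp : 1 ≤ p)
    (i : ℕ) : taylor (lerchDeriv p x) b i
      = ((i + p - 1).choose (p - 1) : ℂ) * (-1) ^ i * lerch (i + p) x b := by
  obtain ⟨m, rfl⟩ := Nat.exists_eq_add_of_le' hp
  have h := taylor_normalised_iteratedDeriv (lerch 1 x) b m i
  rw [taylor_lerch_one hx hb, pow_add] at h
  have h1 : (-1 : ℂ) ^ m * (-1) ^ m = 1 := by rw [← mul_pow]; simp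
  unfold lerchDeriv
  simp only [← add_assoc, Nat.add_sub_cancel]
  rw [h]
  linear_combination ((i + m).choose m : ℂ) * (-1) ^ i * lerch (i + m + 1) x b * h1

/-- Two nonpositive integers at distance less than 1 coincide, so the excluded points are isolated.
-/
lemma eventually_mem_lerchDomain (a : ℂ) : ∀ᶠ s in 𝓝[≠] a, s ∈ lerchDomain := by
  by_cases ha : a ∈ lerchDomain
  · exact nhdsWithin_le_nhds (isOpen_lerchDomain.mem_nhds ha)
  · simp only [lerchDomain, Set.mem_ofPred_eq, not_forall, not_not] at ha
    obtain ⟨n, hn⟩ := ha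
    have hb : Metric.ball a 1 ∈ 𝓝 a := Metric.ball_mem_nhds a one_pos
    filter_upwards [nhdsWithin_le_nhds hb, self_mem_nhdsWithin] with s hs hsa k hk
    rw [Metric.mem_ball, dist_eq_norm] at hs
    have h1 : s - a = ((n - k : ℤ) : ℂ) := by
      push_cast
      linear_combination hk - hn
    rw [h1, Complex.norm_intCast] at hs
    have h2 : (n - k : ℤ) = 0 := by
      rw [← Int.abs_lt_one_iff]
      exact_mod_cast hs
    rw [h2, Int.cast_zero, sub_eq_zero] at h1
    exact hsa h1

/-- The part of `φ(s;x)` that is analytic at `-n`. -/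
noncomputable def lerchRegular (n : ℕ) (x s : ℂ) : ℂ :=
  (∑ k ∈ range n, x ^ k * ((k : ℂ) + s)⁻¹) + x ^ (n + 1) * lerch 1 x (s + (n + 1))

lemma lerch_one_eq_inv_add {x s : ℂ} (hx : ‖x‖ = 1) (hs : s ∈ lerchDomain) (n : ℕ) :
    lerch 1 x s = x ^ n * ((n : ℂ) + s)⁻¹ + lerchRegular n x s := by
  rw [lerch_eq_sum_add hx hs le_rfl (n + 1), sum_range_succ, lerchRegular]
  simp only [pow_one, div_eq_mul_inv]
  push_cast
  ring

/-- Needed at -n itself, where the k-th denominators with k < n do not vanish, and at the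
neighbouring points, where the derivative of φ is taken apart. -/
lemma analyticAt_lerchRegular {x s : ℂ} (hx : ‖x‖ = 1) {n : ℕ} (h1 : ∀ k < n, (k : ℂ) + s ≠ 0)
    (h2 : s + (n + 1) ∈ lerchDomain) : AnalyticAt ℂ (lerchRegular n x) s := by
  unfold lerchRegular
  refine AnalyticAt.add (Finset.analyticAt_fun_sum _ fun k hk => ?_) ?_
  · exact analyticAt_const.mul ((analyticAt_const.add analyticAt_id).inv (h1 k (mem_range.mp hk)))
  · refine analyticAt_const.mul ?_
    exact AnalyticAt.fun_comp (g := lerch 1 x) (f := fun w => w + ((n : ℂ) + 1))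
      (analyticAt_lerch_one hx h2) (by fun_prop)

lemma natCast_sub_natCast_ne_zero {k n : ℕ} (h : k < n) : (k : ℂ) + -(n : ℂ) ≠ 0 := by
  rw [← sub_eq_add_neg, sub_ne_zero]
  exact_mod_cast h.ne

lemma analyticAt_lerchRegular_neg {x : ℂ} (hx : ‖x‖ = 1) (n : ℕ) :
    AnalyticAt ℂ (lerchRegular n x) (-(n : ℂ)) :=
  analyticAt_lerchRegular hx (fun _ hk => natCast_sub_natCast_ne_zero hk)
    (by simpa using one_mem_lerchDomain)

/-- The tail is evaluated at 1 and gives Li. In the head, the denominator k - n is minus the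
positive integer n - k; reversing the order of summation and pulling out x^n gives the finite sum at
x⁻¹, and the sign (-1)^i (-1)^(i+1) = -1 explains the minus. -/
lemma taylor_lerchRegular {x : ℂ} (hx : ‖x‖ = 1) (n i : ℕ) :
    taylor (lerchRegular n x) (-(n : ℂ)) i
      = x ^ n * ((-1) ^ i * Li (i + 1) x - zetaFin n (i + 1) x⁻¹) := by
  have hx0 := ne_zero_of_norm_eq_one hx
  have hfac : (i.factorial : ℂ) ≠ 0 := Nat.cast_ne_zero.mpr i.factorial_ne_zero
  have hsum : ∀ k ∈ range n, AnalyticAt ℂ (fun s : ℂ => x ^ k * ((k : ℂ) + s)⁻¹) (-(n : ℂ)) :=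
    fun k hk => analyticAt_const.mul ((analyticAt_const.add analyticAt_id).inv
      (natCast_sub_natCast_ne_zero (mem_range.mp hk)))
  have hlast : AnalyticAt ℂ (fun s : ℂ => x ^ (n + 1) * lerch 1 x (s + (n + 1))) (-(n : ℂ)) := by
    refine analyticAt_const.mul ?_
    exact AnalyticAt.fun_comp (g := lerch 1 x) (f := fun w => w + ((n : ℂ) + 1))
      (analyticAt_lerch_one hx (by simpa using one_mem_lerchDomain)) (by fun_prop)
  unfold lerchRegular
  rw [taylor_add (Finset.analyticAt_fun_sum _ hsum) hlast, taylor_sum hsum,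
    taylor_const_mul, taylor_comp_add_const, neg_add_cancel_left,
    taylor_lerch_one hx one_mem_lerchDomain, Li_eq hx (Nat.le_add_left 1 i), zetaFin,
    sum_Icc_one_eq_sum_range, ← sum_range_reflect (fun k => _ / _), mul_sub, mul_sum,
    sub_eq_neg_add, ← sum_neg_distrib]
  congr 1
  · refine sum_congr rfl fun k hk => ?_
    have hkn := mem_range.mp hk
    obtain ⟨d, rfl⟩ := Nat.exists_eq_add_of_lt hkn
    have e1 : k + d + 1 - 1 - k + 1 = d + 1 := by omega
    have hd : ((d + 1 : ℕ) : ℂ) ≠ 0 := Nat.cast_ne_zero.mpr d.succ_ne_zero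
    have e2 : (k : ℂ) + -((k + d + 1 : ℕ) : ℂ) = -((d + 1 : ℕ) : ℂ) := by push_cast; ring
    have e3 : (-((d + 1 : ℕ) : ℂ)) ^ (i + 1) = (-1) ^ (i + 1) * ((d + 1 : ℕ) : ℂ) ^ (i + 1) := by
      rw [← mul_pow, neg_one_mul]
    rw [taylor_const_mul, taylor, iteratedDeriv_inv_natCast_add, e1, e2, e3, inv_pow,
      show x ^ (k + d + 1) = x ^ k * x ^ (d + 1) by ring]
    have h1 : (-1 : ℂ) ^ (i + 1) ≠ 0 := by simp
    have hxd : x ^ (d + 1) ≠ 0 := pow_ne_zero _ hx0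
    have h2 : (-1 : ℂ) ^ i * (-1) ^ i = 1 := by rw [← mul_pow]; simp
    have h3 : (-1 : ℂ) ^ (i + 1) = - (-1) ^ i := by ring
    rw [h3] at h1 ⊢
    field_simp
  · ring

/-- The Laurent expansion of `(-1)^(p-1) φ^{(p-1)}(s;x) / (p-1)!` at `-n`. -/
lemma exists_lerchDeriv_expansion {x : ℂ} (hx : ‖x‖ = 1) (n : ℕ) {p : ℕ} (hp : 1 ≤ p) :
    ∃ g : ℂ → ℂ, AnalyticAt ℂ g (-(n : ℂ)) ∧
      (∀ i, taylor g (-(n : ℂ)) i = ((i + p - 1).choose (p - 1) : ℂ)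
        * ((-1) ^ i * Li (i + p) x + (-1) ^ p * zetaFin n (i + p) x⁻¹)) ∧
      ∀ᶠ s in 𝓝[≠] (-(n : ℂ)),
        lerchDeriv p x s = x ^ n * (((s - -(n : ℂ)) ^ p)⁻¹ + g s) := by
  obtain ⟨m, rfl⟩ := Nat.exists_eq_add_of_le' hp
  have hx0 := pow_ne_zero n (ne_zero_of_norm_eq_one hx)
  have hfac : (m.factorial : ℂ) ≠ 0 := Nat.cast_ne_zero.mpr m.factorial_ne_zero
  have h1 : (-1 : ℂ) ^ m * (-1) ^ m = 1 := by rw [← mul_pow]; simp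
  refine ⟨fun s => (x ^ n)⁻¹ *
    ((-1) ^ m * ((m.factorial : ℂ))⁻¹ * iteratedDeriv m (lerchRegular n x) s), ?_, fun i => ?_, ?_⟩
  · have := analyticAt_iteratedDeriv (analyticAt_lerchRegular_neg hx n) m
    fun_prop
  · rw [taylor_const_mul, taylor_normalised_iteratedDeriv, taylor_lerchRegular hx, ← add_assoc,
      Nat.add_sub_cancel, Nat.add_sub_cancel, pow_add (-1 : ℂ) i m, pow_succ (-1 : ℂ) m]
    field_simp
    linear_combination ((i + m).choose m : ℂ) * (-1) ^ i * Li (i + m + 1) x * h1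
  · filter_upwards [eventually_mem_lerchDomain (-(n : ℂ)), self_mem_nhdsWithin] with s hs hsn
    have hev : lerch 1 x =ᶠ[𝓝 s] fun w => x ^ n * ((n : ℂ) + w)⁻¹ + lerchRegular n x w := by
      filter_upwards [isOpen_lerchDomain.mem_nhds hs] with w hw using lerch_one_eq_inv_add hx hw n
    have hreg : AnalyticAt ℂ (lerchRegular n x) s :=
      analyticAt_lerchRegular hx (fun k _ => hs k) (by
        have := add_natCast_mem_lerchDomain hs (n + 1)
        push_cast at this
        exact this)
    have hinv : ContDiffAt ℂ m (fun w : ℂ => x ^ n * ((n : ℂ) + w)⁻¹) s :=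
      contDiffAt_const.mul ((contDiffAt_const.add contDiffAt_id).inv (hs n))
    rw [lerchDeriv, Nat.add_sub_cancel, hev.iteratedDeriv_eq,
      iteratedDeriv_fun_add hinv hreg.contDiffAt, iteratedDeriv_const_mul_field,
      iteratedDeriv_inv_natCast_add, sub_neg_eq_add, add_comm s]
    have hns : ((n : ℂ) + s) ^ (m + 1) ≠ 0 := pow_ne_zero _ (hs n)
    field_simp
    linear_combination x ^ n * m.factorial * h1

lemma mem_lerchDomain_of_forall_int {s : ℂ} (hs : ∀ m : ℤ, s ≠ m) : s ∈ lerchDomain := fun k hk =>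
  hs (-k) (by push_cast; linear_combination hk)

lemma neg_ne_int {s : ℂ} (hs : ∀ m : ℤ, s ≠ m) (m : ℤ) : -s ≠ m := fun h =>
  hs (-m) (by push_cast; linear_combination -h)

lemma add_int_ne_int {s : ℂ} (hs : ∀ m : ℤ, s ≠ m) (n m : ℤ) : s + n ≠ m := fun h =>
  hs (m - n) (by push_cast; linear_combination h)

lemma Phi_eq_of_mem {x s : ℂ} (hx : ‖x‖ = 1) (hs : s ∈ lerchDomain) :
    Phi s x = x * lerch 1 x (s + 1) - lerch 1 x⁻¹ (0 - s) := by
  rw [Phi, phi_eq_lerch, phi_eq_lerch, lerch_eq_add hx hs le_rfl, pow_one, zero_sub]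
  ring

lemma Phi_eq_of_forall_int {x s : ℂ} (hx : ‖x‖ = 1) (hs : ∀ m : ℤ, s ≠ m) :
    Phi s x = s⁻¹ + (x * lerch 1 x (s + 1) - x⁻¹ * lerch 1 x⁻¹ (1 - s)) := by
  have h := mem_lerchDomain_of_forall_int (neg_ne_int hs)
  rw [← zero_sub] at h
  rw [Phi_eq_of_mem hx (mem_lerchDomain_of_forall_int hs),
    lerch_eq_add (norm_inv_eq_one hx) h le_rfl, pow_one, zero_sub, neg_add_eq_sub, one_div,
    inv_neg]
  ring

/-- By the shift equation each of the two φ changes by a factor x⁻¹ and a rational term; the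
rational terms combine with -1/s. -/
lemma Phi_add_one {x s : ℂ} (hx : ‖x‖ = 1) (hs : ∀ m : ℤ, s ≠ m) :
    Phi (s + 1) x = x⁻¹ * Phi s x := by
  have hx0 := ne_zero_of_norm_eq_one hx
  have hs1 : ∀ m : ℤ, s + 1 ≠ m := by simpa using add_int_ne_int hs 1
  have h := mem_lerchDomain_of_forall_int (neg_ne_int hs1)
  rw [Phi, Phi, phi_eq_lerch, phi_eq_lerch, phi_eq_lerch, phi_eq_lerch,
    lerch_eq_add hx (mem_lerchDomain_of_forall_int hs) le_rfl,
    lerch_eq_add (norm_inv_eq_one hx) h le_rfl, neg_add_rev, neg_add_cancel_comm, pow_one, pow_one,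
    ← neg_add_rev, one_div, one_div, one_div, inv_neg]
  field_simp
  ring

lemma Phi_add_int {x s : ℂ} (hx : ‖x‖ = 1) (hs : ∀ m : ℤ, s ≠ m) (m : ℤ) :
    Phi (s + m) x = (x ^ m)⁻¹ * Phi s x := by
  have hx0 := ne_zero_of_norm_eq_one hx
  induction m using Int.induction_on with
  | zero => simp
  | succ n ih =>
    push_cast at ih ⊢
    rw [← add_assoc, Phi_add_one hx (by simpa using add_int_ne_int hs n), ih, zpow_add_one₀ hx0,
      mul_inv]
    ring
  | pred n ih =>
    have h := Phi_add_one hx (add_int_ne_int hs (-n - 1))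
    push_cast at ih h ⊢
    rw [add_assoc, sub_add_cancel, ih] at h
    rw [zpow_sub_one₀ hx0, mul_inv, inv_inv]
    have h2 := congrArg (x * ·) h
    simp only [mul_inv_cancel_left₀ hx0] at h2
    rw [← h2]
    ring

lemma eventually_forall_int_ne (a : ℂ) : ∀ᶠ s : ℂ in 𝓝[≠] a, ∀ m : ℤ, s ≠ m := by
  have h1 := eventually_mem_lerchDomain a
  have h2 : ∀ᶠ s in 𝓝[≠] a, -s ∈ lerchDomain := by
    have : Tendsto (fun s : ℂ => -s) (𝓝[≠] a) (𝓝[≠] (-a)) :=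
      tendsto_nhdsWithin_of_tendsto_nhds_of_eventually_within _
        (tendsto_neg a |>.mono_left nhdsWithin_le_nhds)
        (eventually_mem_nhdsWithin.mono fun s hs h => hs (neg_injective h))
    exact this.eventually (eventually_mem_lerchDomain (-a))
  filter_upwards [h1, h2] with s hs1 hs2 m hm
  obtain ⟨k, rfl | rfl⟩ := m.eq_nat_or_neg
  · exact hs2 k (by rw [hm]; push_cast; ring)
  · exact hs1 k (by rw [hm]; push_cast; ring)

lemma analyticAt_lerch_one_comp_add {x b c : ℂ} (hx : ‖x‖ = 1) (h : b + c ∈ lerchDomain) :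
    AnalyticAt ℂ (fun s => lerch 1 x (s + c)) b :=
  AnalyticAt.fun_comp (g := lerch 1 x) (f := fun w => w + c) (analyticAt_lerch_one hx h)
    (by fun_prop)

lemma analyticAt_lerch_one_comp_sub {x b c : ℂ} (hx : ‖x‖ = 1) (h : c - b ∈ lerchDomain) :
    AnalyticAt ℂ (fun s => lerch 1 x (c - s)) b :=
  AnalyticAt.fun_comp (g := lerch 1 x) (f := fun w => c - w) (analyticAt_lerch_one hx h)
    (by fun_prop)

lemma taylor_sub {f g : ℂ → ℂ} {a : ℂ} (hf : AnalyticAt ℂ f a) (hg : AnalyticAt ℂ g a) (n : ℕ) :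
    taylor (fun s => f s - g s) a n = taylor f a n - taylor g a n := by
  rw [taylor, iteratedDeriv_fun_sub hf.contDiffAt hg.contDiffAt, sub_div, taylor, taylor]

lemma neg_one_pow_mul_self (i : ℕ) : (-1 : ℂ) ^ i * (-1) ^ i = 1 := by rw [← mul_pow]; simp

/-- The Laurent expansion of `Φ(s;x)` at an integer. -/
lemma exists_Phi_expansion_int {x : ℂ} (hx : ‖x‖ = 1) (m : ℤ) :
    ∃ g : ℂ → ℂ, AnalyticAt ℂ g m ∧ (∀ i, taylor g m i = cLi x i) ∧
      ∀ᶠ s in 𝓝[≠] (m : ℂ), Phi s x = (x ^ m)⁻¹ * ((s - m)⁻¹ + g s) := by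
  have hx' := norm_inv_eq_one hx
  have h1 : AnalyticAt ℂ (fun s => lerch 1 x (s + (1 - m))) m :=
    analyticAt_lerch_one_comp_add hx (by simpa using one_mem_lerchDomain)
  have h2 : AnalyticAt ℂ (fun s => lerch 1 x⁻¹ (1 + m - s)) m :=
    analyticAt_lerch_one_comp_sub hx' (by simpa using one_mem_lerchDomain)
  refine ⟨fun s => x * lerch 1 x (s + (1 - m)) - x⁻¹ * lerch 1 x⁻¹ (1 + m - s), by fun_prop,
    fun i => ?_, ?_⟩
  · rw [taylor_sub (by fun_prop) (by fun_prop), taylor_const_mul, taylor_const_mul,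
      taylor_comp_add_const, taylor_comp_const_sub, add_sub_cancel, add_sub_cancel_right,
      taylor_lerch_one hx one_mem_lerchDomain, taylor_lerch_one hx' one_mem_lerchDomain, cLi,
      Li_eq hx (Nat.le_add_left 1 i), Li_eq hx' (Nat.le_add_left 1 i)]
    linear_combination -x⁻¹ * lerch (i + 1) x⁻¹ 1 * neg_one_pow_mul_self i
  · filter_upwards [eventually_forall_int_ne (m : ℂ)] with s hs
    -- Quasi-periodicity reduces the expansion at m to the one at 0.
    have hs' : ∀ k : ℤ, s - m ≠ k := by simpa [← sub_eq_add_neg] using add_int_ne_int hs (-m)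
    have h := Phi_add_int hx hs' m
    rw [sub_add_cancel, Phi_eq_of_forall_int hx hs'] at h
    rw [h, show s - m + 1 = s + (1 - m) by ring, show 1 - (s - m) = 1 + m - s by ring]

lemma half_add_natCast_ne_int (n : ℕ) (m : ℤ) : -(n : ℂ) - 1 / 2 ≠ m := fun h => by
  have h1 : ((-2 * n - 1 : ℤ) : ℂ) = ((2 * m : ℤ) : ℂ) := by
    push_cast
    linear_combination 2 * h
  have h2 : (-2 * n - 1 : ℤ) = 2 * m := by exact_mod_cast h1
  omega

/-- The Taylor expansion of `Φ(s;x)` at `-n - 1/2`. -/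
lemma exists_Phi_expansion_half {x : ℂ} (hx : ‖x‖ = 1) (n : ℕ) :
    ∃ g : ℂ → ℂ, AnalyticAt ℂ g (-(n : ℂ) - 1 / 2) ∧
      (∀ i, taylor g (-(n : ℂ) - 1 / 2) i = cTi x i) ∧
      ∀ᶠ s in 𝓝[≠] (-(n : ℂ) - 1 / 2), Phi s x = x ^ n * g s := by
  have hx' := norm_inv_eq_one hx
  have hx0 := ne_zero_of_norm_eq_one hx
  have e1 : -(n : ℂ) - 1 / 2 + (n + 1) = 1 / 2 := by ring
  have e2 : -(n : ℂ) - (-(n : ℂ) - 1 / 2) = 1 / 2 := by ring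
  have h1 : AnalyticAt ℂ (fun s => lerch 1 x (s + (n + 1))) (-(n : ℂ) - 1 / 2) :=
    analyticAt_lerch_one_comp_add hx (by rw [e1]; exact half_mem_lerchDomain)
  have h2 : AnalyticAt ℂ (fun s => lerch 1 x⁻¹ (-(n : ℂ) - s)) (-(n : ℂ) - 1 / 2) :=
    analyticAt_lerch_one_comp_sub hx' (by rw [e2]; exact half_mem_lerchDomain)
  refine ⟨fun s => x * lerch 1 x (s + (n + 1)) - lerch 1 x⁻¹ (-(n : ℂ) - s), by fun_prop,
    fun i => ?_, ?_⟩
  · rw [taylor_sub (by fun_prop) (by fun_prop), taylor_const_mul,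
      taylor_comp_add_const, taylor_comp_const_sub, e1, e2,
      taylor_lerch_one hx half_mem_lerchDomain, taylor_lerch_one hx' half_mem_lerchDomain, cTi,
      ti_eq hx (Nat.le_add_left 1 i), ti_eq hx' (Nat.le_add_left 1 i)]
    rw [mul_inv_cancel_left₀ hx0]
    linear_combination -lerch (i + 1) x⁻¹ (1 / 2) * neg_one_pow_mul_self i
  · filter_upwards [eventually_forall_int_ne (-(n : ℂ) - 1 / 2)] with s hs
    -- The shift by n leads to a neighbourhood of -1/2. There the form of Φ in `Phi_eq_of_mem` has
    -- both arguments, s + 1 and -s, near 1/2, so that the coefficients are values of ti.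
    have hs' := add_int_ne_int hs n
    have h := Phi_add_int hx hs' (-n)
    rw [Phi_eq_of_mem hx (mem_lerchDomain_of_forall_int hs')] at h
    push_cast at h
    rw [add_neg_cancel_right, zpow_neg, inv_inv, zpow_natCast] at h
    have e3 : s + ((n : ℤ) : ℂ) + 1 = s + (n + 1) := by push_cast; ring
    have e4 : 0 - (s + ((n : ℤ) : ℂ)) = -(n : ℂ) - s := by push_cast; ring
    rw [h, ← e3, ← e4, Int.cast_natCast]

/-! ### Coefficients of the products of Laurent series -/

lemma coeff_mk_mul (A : ℕ → ℂ) (P : PowerSeries ℂ) (N : ℕ) :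
    PowerSeries.coeff N (PowerSeries.mk A * P)
      = ∑ k ∈ range (N + 1), A k * PowerSeries.coeff (N - k) P := by
  rw [PowerSeries.coeff_mul, Finset.Nat.sum_antidiagonal_eq_sum_range_succ_mk]
  simp

/-- The truncated subtraction N - 1 - k is harmless: for N = 0 the sum is empty. -/
lemma coeff_X_mul_mk_mul (A : ℕ → ℂ) (P : PowerSeries ℂ) (N : ℕ) :
    PowerSeries.coeff N (PowerSeries.X * (PowerSeries.mk A * P))
      = ∑ k ∈ range N, A k * PowerSeries.coeff (N - 1 - k) P := by
  cases N with
  | zero => simp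
  | succ N => rw [PowerSeries.coeff_succ_X_mul, coeff_mk_mul, Nat.add_sub_cancel]

lemma coeff_add_X_pow_mul (P : PowerSeries ℂ) (d N : ℕ) :
    PowerSeries.coeff (d + N) (PowerSeries.X ^ d * P) = PowerSeries.coeff N P := by
  rw [add_comm, PowerSeries.coeff_X_pow_mul]

open PowerSeries (coeff X) in
-- Only Φ has a pole: 1 + X·A stands for (s-a)Φ, up to a constant, B₀ and B₁ for the φ factors and R
-- for the rational function freed from its pole.
lemma coeff_regular_mul_regular (A B₀ B₁ R : ℕ → ℂ) (q : ℕ) :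
    coeff q ((1 + X * PowerSeries.mk A) * (PowerSeries.mk B₀ * PowerSeries.mk B₁ * PowerSeries.mk R))
      = (∑ k₁ ∈ range (q + 1), ∑ k₂ ∈ range (q + 1 - k₁), B₀ k₁ * B₁ k₂ * R (q - k₁ - k₂))
        + ∑ k₁ ∈ range q, ∑ k₂ ∈ range (q - k₁), ∑ k₃ ∈ range (q - k₁ - k₂),
            A k₁ * B₀ k₂ * B₁ k₃ * R (q - 1 - k₁ - k₂ - k₃) := by
  have e : (1 + X * PowerSeries.mk A) * (PowerSeries.mk B₀ * PowerSeries.mk B₁ * PowerSeries.mk R)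
      = PowerSeries.mk B₀ * (PowerSeries.mk B₁ * PowerSeries.mk R) + X * (PowerSeries.mk A * (PowerSeries.mk B₀ * (PowerSeries.mk B₁ * PowerSeries.mk R))) := by ring
  rw [e, map_add, coeff_mk_mul, coeff_X_mul_mk_mul]
  simp only [coeff_mk_mul, PowerSeries.coeff_mk, mul_sum]
  congr 1
  · refine sum_congr rfl fun k hk => ?_
    rw [mem_range] at hk
    rw [show q - k + 1 = q + 1 - k by omega]
    exact sum_congr rfl fun l _ => by ring
  · refine sum_congr rfl fun k hk => ?_
    rw [mem_range] at hk
    rw [show q - 1 - k + 1 = q - k by omega]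
    refine sum_congr rfl fun l hl => ?_
    rw [mem_range] at hl
    rw [show q - 1 - k - l + 1 = q - k - l by omega]
    exact sum_congr rfl fun j _ => by ring

open PowerSeries (coeff X) in
lemma coeff_X_mul_mul_mul (A B R : ℕ → ℂ) (N : ℕ) :
    coeff N (X * (PowerSeries.mk A * (PowerSeries.mk B * PowerSeries.mk R)))
      = ∑ k₁ ∈ range N, ∑ k₂ ∈ range (N - k₁), A k₁ * B k₂ * R (N - 1 - k₁ - k₂) := by
  rw [coeff_X_mul_mk_mul]
  simp only [coeff_mk_mul, PowerSeries.coeff_mk, mul_sum]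
  refine sum_congr rfl fun k hk => ?_
  rw [mem_range] at hk
  rw [show N - 1 - k + 1 = N - k by omega]
  exact sum_congr rfl fun l _ => by ring

open PowerSeries (coeff X) in
-- All three kernel factors have a pole. A factor 1 + X^p·B is a φ factor multiplied by (s-a)^p:
-- choosing 1 means taking its polar part, choosing X^p·B its regular part. The eight choices are
-- the eight sums.
lemma coeff_polar_mul_polar (A B₀ B₁ R : ℕ → ℂ) (p₀ p₁ q : ℕ) :
    coeff (p₀ + p₁ + q) ((1 + X * PowerSeries.mk A) * ((1 + X ^ p₀ * PowerSeries.mk B₀) * (1 + X ^ p₁ * PowerSeries.mk B₁) * PowerSeries.mk R))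
      = R (p₀ + p₁ + q)
        + (∑ k ∈ range (p₀ + q + 1), B₁ k * R (p₀ + q - k))
        + (∑ k ∈ range (p₁ + q + 1), B₀ k * R (p₁ + q - k))
        + (∑ k₁ ∈ range (q + 1), ∑ k₂ ∈ range (q + 1 - k₁), B₀ k₁ * B₁ k₂ * R (q - k₁ - k₂))
        + (∑ k ∈ range (p₀ + p₁ + q), A k * R (p₀ + p₁ + q - 1 - k))
        + (∑ k₁ ∈ range (p₀ + q), ∑ k₂ ∈ range (p₀ + q - k₁),
            A k₁ * B₁ k₂ * R (p₀ + q - 1 - k₁ - k₂))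
        + (∑ k₁ ∈ range (p₁ + q), ∑ k₂ ∈ range (p₁ + q - k₁),
            A k₁ * B₀ k₂ * R (p₁ + q - 1 - k₁ - k₂))
        + ∑ k₁ ∈ range q, ∑ k₂ ∈ range (q - k₁), ∑ k₃ ∈ range (q - k₁ - k₂),
            A k₁ * B₀ k₂ * B₁ k₃ * R (q - 1 - k₁ - k₂ - k₃) := by
  -- Each product displays its power of X in front, which only lowers the index of the coefficient.
  -- The last summand contains two of the eight products and is the case of regular φ factors.
  have e : (1 + X * PowerSeries.mk A) * ((1 + X ^ p₀ * PowerSeries.mk B₀) * (1 + X ^ p₁ * PowerSeries.mk B₁) * PowerSeries.mk R)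
      = PowerSeries.mk R + X ^ p₁ * (PowerSeries.mk B₁ * PowerSeries.mk R) + X ^ p₀ * (PowerSeries.mk B₀ * PowerSeries.mk R) + X * (PowerSeries.mk A * PowerSeries.mk R)
        + X ^ p₁ * (X * (PowerSeries.mk A * (PowerSeries.mk B₁ * PowerSeries.mk R))) + X ^ p₀ * (X * (PowerSeries.mk A * (PowerSeries.mk B₀ * PowerSeries.mk R)))
        + X ^ (p₀ + p₁) * ((1 + X * PowerSeries.mk A) * (PowerSeries.mk B₀ * PowerSeries.mk B₁ * PowerSeries.mk R)) := by ring
  rw [e]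
  simp only [map_add]
  rw [coeff_add_X_pow_mul, coeff_regular_mul_regular,
    show p₀ + p₁ + q = p₀ + (p₁ + q) by ring, coeff_add_X_pow_mul, coeff_add_X_pow_mul,
    show p₀ + (p₁ + q) = p₁ + (p₀ + q) by ring, coeff_add_X_pow_mul, coeff_add_X_pow_mul,
    coeff_X_mul_mul_mul, coeff_X_mul_mul_mul, coeff_X_mul_mk_mul, coeff_mk_mul, coeff_mk_mul]
  simp only [PowerSeries.coeff_mk]
  ring

-- Here Φ is regular and A is its whole Taylor series. The identity is the previous one for A minus
-- the same one for A = 0.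
open PowerSeries (coeff X) in
lemma coeff_X_mul_polar_mul_polar (A B₀ B₁ R : ℕ → ℂ) (p₀ p₁ q : ℕ) :
    coeff (p₀ + p₁ + q) (X * (PowerSeries.mk A * ((1 + X ^ p₀ * PowerSeries.mk B₀) * (1 + X ^ p₁ * PowerSeries.mk B₁) * PowerSeries.mk R)))
      = (∑ k ∈ range (p₀ + p₁ + q), A k * R (p₀ + p₁ + q - 1 - k))
        + (∑ k₁ ∈ range (p₀ + q), ∑ k₂ ∈ range (p₀ + q - k₁),
            A k₁ * B₁ k₂ * R (p₀ + q - 1 - k₁ - k₂))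
        + (∑ k₁ ∈ range (p₁ + q), ∑ k₂ ∈ range (p₁ + q - k₁),
            A k₁ * B₀ k₂ * R (p₁ + q - 1 - k₁ - k₂))
        + ∑ k₁ ∈ range q, ∑ k₂ ∈ range (q - k₁), ∑ k₃ ∈ range (q - k₁ - k₂),
            A k₁ * B₀ k₂ * B₁ k₃ * R (q - 1 - k₁ - k₂ - k₃) := by
  have h1 := coeff_polar_mul_polar A B₀ B₁ R p₀ p₁ q
  have h2 := coeff_polar_mul_polar 0 B₀ B₁ R p₀ p₁ q
  have h0 : (PowerSeries.mk (0 : ℕ → ℂ)) = 0 := by ext n; simp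
  simp only [h0, mul_zero, add_zero, one_mul, Pi.zero_apply, zero_mul, sum_const_zero] at h2
  rw [add_mul, one_mul, map_add, h2, mul_assoc] at h1
  linear_combination h1

lemma hasResidue_const_mul {f G : ℂ → ℂ} {a c : ℂ} {N : ℕ} {P : PowerSeries ℂ}
    (hG : AnalyticAt ℂ G a) (hP : taylorSeries G a = P)
    (hf : ∀ᶠ s in 𝓝[≠] a, f s = ((s - a) ^ (N + 1))⁻¹ * (c * G s)) :
    HasResidue f a (c * PowerSeries.coeff N P) := by
  have h : HasResidue f a (taylor (fun s => c * G s) a N) :=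
    hasResidue_of_eventuallyEq_inv_pow_mul N (analyticAt_const.mul hG) hf
  rwa [taylor_const_mul, ← coeff_taylorSeries, hP] at h

lemma taylorSeries_eq_mk {f : ℂ → ℂ} {a : ℂ} {A : ℕ → ℂ} (h : ∀ i, taylor f a i = A i) :
    taylorSeries f a = PowerSeries.mk A := by
  ext i
  rw [coeff_taylorSeries, h, PowerSeries.coeff_mk]

lemma taylorSeries_one_add_pow_mul {f : ℂ → ℂ} {a : ℂ} {A : ℕ → ℂ} (hf : AnalyticAt ℂ f a)
    (h : ∀ i, taylor f a i = A i) (p : ℕ) :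
    taylorSeries (fun s => 1 + (s - a) ^ p * f s) a
      = 1 + PowerSeries.X ^ p * PowerSeries.mk A := by
  rw [taylorSeries_add analyticAt_const (by fun_prop), taylorSeries_mul (by fun_prop) hf,
    taylorSeries_sub_self_pow, taylorSeries_const, taylorSeries_eq_mk h, map_one]

lemma taylorSeries_one_add_mul {f : ℂ → ℂ} {a : ℂ} {A : ℕ → ℂ} (hf : AnalyticAt ℂ f a)
    (h : ∀ i, taylor f a i = A i) :
    taylorSeries (fun s => 1 + (s - a) * f s) a = 1 + PowerSeries.X * PowerSeries.mk A := by
  simpa using taylorSeries_one_add_pow_mul hf h 1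

/-! ### Residues of the kernel times a meromorphic factor -/

/-- The Taylor coefficients at `-n` of the regular part of the normalised derivatives of `φ`. -/
noncomputable def polarCoeff (n p : ℕ) (x : ℂ) (i : ℕ) : ℂ :=
  ((i + p - 1).choose (p - 1) : ℂ) * ((-1) ^ i * Li (i + p) x + (-1) ^ p * zetaFin n (i + p) x⁻¹)

section

variable {x : ℂ} {y : Fin 2 → ℂ} {p : Fin 2 → ℕ}

/-- The residue at an integer where only `Φ` has a pole. -/
lemma hasResidue_kernel_int (hx : ‖x‖ = 1) (hy : ∀ j, ‖y j‖ = 1) (hp : ∀ j, 1 ≤ p j) (m : ℤ)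
    {h : ℂ} (hm : (m : ℂ) + h ∈ lerchDomain) {F ρ : ℂ → ℂ} {q : ℕ} (hρ : AnalyticAt ℂ ρ m)
    (hF : ∀ᶠ s in 𝓝[≠] (m : ℂ), F s = ((s - m) ^ q)⁻¹ * ρ s) {B : Fin 2 → ℕ → ℂ}
    (hB : ∀ j i, ((i + p j - 1).choose (p j - 1) : ℂ) * (-1) ^ i * lerch (i + p j) (y j) (m + h)
      = B j i) :
    HasResidue (fun s => kernel h x p y s * F s) m
      ((x ^ m)⁻¹ * ((∑ k₁ ∈ range (q + 1), ∑ k₂ ∈ range (q + 1 - k₁),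
          B 0 k₁ * B 1 k₂ * taylor ρ m (q - k₁ - k₂))
        + ∑ k₁ ∈ range q, ∑ k₂ ∈ range (q - k₁), ∑ k₃ ∈ range (q - k₁ - k₂),
            cLi x k₁ * B 0 k₂ * B 1 k₃ * taylor ρ m (q - 1 - k₁ - k₂ - k₃))) := by
  obtain ⟨g, hg, hgt, hPhi⟩ := exists_Phi_expansion_int hx m
  have hL : ∀ j, AnalyticAt ℂ (fun s => lerchDeriv (p j) (y j) (s + h)) m := fun j =>
    AnalyticAt.fun_comp (g := lerchDeriv (p j) (y j)) (f := fun w => w + h)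
      (analyticAt_lerchDeriv (hy j) hm (p j)) (by fun_prop)
  have hLt : ∀ j i, taylor (fun s => lerchDeriv (p j) (y j) (s + h)) m i = B j i := fun j i => by
    rw [taylor_comp_add_const, taylor_lerchDeriv (hy j) hm (hp j), hB]
  have hL0 := hL 0
  have hL1 := hL 1
  rw [← coeff_regular_mul_regular]
  -- The simple pole of Φ and the pole of F of order at most q give the exponent q + 1, so the
  -- coefficient of index q is extracted.
  refine hasResidue_const_mul
    (G := fun s => (1 + (s - m) * g s) * (lerchDeriv (p 0) (y 0) (s + h)
      * lerchDeriv (p 1) (y 1) (s + h) * ρ s)) (by fun_prop) ?_ ?_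
  · rw [taylorSeries_mul (by fun_prop) (by fun_prop), taylorSeries_mul (by fun_prop) hρ,
      taylorSeries_mul hL0 hL1, taylorSeries_one_add_mul hg hgt, taylorSeries_eq_mk (hLt 0),
      taylorSeries_eq_mk (hLt 1)]
    rfl
  · filter_upwards [hPhi, hF, self_mem_nhdsWithin] with s h1 h2 hs
    have hne : s - m ≠ 0 := sub_ne_zero.mpr hs
    rw [kernel_eq hp, h1, h2]
    field_simp
    ring

/-- The residue at `-n` of the kernel without shift. -/
lemma hasResidue_kernel_neg_nat (hx : ‖x‖ = 1) (hy : ∀ j, ‖y j‖ = 1) (hp : ∀ j, 1 ≤ p j) (n : ℕ)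
    {F ρ : ℂ → ℂ} {q : ℕ} (hρ : AnalyticAt ℂ ρ (-(n : ℂ)))
    (hF : ∀ᶠ s in 𝓝[≠] (-(n : ℂ)), F s = ((s - -(n : ℂ)) ^ q)⁻¹ * ρ s) :
    HasResidue (fun s => kernel 0 x p y s * F s) (-(n : ℂ))
      ((x * y 0 * y 1) ^ n * (PowerSeries.coeff (p 0 + p 1 + q)
        ((1 + PowerSeries.X * PowerSeries.mk (cLi x))
          * ((1 + PowerSeries.X ^ p 0 * PowerSeries.mk (polarCoeff n (p 0) (y 0)))
            * (1 + PowerSeries.X ^ p 1 * PowerSeries.mk (polarCoeff n (p 1) (y 1)))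
            * PowerSeries.mk (taylor ρ (-(n : ℂ))))))) := by
  obtain ⟨g, hg, hgt, hPhi⟩ := exists_Phi_expansion_int hx (-n)
  push_cast at hg hgt hPhi
  obtain ⟨b₀, hb₀, hbt₀, hL₀⟩ := exists_lerchDeriv_expansion (hy 0) n (hp 0)
  obtain ⟨b₁, hb₁, hbt₁, hL₁⟩ := exists_lerchDeriv_expansion (hy 1) n (hp 1)
  refine hasResidue_const_mul
    (G := fun s => (1 + (s - -(n : ℂ)) * g s) * ((1 + (s - -(n : ℂ)) ^ p 0 * b₀ s)
      * (1 + (s - -(n : ℂ)) ^ p 1 * b₁ s) * ρ s)) (by fun_prop) ?_ ?_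
  · rw [taylorSeries_mul (by fun_prop) (by fun_prop), taylorSeries_mul (by fun_prop) hρ,
      taylorSeries_mul (by fun_prop) (by fun_prop), taylorSeries_one_add_mul hg hgt,
      taylorSeries_one_add_pow_mul hb₀ hbt₀, taylorSeries_one_add_pow_mul hb₁ hbt₁]
    rfl
  · filter_upwards [hPhi, hF, hL₀, hL₁, self_mem_nhdsWithin] with s h1 h2 h3 h4 hs
    have hne : s - -(n : ℂ) ≠ 0 := sub_ne_zero.mpr hs
    rw [kernel_eq hp, add_zero, h1, h2, h3, h4, zpow_neg, inv_inv, zpow_natCast]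
    field_simp
    ring

/-- The residue at `-n - 1/2` of the kernel shifted by `1/2`. -/
lemma hasResidue_kernel_half (hx : ‖x‖ = 1) (hy : ∀ j, ‖y j‖ = 1) (hp : ∀ j, 1 ≤ p j) (n : ℕ)
    {F ρ : ℂ → ℂ} {q : ℕ} (hρ : AnalyticAt ℂ ρ (-(n : ℂ) - 1 / 2))
    (hF : ∀ᶠ s in 𝓝[≠] (-(n : ℂ) - 1 / 2), F s = ((s - (-(n : ℂ) - 1 / 2)) ^ q)⁻¹ * ρ s) :
    HasResidue (fun s => kernel (1 / 2) x p y s * F s) (-(n : ℂ) - 1 / 2)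
      ((x * y 0 * y 1) ^ n * (PowerSeries.coeff (p 0 + p 1 + q)
        (PowerSeries.X * (PowerSeries.mk (cTi x)
          * ((1 + PowerSeries.X ^ p 0 * PowerSeries.mk (polarCoeff n (p 0) (y 0)))
            * (1 + PowerSeries.X ^ p 1 * PowerSeries.mk (polarCoeff n (p 1) (y 1)))
            * PowerSeries.mk (taylor ρ (-(n : ℂ) - 1 / 2))))))) := by
  obtain ⟨g, hg, hgt, hPhi⟩ := exists_Phi_expansion_half hx n
  set a : ℂ := -(n : ℂ) - 1 / 2 with ha
  have hshift : a + 1 / 2 = -(n : ℂ) := by rw [ha]; ring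
  have hL : ∀ j, ∃ b : ℂ → ℂ, AnalyticAt ℂ b a ∧
      (∀ i, taylor b a i = polarCoeff n (p j) (y j) i) ∧
      ∀ᶠ s in 𝓝[≠] a, lerchDeriv (p j) (y j) (s + 1 / 2)
        = y j ^ n * (((s - a) ^ p j)⁻¹ + b s) := fun j => by
    obtain ⟨b, hb, hbt, hL⟩ := exists_lerchDeriv_expansion (hy j) n (hp j)
    rw [← hshift] at hb hbt hL
    refine ⟨fun s => b (s + 1 / 2), AnalyticAt.fun_comp (g := b) (f := fun w => w + 1 / 2) hb
      (by fun_prop), fun i => by rw [taylor_comp_add_const, hbt, polarCoeff], ?_⟩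
    have ht : Tendsto (fun s : ℂ => s + 1 / 2) (𝓝[≠] a) (𝓝[≠] (a + 1 / 2)) :=
      tendsto_nhdsWithin_of_tendsto_nhds_of_eventually_within _
        (((continuous_id.add continuous_const).tendsto a).mono_left nhdsWithin_le_nhds)
        (eventually_mem_nhdsWithin.mono fun s hs h => hs (add_right_cancel h))
    filter_upwards [ht.eventually hL] with s hs
    rw [hs, add_sub_add_right_eq_sub]
  obtain ⟨b₀, hb₀, hbt₀, hL₀⟩ := hL 0
  obtain ⟨b₁, hb₁, hbt₁, hL₁⟩ := hL 1
  -- Φ has no pole here; the artificial factor s - a raises the exponent to p₀ + p₁ + q + 1, the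
  -- same as at the integers. It is the X in front of the power series.
  refine hasResidue_const_mul
    (G := fun s => (s - a) * (g s * ((1 + (s - a) ^ p 0 * b₀ s)
      * (1 + (s - a) ^ p 1 * b₁ s) * ρ s))) (by fun_prop) ?_ ?_
  · rw [taylorSeries_mul (by fun_prop) (by fun_prop), taylorSeries_mul hg (by fun_prop),
      taylorSeries_mul (by fun_prop) hρ, taylorSeries_mul (by fun_prop) (by fun_prop),
      taylorSeries_sub_self, taylorSeries_eq_mk hgt,
      taylorSeries_one_add_pow_mul hb₀ hbt₀, taylorSeries_one_add_pow_mul hb₁ hbt₁]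
    rfl
  · filter_upwards [hPhi, hF, hL₀, hL₁, self_mem_nhdsWithin] with s h1 h2 h3 h4 hs
    have hne : s - a ≠ 0 := sub_ne_zero.mpr hs
    rw [kernel_eq hp, h1, h2, h3, h4]
    field_simp
    ring

lemma analyticAt_kernel (hx : ‖x‖ = 1) (hy : ∀ j, ‖y j‖ = 1) (hp : ∀ j, 1 ≤ p j) {h s : ℂ}
    (hs : ∀ m : ℤ, s ≠ m) (hsh : s + h ∈ lerchDomain) : AnalyticAt ℂ (kernel h x p y) s := by
  have h1 := mem_lerchDomain_of_forall_int hs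
  have h2 := mem_lerchDomain_of_forall_int (neg_ne_int hs)
  have hs0 : s ≠ 0 := by simpa using hs 0
  have hL : ∀ j, AnalyticAt ℂ (fun s => lerchDeriv (p j) (y j) (s + h)) s := fun j =>
    AnalyticAt.fun_comp (g := lerchDeriv (p j) (y j)) (f := fun w => w + h)
      (analyticAt_lerchDeriv (hy j) hsh (p j)) (by fun_prop)
  have hP : AnalyticAt ℂ (fun s => Phi s x) s := by
    simp only [Phi, phi_eq_lerch]
    refine ((analyticAt_lerch_one hx h1).sub ?_).sub ?_
    · exact AnalyticAt.fun_comp (g := lerch 1 x⁻¹) (f := fun w => -w)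
        (analyticAt_lerch_one (norm_inv_eq_one hx) h2) (by fun_prop)
    · exact analyticAt_const.div analyticAt_id hs0
  have := (hP.mul (hL 0)).mul (hL 1)
  refine this.congr (Eventually.of_forall fun w => ?_)
  simp [kernel_eq hp]

end

/-! ### Bounds for the kernel on the circles -/

/-- A lower bound for `|k + h + s|` on the circle `|s| = M + 1/4`. -/
noncomputable def circleGap (M k : ℕ) : ℝ := (|(k : ℝ) - M| + 1) / 4

lemma circleGap_ge (M k : ℕ) : 1 / 4 ≤ circleGap M k := by
  have := abs_nonneg ((k : ℝ) - M)
  rw [circleGap]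
  linarith

lemma circleGap_pos (M k : ℕ) : 0 < circleGap M k := by linarith [circleGap_ge M k]

/-- Reverse triangle inequality: |k + h + s| is at least |k + h - M - 1/4|, which is at least 1/4
for k = M and grows linearly in |k - M|. -/
lemma circleGap_le_norm {M : ℕ} {s : ℂ} (hs : ‖s‖ = M + 1 / 4) {h : ℝ} (hh : h = 0 ∨ h = 1 / 2)
    (k : ℕ) : circleGap M k ≤ ‖(k : ℂ) + (s + h)‖ := by
  have h0 : 0 ≤ h := by rcases hh with rfl | rfl <;> norm_num
  have h1 := abs_norm_sub_norm_le ((k : ℂ) + h) (-s)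
  have h2 : ‖(k : ℂ) + h‖ = k + h := by
    have : (k : ℂ) + h = ((k + h : ℝ) : ℂ) := by push_cast; rfl
    rw [this, Complex.norm_real, Real.norm_of_nonneg (by positivity)]
  have h3 : (k : ℂ) + h - -s = k + (s + h) := by ring
  rw [h2, h3, norm_neg, hs] at h1
  refine le_trans ?_ h1
  rw [circleGap]
  rcases lt_trichotomy k M with hk | hk | hk
  · have hk' : (k : ℝ) + 1 ≤ M := by exact_mod_cast hk
    rw [abs_of_neg (by linarith), le_abs]
    right
    rcases hh with rfl | rfl <;> linarith
  · subst hk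
    rw [sub_self, abs_zero, le_abs]
    rcases hh with rfl | rfl
    · right; linarith
    · left; linarith
  · have hk' : (M : ℝ) + 1 ≤ k := by exact_mod_cast hk
    rw [abs_of_pos (by linarith), le_abs]
    left
    rcases hh with rfl | rfl <;> linarith

/-- Uniformity in M: the substitution j = k - M embeds every such sum into one convergent series
over ℤ. -/
lemma exists_sum_circleGap_rpow_le {b : ℝ} (hb : 1 < b) :
    ∃ D : ℝ, 0 < D ∧ ∀ M n : ℕ, ∑ k ∈ range n, circleGap M k ^ (-b) ≤ D := by
  have hnat : Summable fun n : ℕ => ((|(n : ℝ)| + 1) / 4) ^ (-b) := by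
    have h1 : Summable fun n : ℕ => (4 : ℝ) ^ b * ((n + 1 : ℕ) : ℝ) ^ (-b) :=
      ((summable_nat_add_iff 1).mpr (Real.summable_nat_rpow.mpr (by linarith))).mul_left _
    refine h1.congr fun n => ?_
    rw [abs_of_nonneg n.cast_nonneg, Real.div_rpow (by positivity) (by norm_num),
      Real.rpow_neg (by norm_num : (0 : ℝ) ≤ 4), div_inv_eq_mul, mul_comm]
    push_cast
    rfl
  have hint : Summable fun j : ℤ => ((|(j : ℝ)| + 1) / 4) ^ (-b) :=
    Summable.of_nat_of_neg (by simpa using hnat) (by simpa using hnat)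
  have hpos : ∀ j : ℤ, 0 ≤ ((|(j : ℝ)| + 1) / 4) ^ (-b) := fun j => by positivity
  refine ⟨(∑' j : ℤ, ((|(j : ℝ)| + 1) / 4) ^ (-b)) + 1,
    add_pos_of_nonneg_of_pos (tsum_nonneg hpos) one_pos, fun M n => ?_⟩
  have hinj : Function.Injective fun k : ℕ => (k : ℤ) - M := fun a c h => by
    simpa using h
  have h := hint.sum_le_tsum ((range n).map ⟨_, hinj⟩) fun j _ => hpos j
  rw [sum_map] at h
  simp only [Function.Embedding.coeFn_mk, Int.cast_sub, Int.cast_natCast] at h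
  simp only [circleGap]
  linarith

/-- Bound on the circles for the convergent series, with a gain `E`. -/
lemma exists_norm_lerch_le {p : ℕ} (hp : 1 ≤ p) {x : ℂ} (hx : ‖x‖ = 1)
    (hpx : ¬(p = 1 ∧ x = 1)) :
    ∃ C : ℝ, 0 < C ∧ ∀ (M : ℕ) (s : ℂ) (h E : ℝ), ‖s‖ = M + 1 / 4 → (h = 0 ∨ h = 1 / 2) →
      (∀ k : ℕ, ‖(k : ℂ) + (s + h)‖ ^ (-(1 / 2) : ℝ) ≤ E) → ‖lerch p x (s + h)‖ ≤ C * E := by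
  obtain ⟨D, hD0, hD⟩ := exists_sum_circleGap_rpow_le (b := 3 / 2) (by norm_num)
  -- Half a power of every denominator is traded for the common bound E. The exponent 3/2 that
  -- remains of a square is still summable uniformly in M. Later E is either a constant or |Im
  -- s|^(-1/2).
  have key : ∀ (M : ℕ) (s : ℂ) (h E : ℝ), ‖s‖ = M + 1 / 4 → (h = 0 ∨ h = 1 / 2) →
      (∀ k : ℕ, ‖(k : ℂ) + (s + h)‖ ^ (-(1 / 2) : ℝ) ≤ E) →
      s + h ∈ lerchDomain ∧ (∀ k : ℕ, ‖(k : ℂ) + (s + h)‖⁻¹ ≤ 2 * E) ∧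
      ∀ n : ℕ, ∑ k ∈ range n, (‖(k : ℂ) + (s + h)‖ ^ 2)⁻¹ ≤ D * E := by
    intro M s h E hs hh hE
    have hw : ∀ k : ℕ, circleGap M k ≤ ‖(k : ℂ) + (s + h)‖ := circleGap_le_norm hs hh
    have hw0 : ∀ k : ℕ, 0 < ‖(k : ℂ) + (s + h)‖ := fun k => (circleGap_pos M k).trans_le (hw k)
    have hE0 : 0 ≤ E := (Real.rpow_nonneg (norm_nonneg _) _).trans (hE 0)
    refine ⟨fun k => norm_pos_iff.mp (hw0 k), fun k => ?_, fun n => ?_⟩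
    · have h1 : ‖(k : ℂ) + (s + h)‖⁻¹
          = ‖(k : ℂ) + (s + h)‖ ^ (-(1 / 2) : ℝ) * ‖(k : ℂ) + (s + h)‖ ^ (-(1 / 2) : ℝ) := by
        rw [← Real.rpow_add (hw0 k), ← Real.rpow_neg_one]
        norm_num
      have h2 : ‖(k : ℂ) + (s + h)‖ ^ (-(1 / 2) : ℝ) ≤ 2 := by
        refine (Real.rpow_le_rpow_of_nonpos (by norm_num : (0 : ℝ) < 1 / 4)
          ((circleGap_ge M k).trans (hw k)) (by norm_num)).trans ?_
        rw [show (1 / 4 : ℝ) = 2 ^ (-2 : ℝ) by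
          rw [Real.rpow_neg (by norm_num)]; norm_num, ← Real.rpow_mul (by norm_num)]
        norm_num
      rw [h1]
      exact mul_le_mul h2 (hE k) (by positivity) (by norm_num)
    · calc ∑ k ∈ range n, (‖(k : ℂ) + (s + h)‖ ^ 2)⁻¹
          ≤ ∑ k ∈ range n, circleGap M k ^ (-(3 / 2) : ℝ) * E := by
            refine sum_le_sum fun k _ => ?_
            have h1 : (‖(k : ℂ) + (s + h)‖ ^ 2)⁻¹ = ‖(k : ℂ) + (s + h)‖ ^ (-(3 / 2) : ℝ)
                * ‖(k : ℂ) + (s + h)‖ ^ (-(1 / 2) : ℝ) := by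
              rw [← Real.rpow_add (hw0 k), ← Real.rpow_natCast, ← Real.rpow_neg (hw0 k).le]
              norm_num
            rw [h1]
            exact mul_le_mul (Real.rpow_le_rpow_of_nonpos (circleGap_pos M k) (hw k)
              (by norm_num)) (hE k) (by positivity)
              (Real.rpow_nonneg (circleGap_pos M k).le _)
        _ ≤ D * E := by
            rw [← sum_mul]
            exact mul_le_mul_of_nonneg_right (hD M n) hE0
  by_cases hp1 : p = 1
  · subst hp1
    have hx1 : x ≠ 1 := fun h => hpx ⟨rfl, h⟩
    have hx1' : 0 < ‖1 - x‖ := norm_pos_iff.mpr (sub_ne_zero.mpr (Ne.symm hx1))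
    refine ⟨(4 + 2 * D) / ‖1 - x‖, by positivity, fun M s h E hs hh hE => ?_⟩
    obtain ⟨hdom, hinv, hsum⟩ := key M s h E hs hh hE
    have hE0 : 0 ≤ E := (Real.rpow_nonneg (norm_nonneg _) _).trans (hE 0)
    refine le_of_tendsto (tendsto_lerchSum hx hdom le_rfl).norm (Eventually.of_forall fun n => ?_)
    rw [div_mul_eq_mul_div, le_div_iff₀ hx1', mul_comm ‖lerchSum _ _ _ _‖, ← norm_mul,
      one_sub_mul_lerchSum hx1]
    have h0 : ‖1 / (s + (h : ℂ))‖ ≤ 2 * E := by simpa using hinv 0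
    have hn : ‖x ^ n / ((n : ℂ) + (s + h))‖ ≤ 2 * E := by
      rw [norm_div, norm_pow, hx, one_pow, one_div]
      exact hinv n
    have hS : ‖∑ k ∈ range n, x ^ (k + 1) * (1 / ((k : ℂ) + 1 + (s + h)) - 1 / (k + (s + h)))‖
        ≤ 2 * D * E := by
      refine (norm_sum_le _ _).trans ?_
      have hsum' : ∑ k ∈ range n, (‖((k + 1 : ℕ) : ℂ) + (s + h)‖ ^ 2)⁻¹ ≤ D * E := by
        refine le_trans ?_ (hsum (n + 1))
        rw [sum_range_succ' _ n]
        exact le_add_of_nonneg_right (by positivity)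
      calc _ ≤ ∑ k ∈ range n, ((‖(k : ℂ) + (s + h)‖ ^ 2)⁻¹
            + (‖((k + 1 : ℕ) : ℂ) + (s + h)‖ ^ 2)⁻¹) := by
            refine sum_le_sum fun k _ => ?_
            have e1 := hdom k
            have e2 := hdom (k + 1)
            push_cast at e2 ⊢
            have : 1 / ((k : ℂ) + 1 + (s + h)) - 1 / (k + (s + h))
                = -((((k : ℂ) + (s + h)))⁻¹ * ((k : ℂ) + 1 + (s + h))⁻¹) := by
              field_simp
              ring
            rw [norm_mul, norm_pow, hx, one_pow, one_mul, this, norm_neg, norm_mul, norm_inv,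
              norm_inv, ← inv_pow, ← inv_pow]
            -- The product of two neighbouring inverses is bounded by the sum of their squares.
            nlinarith [sq_nonneg (‖(k : ℂ) + (s + h)‖⁻¹ - ‖(k : ℂ) + 1 + (s + h)‖⁻¹),
              sq_nonneg (‖(k : ℂ) + (s + h)‖⁻¹), sq_nonneg (‖(k : ℂ) + 1 + (s + h)‖⁻¹)]
        _ ≤ 2 * D * E := by
            rw [sum_add_distrib]
            linarith [hsum n]
    calc _ ≤ ‖1 / (s + (h : ℂ))‖ + ‖x ^ n / ((n : ℂ) + (s + h))‖ + _ :=
          (norm_add_le _ _).trans (add_le_add_left (norm_sub_le _ _) _)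
      _ ≤ 2 * E + 2 * E + 2 * D * E := add_le_add (add_le_add h0 hn) hS
      _ = (4 + 2 * D) * E := by ring
  · obtain ⟨m, rfl⟩ := Nat.exists_eq_add_of_le' (show 2 ≤ p by omega)
    -- The m = p - 2 surplus denominators contribute at most 4 each, because all gaps are at least
    -- 1/4.
    refine ⟨4 ^ m * D, by positivity, fun M s h E hs hh hE => ?_⟩
    obtain ⟨hdom, -, hsum⟩ := key M s h E hs hh hE
    refine le_of_tendsto (tendsto_lerchSum hx hdom hp).norm (Eventually.of_forall fun n => ?_)
    rw [lerchSum, counterterm_of_ne hpx, sub_zero]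
    refine (norm_sum_le _ _).trans ?_
    calc _ ≤ ∑ k ∈ range n, 4 ^ m * (‖(k : ℂ) + (s + h)‖ ^ 2)⁻¹ := by
          refine sum_le_sum fun k _ => ?_
          have hge : 1 / 4 ≤ ‖(k : ℂ) + (s + h)‖ :=
            (circleGap_ge M k).trans (circleGap_le_norm hs hh k)
          rw [norm_div, norm_pow, norm_pow, hx, one_pow, one_div, pow_add, mul_inv, ← inv_pow _ m]
          gcongr
          rw [inv_le_comm₀ (by linarith) (by norm_num)]
          linarith
      _ ≤ 4 ^ m * D * E := by
          rw [← mul_sum, mul_assoc]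
          exact mul_le_mul_of_nonneg_left (hsum n) (by positivity)

/-- If B ≤ A, then L ≤ 4A, hence L^(7/8) ≤ 4 A^(7/8), and A^(-1/8) B⁻¹ ≤ B^(-9/8). A product of two
first powers thus becomes summable with exponent 9/8, at the price L^(1/8). -/
lemma one_div_mul_le {L A B : ℝ} (hL : 0 < L) (hA : 1 ≤ A) (hB : 1 ≤ B) (h : L ≤ 2 * (A + B)) :
    L / (A * B) ≤ 4 * L ^ (1 / 8 : ℝ) * (A ^ (-(9 / 8) : ℝ) + B ^ (-(9 / 8) : ℝ)) := by
  wlog hAB : B ≤ A generalizing A B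
  · have := this hB hA (by linarith) (by linarith)
    rwa [mul_comm B A, add_comm (B ^ _)] at this
  have hA0 : 0 < A := by linarith
  have hB0 : 0 < B := by linarith
  have h1 : L ^ (7 / 8 : ℝ) ≤ 4 * A ^ (7 / 8 : ℝ) := by
    calc L ^ (7 / 8 : ℝ) ≤ (4 * A) ^ (7 / 8 : ℝ) := by gcongr; linarith
      _ = 4 ^ (7 / 8 : ℝ) * A ^ (7 / 8 : ℝ) := Real.mul_rpow (by norm_num) hA0.le
      _ ≤ 4 * A ^ (7 / 8 : ℝ) := by
          gcongr
          calc (4 : ℝ) ^ (7 / 8 : ℝ) ≤ 4 ^ (1 : ℝ) :=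
                Real.rpow_le_rpow_of_exponent_le (by norm_num) (by norm_num)
            _ = 4 := Real.rpow_one 4
  have h2 : L = L ^ (1 / 8 : ℝ) * L ^ (7 / 8 : ℝ) := by
    rw [← Real.rpow_add hL]; norm_num
  have h3 : A = A ^ (7 / 8 : ℝ) * A ^ (1 / 8 : ℝ) := by
    rw [← Real.rpow_add hA0]; norm_num
  have h4 : B ^ (-(9 / 8) : ℝ) = (B ^ (1 / 8 : ℝ) * B)⁻¹ := by
    rw [Real.rpow_neg hB0.le, ← Real.rpow_add_one hB0.ne']; norm_num
  have h5 : B ^ (1 / 8 : ℝ) ≤ A ^ (1 / 8 : ℝ) := by gcongr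
  have h6 : 0 ≤ A ^ (-(9 / 8) : ℝ) := by positivity
  calc L / (A * B)
      = L ^ (1 / 8 : ℝ) * L ^ (7 / 8 : ℝ) / (A ^ (7 / 8 : ℝ) * A ^ (1 / 8 : ℝ) * B) := by
        rw [← h2, ← h3]
    _ ≤ L ^ (1 / 8 : ℝ) * (4 * A ^ (7 / 8 : ℝ)) / (A ^ (7 / 8 : ℝ) * A ^ (1 / 8 : ℝ) * B) := by
        gcongr
    _ = 4 * L ^ (1 / 8 : ℝ) * (A ^ (1 / 8 : ℝ) * B)⁻¹ := by
        field_simp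
    _ ≤ 4 * L ^ (1 / 8 : ℝ) * B ^ (-(9 / 8) : ℝ) := by
        rw [h4]
        gcongr
    _ ≤ _ := by
        gcongr
        linarith

/-- The divergent case. The terms have size about M/((k+1)(|k-M|+1)); the true growth is
logarithmic, but 1/8 is small enough for three factors together to stay far below the first power.
-/
lemma exists_norm_lerch_one_one_le :
    ∃ C : ℝ, 0 < C ∧ ∀ (M : ℕ) (s : ℂ) (h : ℝ), ‖s‖ = M + 1 / 4 → (h = 0 ∨ h = 1 / 2) →
      ‖lerch 1 1 (s + h)‖ ≤ C * ((M : ℝ) + 3) ^ (1 / 8 : ℝ) := by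
  obtain ⟨D, hD0, hD⟩ := exists_sum_circleGap_rpow_le (b := 9 / 8) (by norm_num)
  -- One 4 comes from the quarter in `circleGap`, the other from `one_div_mul_le`, and 2D from the
  -- two sums centred at 0 and at M.
  refine ⟨4 * 4 * (2 * D), by positivity, fun M s h hs hh => ?_⟩
  have hw : ∀ k : ℕ, circleGap M k ≤ ‖(k : ℂ) + (s + h)‖ := circleGap_le_norm hs hh
  have hw0 : ∀ k : ℕ, 0 < ‖(k : ℂ) + (s + h)‖ := fun k => (circleGap_pos M k).trans_le (hw k)
  have hdom : s + h ∈ lerchDomain := fun k => norm_pos_iff.mp (hw0 k)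
  have hquarter : ∀ A : ℝ, 1 ≤ A → A ^ (-(9 / 8) : ℝ) ≤ (A / 4) ^ (-(9 / 8) : ℝ) := fun A hA =>
    Real.rpow_le_rpow_of_nonpos (by linarith) (by linarith) (by norm_num)
  refine le_of_tendsto (tendsto_lerchSum norm_one hdom le_rfl).norm
    (Eventually.of_forall fun n => ?_)
  rw [lerchSum_one_one]
  refine (norm_sum_le _ _).trans ?_
  calc _ ≤ ∑ k ∈ range n, 4 * (4 * ((M : ℝ) + 3) ^ (1 / 8 : ℝ)
        * (circleGap 0 k ^ (-(9 / 8) : ℝ) + circleGap M k ^ (-(9 / 8) : ℝ))) := by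
        refine sum_le_sum fun k _ => ?_
        have e1 := hdom k
        have e2 : (k : ℂ) + 1 ≠ 0 := Nat.cast_add_one_ne_zero k
        have e3 : ‖(k : ℂ) + 1‖ = k + 1 := by
          have : (k : ℂ) + 1 = ((k + 1 : ℕ) : ℂ) := by push_cast; rfl
          rw [this, Complex.norm_natCast]
          push_cast
          rfl
        have e4 : 1 / ((k : ℂ) + (s + h)) - 1 / ((k : ℂ) + 1)
            = (1 - h - s) / (((k : ℂ) + (s + h)) * ((k : ℂ) + 1)) := by
          field_simp
          ring
        have e5 : ‖1 - (h : ℂ) - s‖ ≤ M + 3 := by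
          refine (norm_sub_le _ _).trans ?_
          have : ‖(1 : ℂ) - h‖ ≤ 1 := by
            rcases hh with rfl | rfl
            · simp
            · norm_num
          rw [hs]
          linarith
        have hB : 1 ≤ |(k : ℝ) - M| + 1 := by linarith [abs_nonneg ((k : ℝ) - M)]
        have hA : 1 ≤ (k : ℝ) + 1 := by linarith [k.cast_nonneg (α := ℝ)]
        rw [e4, norm_div, norm_mul, e3]
        calc ‖1 - (h : ℂ) - s‖ / (‖(k : ℂ) + (s + h)‖ * ((k : ℝ) + 1))
            ≤ ((M : ℝ) + 3) / ((|(k : ℝ) - M| + 1) / 4 * ((k : ℝ) + 1)) := by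
              gcongr
              exact hw k
          _ = 4 * (((M : ℝ) + 3) / (((k : ℝ) + 1) * (|(k : ℝ) - M| + 1))) := by
              field_simp
          _ ≤ 4 * (4 * ((M : ℝ) + 3) ^ (1 / 8 : ℝ)
              * (((k : ℝ) + 1) ^ (-(9 / 8) : ℝ) + (|(k : ℝ) - M| + 1) ^ (-(9 / 8) : ℝ))) := by
              gcongr
              refine one_div_mul_le (by positivity) hA hB ?_
              linarith [neg_abs_le ((k : ℝ) - M)]
          _ ≤ _ := by
              have hA' : ((k : ℝ) + 1) ^ (-(9 / 8) : ℝ) ≤ circleGap 0 k ^ (-(9 / 8) : ℝ) := by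
                refine (hquarter _ hA).trans_eq ?_
                rw [circleGap]
                simp
              exact mul_le_mul_of_nonneg_left (mul_le_mul_of_nonneg_left
                (add_le_add hA' (hquarter _ hB)) (by positivity)) (by norm_num)
    _ = 4 * (4 * ((M : ℝ) + 3) ^ (1 / 8 : ℝ) * ((∑ k ∈ range n, circleGap 0 k ^ (-(9 / 8) : ℝ))
        + ∑ k ∈ range n, circleGap M k ^ (-(9 / 8) : ℝ))) := by
        rw [← sum_add_distrib, mul_sum, mul_sum]
    _ ≤ 4 * (4 * ((M : ℝ) + 3) ^ (1 / 8 : ℝ) * (D + D)) := by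
        gcongr
        · exact hD 0 n
        · exact hD M n
    _ = _ := by ring

lemma one_le_growth (M : ℕ) : 1 ≤ ((M : ℝ) + 3) ^ (1 / 8 : ℝ) :=
  Real.one_le_rpow (by linarith [M.cast_nonneg (α := ℝ)]) (by norm_num)

lemma mem_lerchDomain_of_norm_eq {M : ℕ} {s : ℂ} {h : ℝ} (hs : ‖s‖ = M + 1 / 4)
    (hh : h = 0 ∨ h = 1 / 2) : s + h ∈ lerchDomain := fun k =>
  norm_pos_iff.mp ((circleGap_pos M k).trans_le (circleGap_le_norm hs hh k))

lemma exists_norm_lerch_le_growth {p : ℕ} (hp : 1 ≤ p) {x : ℂ} (hx : ‖x‖ = 1) :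
    ∃ C : ℝ, 0 < C ∧ ∀ (M : ℕ) (s : ℂ) (h : ℝ), ‖s‖ = M + 1 / 4 → (h = 0 ∨ h = 1 / 2) →
      ‖lerch p x (s + h)‖ ≤ C * ((M : ℝ) + 3) ^ (1 / 8 : ℝ) := by
  by_cases hpx : p = 1 ∧ x = 1
  · obtain ⟨rfl, rfl⟩ := hpx
    exact exists_norm_lerch_one_one_le
  · obtain ⟨C, hC, h⟩ := exists_norm_lerch_le hp hx hpx
    refine ⟨C * (1 / 4) ^ (-(1 / 2) : ℝ), by positivity, fun M s h' hs hh => ?_⟩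
    refine (h M s h' _ hs hh fun k => Real.rpow_le_rpow_of_nonpos (by norm_num)
      ((circleGap_ge M k).trans (circleGap_le_norm hs hh k)) (by norm_num)).trans ?_
    exact le_mul_of_one_le_right (by positivity) (one_le_growth M)

/-- As k and h are real, every denominator has modulus at least |Im s|. -/
lemma exists_norm_lerch_le_im {p : ℕ} (hp : 1 ≤ p) {x : ℂ} (hx : ‖x‖ = 1)
    (hpx : ¬(p = 1 ∧ x = 1)) :
    ∃ C : ℝ, 0 < C ∧ ∀ (M : ℕ) (s : ℂ) (h : ℝ), ‖s‖ = M + 1 / 4 → (h = 0 ∨ h = 1 / 2) →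
      s.im ≠ 0 → ‖lerch p x (s + h)‖ ≤ C * |s.im| ^ (-(1 / 2) : ℝ) := by
  obtain ⟨C, hC, h⟩ := exists_norm_lerch_le hp hx hpx
  refine ⟨C, hC, fun M s h' hs hh him => h M s h' _ hs hh fun k => ?_⟩
  refine Real.rpow_le_rpow_of_nonpos (abs_pos.mpr him) ?_ (by norm_num)
  simpa using Complex.abs_im_le_norm ((k : ℂ) + (s + h'))

lemma Phi_eq_lerch_sub (s x : ℂ) :
    Phi s x = lerch 1 x (s + (0 : ℝ)) - lerch 1 x⁻¹ (-s + (0 : ℝ)) - 1 / s := by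
  simp [Phi, phi_eq_lerch]

lemma exists_norm_Phi_le_growth {x : ℂ} (hx : ‖x‖ = 1) :
    ∃ C : ℝ, 0 < C ∧ ∀ (M : ℕ) (s : ℂ), ‖s‖ = M + 1 / 4 →
      ‖Phi s x‖ ≤ C * ((M : ℝ) + 3) ^ (1 / 8 : ℝ) := by
  obtain ⟨C₁, hC₁, h₁⟩ := exists_norm_lerch_le_growth le_rfl hx
  obtain ⟨C₂, hC₂, h₂⟩ := exists_norm_lerch_le_growth le_rfl (norm_inv_eq_one hx)
  refine ⟨C₁ + C₂ + 4, by positivity, fun M s hs => ?_⟩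
  have e1 := h₁ M s 0 hs (Or.inl rfl)
  have e2 := h₂ M (-s) 0 (by rw [norm_neg, hs]) (Or.inl rfl)
  have e3 : ‖1 / s‖ ≤ 4 := by
    rw [norm_div, norm_one, hs, div_le_iff₀ (by positivity)]
    linarith [M.cast_nonneg (α := ℝ)]
  rw [Phi_eq_lerch_sub]
  refine (norm_sub_le _ _).trans ((add_le_add_left (norm_sub_le _ _) _).trans ?_)
  nlinarith [one_le_growth M]

lemma exists_norm_Phi_le_im {x : ℂ} (hx : ‖x‖ = 1) (hx1 : x ≠ 1) :
    ∃ C : ℝ, 0 < C ∧ ∀ (M : ℕ) (s : ℂ), ‖s‖ = M + 1 / 4 → s.im ≠ 0 →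
      ‖Phi s x‖ ≤ C * |s.im| ^ (-(1 / 2) : ℝ) := by
  obtain ⟨C₁, hC₁, h₁⟩ := exists_norm_lerch_le_im le_rfl hx fun h => hx1 h.2
  obtain ⟨C₂, hC₂, h₂⟩ := exists_norm_lerch_le_im le_rfl (norm_inv_eq_one hx)
    fun h => hx1 (inv_eq_one.mp h.2)
  refine ⟨C₁ + C₂ + (1 / 4) ^ (-(1 / 2) : ℝ), by positivity, fun M s hs him => ?_⟩
  have e1 := h₁ M s 0 hs (Or.inl rfl) him
  have e2 := h₂ M (-s) 0 (by rw [norm_neg, hs]) (Or.inl rfl) (by simpa using him)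
  rw [Complex.neg_im, abs_neg] at e2
  have hpos : 0 < ‖s‖ := by rw [hs]; positivity
  have e3 : ‖1 / s‖ ≤ (1 / 4) ^ (-(1 / 2) : ℝ) * |s.im| ^ (-(1 / 2) : ℝ) := by
    have : ‖1 / s‖ = ‖s‖ ^ (-(1 / 2) : ℝ) * ‖s‖ ^ (-(1 / 2) : ℝ) := by
      rw [← Real.rpow_add hpos, norm_div, norm_one, one_div, ← Real.rpow_neg_one]
      norm_num
    rw [this]
    refine mul_le_mul ?_ ?_ (by positivity) (by positivity)
    · refine Real.rpow_le_rpow_of_nonpos (by norm_num) ?_ (by norm_num)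
      rw [hs]
      linarith [M.cast_nonneg (α := ℝ)]
    · exact Real.rpow_le_rpow_of_nonpos (abs_pos.mpr him) (Complex.abs_im_le_norm s) (by norm_num)
  rw [Phi_eq_lerch_sub]
  refine (norm_sub_le _ _).trans ((add_le_add_left (norm_sub_le _ _) _).trans ?_)
  linarith

section

variable {x : ℂ} {y : Fin 2 → ℂ} {p : Fin 2 → ℕ}

lemma kernel_eq_lerch (hy : ∀ j, ‖y j‖ = 1) (hp : ∀ j, 1 ≤ p j) {M : ℕ} {s : ℂ} {h : ℝ}
    (hs : ‖s‖ = M + 1 / 4) (hh : h = 0 ∨ h = 1 / 2) :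
    kernel h x p y s
      = Phi s x * lerch (p 0) (y 0) (s + h) * lerch (p 1) (y 1) (s + h) := by
  have hd := mem_lerchDomain_of_norm_eq hs hh
  rw [kernel_eq hp, lerchDeriv_eq_lerch (hy 0) hd (hp 0), lerchDeriv_eq_lerch (hy 1) hd (hp 1)]

lemma norm_mul_mul_le {a b c : ℂ} {A B C : ℝ} (ha : ‖a‖ ≤ A) (hb : ‖b‖ ≤ B) (hc : ‖c‖ ≤ C) :
    ‖a * b * c‖ ≤ A * B * C := by
  have hA := (norm_nonneg a).trans ha
  have hB := (norm_nonneg b).trans hb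
  rw [norm_mul, norm_mul]
  gcongr

lemma exists_norm_kernel_le (hx : ‖x‖ = 1) (hy : ∀ j, ‖y j‖ = 1) (hp : ∀ j, 1 ≤ p j) {h : ℝ}
    (hh : h = 0 ∨ h = 1 / 2) :
    ∃ C : ℝ, 0 < C ∧ ∀ (M : ℕ) (s : ℂ), ‖s‖ = M + 1 / 4 →
      ‖kernel h x p y s‖ ≤ C * ((M : ℝ) + 3) ^ (3 / 8 : ℝ) := by
  obtain ⟨C, hC, hΦ⟩ := exists_norm_Phi_le_growth hx
  obtain ⟨C₀, hC₀, h₀⟩ := exists_norm_lerch_le_growth (hp 0) (hy 0)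
  obtain ⟨C₁, hC₁, h₁⟩ := exists_norm_lerch_le_growth (hp 1) (hy 1)
  refine ⟨C * C₀ * C₁, by positivity, fun M s hs => ?_⟩
  rw [kernel_eq_lerch hy hp hs hh]
  refine (norm_mul_mul_le (hΦ M s hs) (h₀ M s h hs hh) (h₁ M s h hs hh)).trans_eq ?_
  have : ((M : ℝ) + 3) ^ (3 / 8 : ℝ) = ((M : ℝ) + 3) ^ (1 / 8 : ℝ) * ((M : ℝ) + 3) ^ (1 / 8 : ℝ)
      * ((M : ℝ) + 3) ^ (1 / 8 : ℝ) := by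
    rw [← Real.rpow_add (by positivity), ← Real.rpow_add (by positivity)]
    norm_num
  rw [this]
  ring

/-- If z ≠ 1, then x, x₁ or x₂ differs from 1. The factor belonging to it decays in |Im s|; the
other two are bounded by the growth M^(1/8) each. -/
lemma exists_norm_kernel_le_im (hx : ‖x‖ = 1) (hy : ∀ j, ‖y j‖ = 1) (hp : ∀ j, 1 ≤ p j) {h : ℝ}
    (hh : h = 0 ∨ h = 1 / 2) (hz : x * y 0 * y 1 ≠ 1) :
    ∃ C : ℝ, 0 < C ∧ ∀ (M : ℕ) (s : ℂ), ‖s‖ = M + 1 / 4 → s.im ≠ 0 →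
      ‖kernel h x p y s‖ ≤ C * ((M : ℝ) + 3) ^ (1 / 4 : ℝ) * |s.im| ^ (-(1 / 2) : ℝ) := by
  obtain ⟨C, hC, hΦ⟩ := exists_norm_Phi_le_growth hx
  obtain ⟨C₀, hC₀, h₀⟩ := exists_norm_lerch_le_growth (hp 0) (hy 0)
  obtain ⟨C₁, hC₁, h₁⟩ := exists_norm_lerch_le_growth (hp 1) (hy 1)
  have hW : ∀ M : ℕ, ((M : ℝ) + 3) ^ (1 / 4 : ℝ)
      = ((M : ℝ) + 3) ^ (1 / 8 : ℝ) * ((M : ℝ) + 3) ^ (1 / 8 : ℝ) := fun M => by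
    rw [← Real.rpow_add (by positivity)]
    norm_num
  by_cases hx1 : x = 1
  · by_cases hy0 : y 0 = 1
    · have hy1 : y 1 ≠ 1 := fun h => hz (by rw [hx1, hy0, h]; norm_num)
      obtain ⟨C', hC', h'⟩ := exists_norm_lerch_le_im (hp 1) (hy 1) fun h => hy1 h.2
      refine ⟨C * C₀ * C', by positivity, fun M s hs him => ?_⟩
      rw [kernel_eq_lerch hy hp hs hh, hW]
      refine (norm_mul_mul_le (hΦ M s hs) (h₀ M s h hs hh) (h' M s h hs hh him)).trans_eq ?_
      ring
    · obtain ⟨C', hC', h'⟩ := exists_norm_lerch_le_im (hp 0) (hy 0) fun h => hy0 h.2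
      refine ⟨C * C' * C₁, by positivity, fun M s hs him => ?_⟩
      rw [kernel_eq_lerch hy hp hs hh, hW]
      refine (norm_mul_mul_le (hΦ M s hs) (h' M s h hs hh him) (h₁ M s h hs hh)).trans_eq ?_
      ring
  · obtain ⟨C', hC', h'⟩ := exists_norm_Phi_le_im hx hx1
    refine ⟨C' * C₀ * C₁, by positivity, fun M s hs him => ?_⟩
    rw [kernel_eq_lerch hy hp hs hh, hW]
    refine (norm_mul_mul_le (h' M s hs him) (h₀ M s h hs hh) (h₁ M s h hs hh)).trans_eq ?_
    ring

end

/-! ### Vanishing of the circle integrals -/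

/-- On [0, π/2] Jordan's inequality sin θ ≥ 2θ/π reduces this to θ^(-1/2); the reflections at π/2
and at π give the rest. -/
lemma intervalIntegrable_abs_sin_rpow :
    IntervalIntegrable (fun θ => |Real.sin θ| ^ (-(1 / 2) : ℝ)) MeasureTheory.volume
      0 (2 * Real.pi) := by
  have hπ := Real.pi_pos
  have h1 : IntervalIntegrable (fun θ => |Real.sin θ| ^ (-(1 / 2) : ℝ)) MeasureTheory.volume
      0 (Real.pi / 2) := by
    have hg : IntervalIntegrable (fun θ : ℝ => (2 / Real.pi) ^ (-(1 / 2) : ℝ) * θ ^ (-(1 / 2) : ℝ))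
        MeasureTheory.volume 0 (Real.pi / 2) :=
      (intervalIntegral.intervalIntegrable_rpow' (by norm_num)).const_mul _
    refine hg.mono_fun' (Measurable.aestronglyMeasurable (by fun_prop)) ?_
    refine (MeasureTheory.ae_restrict_mem measurableSet_uIoc).mono fun θ hθ => ?_
    rw [Set.uIoc_of_le (by positivity)] at hθ
    have hθ0 := hθ.1
    have := Real.mul_le_sin hθ0.le hθ.2
    beta_reduce
    rw [Real.norm_of_nonneg (by positivity), ← Real.mul_rpow (by positivity) hθ0.le]
    exact Real.rpow_le_rpow_of_nonpos (by positivity) (this.trans (le_abs_self _)) (by norm_num)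
  have h2 := h1.comp_sub_left Real.pi
  simp only [Real.sin_pi_sub] at h2
  have h3 : IntervalIntegrable (fun θ => |Real.sin θ| ^ (-(1 / 2) : ℝ)) MeasureTheory.volume
      0 Real.pi := by
    refine h1.trans ?_
    have := h2.symm
    rwa [sub_zero, show Real.pi - Real.pi / 2 = Real.pi / 2 by ring] at this
  refine h3.trans ?_
  have h4 := (h3.comp_sub_left (2 * Real.pi)).symm
  simp only [Real.sin_two_pi_sub, abs_neg] at h4
  rwa [sub_zero, show 2 * Real.pi - Real.pi = Real.pi by ring] at h4

lemma tendsto_const_mul_rpow_neg (C : ℝ) {a : ℝ} (ha : 0 < a) :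
    Tendsto (fun M : ℕ => C * ((M : ℝ) + 3) ^ (-a)) atTop (𝓝 0) := by
  have h1 : Tendsto (fun M : ℕ => (M : ℝ) + 3) atTop atTop :=
    tendsto_atTop_add_const_right _ _ tendsto_natCast_atTop_atTop
  simpa using ((tendsto_rpow_neg_atTop ha).comp h1).const_mul C

lemma ae_sin_ne_zero : ∀ᵐ θ : ℝ, Real.sin θ ≠ 0 := by
  have hc : {θ : ℝ | Real.sin θ = 0}.Countable := by
    have : {θ : ℝ | Real.sin θ = 0} ⊆ Set.range fun n : ℤ => (n : ℝ) * Real.pi := fun θ hθ =>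
      Real.sin_eq_zero_iff.mp hθ
    exact (Set.countable_range _).mono this
  rw [MeasureTheory.ae_iff]
  simpa using hc.measure_zero MeasureTheory.volume

/-- Count of exponents, with R of order M for the length of the circle: R · M^(3/8) · R⁻² = M^(-5/8)
in the first case, and R · M^(1/4) · R^(-1/2) · R⁻¹ = M^(-1/4) in the second, where the factor |sin
θ|^(-1/2) is integrated. -/
lemma tendsto_circleIntegral_kernel {x : ℂ} {y : Fin 2 → ℂ} {p : Fin 2 → ℕ} (hx : ‖x‖ = 1)
    (hy : ∀ j, ‖y j‖ = 1) (hp : ∀ j, 1 ≤ p j) {h : ℝ} (hh : h = 0 ∨ h = 1 / 2) {F : ℂ → ℂ}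
    (hF : (F =O[Bornology.cobounded ℂ] fun s => s ^ (-2 : ℤ)) ∨
      (x * y 0 * y 1 ≠ 1 ∧ F =O[Bornology.cobounded ℂ] fun s => s ^ (-1 : ℤ))) :
    Tendsto (fun M : ℕ => ∮ s in C(0, (M : ℝ) + 1 / 4), kernel h x p y s * F s) atTop (𝓝 0) := by
  rw [tendsto_zero_iff_norm_tendsto_zero]
  -- The constant 16 is chosen for its square root 4, which appears in the second case.
  have hR13 : ∀ M : ℕ, ((M : ℝ) + 3) / 16 ≤ (M : ℝ) + 1 / 4 := fun M => by
    linarith [M.cast_nonneg (α := ℝ)]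
  rcases hF with hF | ⟨hz, hF⟩
  · obtain ⟨C, hC, hK⟩ := exists_norm_kernel_le hx hy hp hh
    obtain ⟨C', hC', hF'⟩ := hF.exists_pos
    obtain ⟨r, -, hr⟩ := Filter.hasBasis_cobounded_norm.eventually_iff.mp hF'.bound
    refine squeeze_zero' (Eventually.of_forall fun _ => norm_nonneg _) ?_
      (tendsto_const_mul_rpow_neg (2 * Real.pi * C * C' * 16) (a := 5 / 8) (by norm_num))
    filter_upwards [tendsto_natCast_atTop_atTop.eventually_ge_atTop r] with M hM
    have hR : (0 : ℝ) < (M : ℝ) + 1 / 4 := by positivity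
    have hM3 : (0 : ℝ) < (M : ℝ) + 3 := by positivity
    refine (circleIntegral.norm_integral_le_of_norm_le_const hR.le
      (C := C * ((M : ℝ) + 3) ^ (3 / 8 : ℝ) * (C' * ((M : ℝ) + 1 / 4)⁻¹ ^ 2))
      fun s hs => ?_).trans ?_
    · rw [mem_sphere_zero_iff_norm] at hs
      have h1 := hr (x := s) (by simp only [Set.mem_ofPred_eq]; linarith)
      rw [norm_zpow, hs] at h1
      rw [norm_mul]
      refine mul_le_mul (hK M s hs) (h1.trans_eq ?_) (norm_nonneg _) (by positivity)
      rw [zpow_neg, inv_pow]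
      norm_cast
    · have e : ((M : ℝ) + 3) ^ (-(5 / 8) : ℝ) = ((M : ℝ) + 3) ^ (3 / 8 : ℝ) * ((M : ℝ) + 3)⁻¹ := by
        rw [← Real.rpow_neg_one ((M : ℝ) + 3), ← Real.rpow_add hM3]
        norm_num
      have h2 : ((M : ℝ) + 1 / 4)⁻¹ ≤ 16 * ((M : ℝ) + 3)⁻¹ := by
        rw [← div_eq_mul_inv, inv_le_comm₀ hR (by positivity), inv_div]
        exact hR13 M
      calc 2 * Real.pi * ((M : ℝ) + 1 / 4)
            * (C * ((M : ℝ) + 3) ^ (3 / 8 : ℝ) * (C' * ((M : ℝ) + 1 / 4)⁻¹ ^ 2))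
          = 2 * Real.pi * C * C' * ((M : ℝ) + 3) ^ (3 / 8 : ℝ) * ((M : ℝ) + 1 / 4)⁻¹ := by
            field_simp
        _ ≤ 2 * Real.pi * C * C' * ((M : ℝ) + 3) ^ (3 / 8 : ℝ) * (16 * ((M : ℝ) + 3)⁻¹) := by
            gcongr
        _ = _ := by
            rw [e]
            ring
  · obtain ⟨C, hC, hK⟩ := exists_norm_kernel_le_im hx hy hp hh hz
    obtain ⟨C', hC', hF'⟩ := hF.exists_pos
    obtain ⟨r, -, hr⟩ := Filter.hasBasis_cobounded_norm.eventually_iff.mp hF'.bound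
    set I := ∫ θ in (0 : ℝ)..(2 * Real.pi), |Real.sin θ| ^ (-(1 / 2) : ℝ)
    refine squeeze_zero' (Eventually.of_forall fun _ => norm_nonneg _) ?_
      (tendsto_const_mul_rpow_neg (C * C' * 4 * I) (a := 1 / 4) (by norm_num))
    filter_upwards [tendsto_natCast_atTop_atTop.eventually_ge_atTop r] with M hM
    have hR : (0 : ℝ) < (M : ℝ) + 1 / 4 := by positivity
    have hM3 : (0 : ℝ) < (M : ℝ) + 3 := by positivity
    refine (intervalIntegral.norm_integral_le_of_norm_le Real.two_pi_pos.le
      (g := fun θ => C * C' * 4 * ((M : ℝ) + 3) ^ (-(1 / 4) : ℝ) * |Real.sin θ| ^ (-(1 / 2) : ℝ))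
      ?_ (intervalIntegrable_abs_sin_rpow.const_mul _)).trans_eq ?_
    · filter_upwards [ae_sin_ne_zero] with θ hθ _
      set s := circleMap 0 ((M : ℝ) + 1 / 4) θ with hsdef
      have hs : ‖s‖ = (M : ℝ) + 1 / 4 := by
        rw [hsdef, norm_circleMap_zero, abs_of_pos hR]
      have him : s.im = ((M : ℝ) + 1 / 4) * Real.sin θ := by
        rw [hsdef, circleMap_zero, Complex.im_ofReal_mul, Complex.exp_ofReal_mul_I_im]
      have h1 := hr (x := s) (by simp only [Set.mem_ofPred_eq]; linarith)
      rw [norm_zpow, hs, zpow_neg_one] at h1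
      have h2 := hK M s hs (by rw [him]; exact mul_ne_zero hR.ne' hθ)
      rw [him, abs_mul, abs_of_pos hR, Real.mul_rpow hR.le (abs_nonneg _)] at h2
      have h3 : ((M : ℝ) + 1 / 4) ^ (-(1 / 2) : ℝ) ≤ 4 * ((M : ℝ) + 3) ^ (-(1 / 2) : ℝ) := by
        refine (Real.rpow_le_rpow_of_nonpos (by positivity) (hR13 M) (by norm_num)).trans_eq ?_
        rw [Real.div_rpow hM3.le (by norm_num), show (16 : ℝ) = 4 ^ (2 : ℝ) by norm_num,
          ← Real.rpow_mul (by norm_num), show (2 : ℝ) * -(1 / 2) = -1 by norm_num,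
          Real.rpow_neg_one]
        field_simp
      have h4 : ((M : ℝ) + 3) ^ (-(1 / 4) : ℝ)
          = ((M : ℝ) + 3) ^ (1 / 4 : ℝ) * ((M : ℝ) + 3) ^ (-(1 / 2) : ℝ) := by
        rw [← Real.rpow_add hM3]
        norm_num
      rw [norm_smul, deriv_circleMap, norm_mul, Complex.norm_I, mul_one, ← hsdef, hs, norm_mul, h4]
      calc ((M : ℝ) + 1 / 4) * (‖kernel h x p y s‖ * ‖F s‖)
          ≤ ((M : ℝ) + 1 / 4) * ((C * ((M : ℝ) + 3) ^ (1 / 4 : ℝ)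
            * ((((M : ℝ) + 1 / 4) ^ (-(1 / 2) : ℝ)) * |Real.sin θ| ^ (-(1 / 2) : ℝ)))
            * (C' * ((M : ℝ) + 1 / 4)⁻¹)) := by
            gcongr
        _ = C * C' * ((M : ℝ) + 3) ^ (1 / 4 : ℝ) * |Real.sin θ| ^ (-(1 / 2) : ℝ)
            * ((M : ℝ) + 1 / 4) ^ (-(1 / 2) : ℝ) := by
            field_simp
        _ ≤ C * C' * ((M : ℝ) + 3) ^ (1 / 4 : ℝ) * |Real.sin θ| ^ (-(1 / 2) : ℝ)
            * (4 * ((M : ℝ) + 3) ^ (-(1 / 2) : ℝ)) := by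
            gcongr
        _ = _ := by ring
    · rw [intervalIntegral.integral_const_mul]
      ring

/-! ### Slowly varying sequences and convergence of series -/

/-- `u_n = O(n^ε)` and `u_{n+1} - u_n = O(n^(ε-1))` for all `ε > 0`. -/
def Slow (u : ℕ → ℂ) : Prop :=
  ∀ ε : ℝ, 0 < ε → (u =O[atTop] fun n : ℕ => (n : ℝ) ^ ε) ∧
    (fun n => u (n + 1) - u n) =O[atTop] fun n : ℕ => (n : ℝ) ^ (ε - 1)

/-- `v_n = O(n⁻¹)` and `v_{n+1} - v_n = O(n⁻²)`, and even `v_n = O(n⁻²)` if `z = 1`. -/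
def Tame (z : ℂ) (v : ℕ → ℂ) : Prop :=
  (v =O[atTop] fun n : ℕ => (n : ℝ) ^ (-1 : ℝ)) ∧
    ((fun n => v (n + 1) - v n) =O[atTop] fun n : ℕ => (n : ℝ) ^ (-2 : ℝ)) ∧
    (z ≠ 1 ∨ v =O[atTop] fun n : ℕ => (n : ℝ) ^ (-2 : ℝ))

lemma isBigO_natCast_rpow {a b : ℝ} (h : a ≤ b) :
    (fun n : ℕ => (n : ℝ) ^ a) =O[atTop] fun n : ℕ => (n : ℝ) ^ b := by
  refine Asymptotics.IsBigO.of_bound 1 ?_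
  filter_upwards [eventually_ge_atTop 1] with n hn
  have hn' : (1 : ℝ) ≤ n := by exact_mod_cast hn
  rw [one_mul, Real.norm_of_nonneg (by positivity), Real.norm_of_nonneg (by positivity)]
  exact Real.rpow_le_rpow_of_exponent_le hn' h

lemma natCast_rpow_mul_eventuallyEq (a b : ℝ) :
    (fun n : ℕ => (n : ℝ) ^ a * (n : ℝ) ^ b) =ᶠ[atTop] fun n : ℕ => (n : ℝ) ^ (a + b) := by
  filter_upwards [eventually_ge_atTop 1] with n hn
  have hn' : (0 : ℝ) < n := by exact_mod_cast hn
  rw [Real.rpow_add hn']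

lemma isBigO_mul_natCast_rpow {u v : ℕ → ℂ} {a b c : ℝ} (hu : u =O[atTop] fun n : ℕ => (n : ℝ) ^ a)
    (hv : v =O[atTop] fun n : ℕ => (n : ℝ) ^ b) (h : a + b ≤ c) :
    (fun n => u n * v n) =O[atTop] fun n : ℕ => (n : ℝ) ^ c :=
  ((hu.mul hv).trans_eventuallyEq (natCast_rpow_mul_eventuallyEq a b)).trans (isBigO_natCast_rpow h)

lemma isBigO_succ_of_sub {v : ℕ → ℂ} {a b : ℝ} (hv : v =O[atTop] fun n : ℕ => (n : ℝ) ^ a)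
    (hd : (fun n => v (n + 1) - v n) =O[atTop] fun n : ℕ => (n : ℝ) ^ b) (h : b ≤ a) :
    (fun n => v (n + 1)) =O[atTop] fun n : ℕ => (n : ℝ) ^ a := by
  have := (hd.trans (isBigO_natCast_rpow h)).add hv
  simpa using this

lemma Slow.add {u v : ℕ → ℂ} (hu : Slow u) (hv : Slow v) : Slow fun n => u n + v n := fun ε hε => by
  refine ⟨(hu ε hε).1.add (hv ε hε).1, ?_⟩
  refine ((hu ε hε).2.add (hv ε hε).2).congr_left fun n => ?_
  ring

/-- The quantifier over all ε makes the class closed under products: each factor gets ε/2. -/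
lemma Slow.mul {u v : ℕ → ℂ} (hu : Slow u) (hv : Slow v) : Slow fun n => u n * v n := fun ε hε => by
  obtain ⟨hu1, hu2⟩ := hu (ε / 2) (by positivity)
  obtain ⟨hv1, hv2⟩ := hv (ε / 2) (by positivity)
  refine ⟨isBigO_mul_natCast_rpow hu1 hv1 (by linarith), ?_⟩
  have h1 := isBigO_mul_natCast_rpow (c := ε - 1) hu2 (isBigO_succ_of_sub hv1 hv2 (by linarith))
    (by linarith)
  have h2 := isBigO_mul_natCast_rpow (c := ε - 1) hu1 hv2 (by linarith)
  refine (h1.add h2).congr_left fun n => ?_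
  ring

lemma isBigO_const_natCast_rpow (c : ℂ) {a : ℝ} (ha : 0 ≤ a) :
    (fun _ : ℕ => c) =O[atTop] fun n : ℕ => (n : ℝ) ^ a := by
  refine Asymptotics.IsBigO.trans ?_ (isBigO_natCast_rpow ha)
  simpa using Asymptotics.isBigO_const_const c (one_ne_zero (α := ℝ)) atTop

lemma slow_const (c : ℂ) : Slow fun _ => c := fun ε hε => by
  refine ⟨isBigO_const_natCast_rpow c hε.le, ?_⟩
  simpa using Asymptotics.isBigO_zero _ _

lemma Slow.const_mul {u : ℕ → ℂ} (hu : Slow u) (c : ℂ) : Slow fun n => c * u n :=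
  (slow_const c).mul hu

lemma isBigO_succ_rpow_neg_one :
    (fun n : ℕ => ((n + 1 : ℕ) : ℝ) ^ (-1 : ℝ)) =O[atTop] fun n : ℕ => (n : ℝ) ^ (-1 : ℝ) := by
  refine Asymptotics.IsBigO.of_bound 1 ?_
  filter_upwards [eventually_ge_atTop 1] with n hn
  have hn' : (0 : ℝ) < n := by exact_mod_cast hn
  rw [one_mul, Real.norm_of_nonneg (by positivity), Real.norm_of_nonneg (by positivity)]
  exact Real.rpow_le_rpow_of_nonpos hn' (by push_cast; linarith) (by norm_num)

lemma slow_of_isBigO_rpow_neg_one {u : ℕ → ℂ} (hu : u =O[atTop] fun n : ℕ => (n : ℝ) ^ (-1 : ℝ)) :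
    Slow u := fun ε hε => by
  refine ⟨hu.trans (isBigO_natCast_rpow (by linarith)), ?_⟩
  have h1 : (fun n => u (n + 1)) =O[atTop] fun n : ℕ => (n : ℝ) ^ (-1 : ℝ) :=
    (hu.comp_tendsto (tendsto_add_atTop_nat 1)).trans isBigO_succ_rpow_neg_one
  exact (h1.sub hu).trans (isBigO_natCast_rpow (by linarith))

/-- Such sums grow at most like the harmonic numbers, hence logarithmically, and their increments
are O(1/n). -/
lemma slow_sum_Icc {a : ℕ → ℂ} {C : ℝ} (ha : ∀ k, 1 ≤ k → ‖a k‖ ≤ C * (1 / (k : ℝ))) :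
    Slow fun n => ∑ k ∈ Icc 1 n, a k := fun ε hε => by
  have hC : 0 ≤ C := by simpa using (norm_nonneg _).trans (ha 1 le_rfl)
  constructor
  · have hlog : (fun n : ℕ => 1 + Real.log n) =O[atTop] fun n : ℕ => (n : ℝ) ^ ε := by
      refine Asymptotics.IsBigO.add ?_ ?_
      · refine Asymptotics.IsBigO.trans ?_ (isBigO_natCast_rpow hε.le)
        simpa using Asymptotics.isBigO_refl (fun _ : ℕ => (1 : ℝ)) atTop
      · exact (isLittleO_log_rpow_atTop hε).isBigO.comp_tendsto tendsto_natCast_atTop_atTop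
    refine (Asymptotics.IsBigO.of_bound C (Eventually.of_forall fun n => ?_)).trans hlog
    have h1 : ‖∑ k ∈ Icc 1 n, a k‖ ≤ ∑ k ∈ Icc 1 n, C * (1 / (k : ℝ)) :=
      (norm_sum_le _ _).trans (sum_le_sum fun k hk => ha k (mem_Icc.mp hk).1)
    have h2 : ∑ k ∈ Icc 1 n, (1 / (k : ℝ)) = (harmonic n : ℝ) := by
      rw [harmonic_eq_sum_Icc]
      simp
    rw [← mul_sum, h2] at h1
    refine h1.trans (mul_le_mul_of_nonneg_left ?_ hC)
    exact (harmonic_le_one_add_log n).trans (le_abs_self _)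
  · have h1 : (fun n => (∑ k ∈ Icc 1 (n + 1), a k) - ∑ k ∈ Icc 1 n, a k) = fun n => a (n + 1) := by
      ext n
      rw [sum_Icc_succ_top (by omega), add_sub_cancel_left]
    rw [h1]
    refine Asymptotics.IsBigO.trans (g := fun n : ℕ => (n : ℝ) ^ (-1 : ℝ)) ?_
      (isBigO_natCast_rpow (by linarith))
    refine (Asymptotics.IsBigO.of_bound C (Eventually.of_forall fun n => ?_)).trans
      isBigO_succ_rpow_neg_one
    rw [Real.rpow_neg_one, norm_inv, Real.norm_natCast, ← one_div]
    exact ha (n + 1) (by omega)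

lemma slow_zetaFin {x : ℂ} (hx : ‖x‖ = 1) {p : ℕ} (hp : 1 ≤ p) : Slow fun n => zetaFin n p x := by
  refine slow_sum_Icc (C := 1) fun k hk => ?_
  have hk' : (1 : ℝ) ≤ k := by exact_mod_cast hk
  rw [norm_div, norm_pow, norm_pow, hx, one_pow, Complex.norm_natCast, one_mul]
  exact one_div_le_one_div_of_le (by linarith) (le_self_pow₀ hk' (by omega))

lemma slow_tFin {x : ℂ} (hx : ‖x‖ = 1) {p : ℕ} (hp : 1 ≤ p) : Slow fun n => tFin n p x := by
  refine slow_sum_Icc (C := 2 ^ p) fun k hk => ?_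
  have hk' : (1 : ℝ) ≤ k := by exact_mod_cast hk
  have h1 : ‖(k : ℂ) - 1 / 2‖ = k - 1 / 2 := by
    have : (k : ℂ) - 1 / 2 = ((k - 1 / 2 : ℝ) : ℂ) := by push_cast; rfl
    rw [this, Complex.norm_real, Real.norm_of_nonneg (by linarith)]
  rw [norm_div, norm_pow, norm_pow, hx, one_pow, h1]
  have h2 : (k : ℝ) / 2 ^ p ≤ (k - 1 / 2) ^ p :=
    calc (k : ℝ) / 2 ^ p ≤ (k : ℝ) ^ p / 2 ^ p := by
          gcongr
          exact le_self_pow₀ hk' (by omega)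
      _ = (k / 2 : ℝ) ^ p := (div_pow _ _ _).symm
      _ ≤ (k - 1 / 2) ^ p := by
          gcongr
          linarith
  refine (one_div_le_one_div_of_le (by positivity) h2).trans_eq ?_
  rw [one_div_div, div_eq_mul_one_div]

lemma slow_zetaFin_pred {x : ℂ} (hx : ‖x‖ = 1) {p : ℕ} (hp : 1 ≤ p) :
    Slow fun n => zetaFin (n - 1) p x := by
  have h1 : Slow fun n : ℕ => (-1 : ℂ) * (x ^ n / (n : ℂ) ^ p) := by
    refine (slow_of_isBigO_rpow_neg_one (Asymptotics.IsBigO.of_bound 1 ?_)).const_mul _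
    filter_upwards [eventually_ge_atTop 1] with n hn
    have hn' : (1 : ℝ) ≤ n := by exact_mod_cast hn
    rw [norm_div, norm_pow, norm_pow, hx, one_pow, Complex.norm_natCast, Real.rpow_neg_one,
      norm_inv, Real.norm_natCast, one_mul, ← one_div]
    exact one_div_le_one_div_of_le (by linarith) (le_self_pow₀ hn' (by omega))
  have h2 := (slow_zetaFin hx hp).add h1
  convert h2 using 2 with n
  -- At n = 0 both sides vanish: 0 - 1 is 0 in ℕ, and division by 0^p = 0 gives 0.
  rcases n with _ | n
  · simp [zetaFin, show p ≠ 0 by omega]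
  · rw [Nat.add_sub_cancel, zetaFin, zetaFin, sum_Icc_succ_top (by omega)]
    ring

lemma seriesFrom_of_tendsto_range {a : ℕ → ℂ} {S : ℂ}
    (h : Tendsto (fun N => ∑ n ∈ range N, a n) atTop (𝓝 S)) (n₀ : ℕ) : ∃ T, SeriesFrom n₀ a T := by
  refine ⟨S - ∑ n ∈ range n₀, a n, (h.sub_const _).congr' ?_⟩
  filter_upwards [eventually_ge_atTop n₀] with N hN
  rw [sum_Ico_eq_sub _ hN]

/-- With ε = 1/2 the terms are O(n^(-3/2)) if z = 1. If z ≠ 1, put b = u·v; summation by parts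
expresses (1-z) ∑ z^n b_n through boundary terms, where b_N → 0, and a series with the increments of
b, which are O(n^(-3/2)). -/
lemma exists_seriesFrom_slow_mul_tame {z : ℂ} (hz : ‖z‖ = 1) {u v : ℕ → ℂ} (hu : Slow u)
    (hv : Tame z v) (n₀ : ℕ) {a : ℕ → ℂ} (ha : ∀ n, a n = z ^ n * u n * v n) :
    ∃ T, SeriesFrom n₀ a T := by
  obtain ⟨hu1, hu2⟩ := hu (1 / 2) (by norm_num)
  obtain ⟨hv1, hv2, hv3⟩ := hv
  have hsum : ∀ {w : ℕ → ℂ}, (w =O[atTop] fun n : ℕ => (n : ℝ) ^ (-(3 / 2) : ℝ)) → Summable w :=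
    fun hw => summable_of_isBigO_nat (Real.summable_nat_rpow.mpr (by norm_num)) hw
  by_cases hz1 : z = 1
  · have h2 := hv3.resolve_left (not_not.mpr hz1)
    have hw : Summable a := hsum (by
      refine (isBigO_mul_natCast_rpow hu1 h2 (by norm_num)).congr_left fun n => ?_
      rw [ha, hz1, one_pow, one_mul])
    exact seriesFrom_of_tendsto_range hw.hasSum.tendsto_sum_nat n₀
  · set b : ℕ → ℂ := fun n => u n * v n with hb
    have hb0 : Tendsto b atTop (𝓝 0) := by
      refine (isBigO_mul_natCast_rpow (c := -(1 / 2)) hu1 hv1 (by norm_num)).trans_tendsto ?_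
      exact (tendsto_rpow_neg_atTop (by norm_num)).comp tendsto_natCast_atTop_atTop
    have hbz : Tendsto (fun n => z ^ n * b n) atTop (𝓝 0) := by
      rw [tendsto_zero_iff_norm_tendsto_zero] at hb0 ⊢
      refine hb0.congr fun n => ?_
      rw [norm_mul (z ^ n), norm_pow, hz, one_pow, one_mul]
    have hdb : Summable fun n => z ^ (n + 1) * (b (n + 1) - b n) := by
      have h1 := isBigO_mul_natCast_rpow (c := -(3 / 2)) hu2
        (isBigO_succ_of_sub hv1 hv2 (by norm_num)) (by norm_num)
      have h2 := isBigO_mul_natCast_rpow (c := -(3 / 2)) hu1 hv2 (by norm_num)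
      refine hsum (((h1.add h2).norm_left.congr_left fun n => ?_).of_norm_left)
      rw [norm_mul, norm_pow, hz, one_pow, one_mul]
      congr 1
      rw [hb]
      ring
    have h := ((hbz.const_sub (b 0)).add hdb.hasSum.tendsto_sum_nat).const_mul (1 - z)⁻¹
    refine seriesFrom_of_tendsto_range (h.congr fun N => ?_) n₀
    have hz' : 1 - z ≠ 0 := sub_ne_zero.mpr (Ne.symm hz1)
    have ht := Finset.sum_range_sub' (fun n => z ^ n * b n) N
    rw [inv_mul_eq_iff_eq_mul₀ hz', mul_sum]
    rw [pow_zero, one_mul] at ht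
    rw [← ht, ← sum_add_distrib]
    refine sum_congr rfl fun n _ => ?_
    rw [ha, hb]
    ring

lemma exists_seriesFrom_sum {ι : Type*} (I : Finset ι) {n₀ : ℕ} {a : ι → ℕ → ℂ}
    (h : ∀ i ∈ I, ∃ T, SeriesFrom n₀ (a i) T) :
    ∃ T, SeriesFrom n₀ (fun n => ∑ i ∈ I, a i n) T := by
  choose! T hT using h
  refine ⟨∑ i ∈ I, T i, (tendsto_finsetSum I hT).congr fun N => ?_⟩
  rw [sum_comm]

/-! ### Rational functions -/

lemma mem_poles_iff {r : RatFunc ℂ} {s : ℂ} : s ∈ poles r ↔ r.denom.eval s = 0 := by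
  classical
  rw [poles]
  simp only [Multiset.mem_toFinset]
  rw [Polynomial.mem_roots r.denom_ne_zero, Polynomial.IsRoot.def]

lemma ev_eq (r : RatFunc ℂ) (s : ℂ) : ev r s = r.num.eval s / r.denom.eval s := rfl

lemma analyticAt_ev {r : RatFunc ℂ} {s : ℂ} (hs : s ∉ poles r) : AnalyticAt ℂ (ev r) s := by
  have h : ev r = fun w => r.num.eval w / r.denom.eval w := funext (ev_eq r)
  have hp : ∀ P : Polynomial ℂ, AnalyticAt ℂ (fun w => P.eval w) s := fun P =>
    (P.differentiable).analyticAt s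
  rw [h]
  exact (hp _).div (hp _) (by rwa [mem_poles_iff] at hs)

lemma ev_algebraMap_mul (P : Polynomial ℂ) {r : RatFunc ℂ} {s : ℂ} (hs : s ∉ poles r) :
    ev (algebraMap (Polynomial ℂ) (RatFunc ℂ) P * r) s = P.eval s * ev r s := by
  rw [mem_poles_iff] at hs
  rw [ev, RatFunc.eval_mul _ _ _ hs, RatFunc.eval_algebraMap]
  · rfl
  · simp

lemma eventually_notMem_poles (r : RatFunc ℂ) (a : ℂ) : ∀ᶠ s in 𝓝[≠] a, s ∉ poles r := by
  have h : ((poles r : Set ℂ) \ {a})ᶜ ∈ 𝓝 a :=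
    ((poles r).finite_toSet.subset Set.sdiff_subset).isClosed.isOpen_compl.mem_nhds (by simp)
  filter_upwards [nhdsWithin_le_nhds h, self_mem_nhdsWithin] with s hs hsa hmem
  exact hs ⟨hmem, hsa⟩

/-- The reduced denominator of R divides that of r stripped of all its factors X - a, so R is
regular at a. As `ev` evaluates in lowest terms, it gives the analytic continuation of (s-a)^q r(s)
to a. -/
lemma ev_local_form {r R : RatFunc ℂ} {a : ℂ} {q : ℕ} (hr : PoleOrderLE r a q)
    (hR : R = algebraMap (Polynomial ℂ) (RatFunc ℂ) ((Polynomial.X - Polynomial.C a) ^ q) * r) :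
    AnalyticAt ℂ (ev R) a ∧ ∀ᶠ s in 𝓝[≠] a, ev r s = ((s - a) ^ q)⁻¹ * ev R s := by
  constructor
  · refine analyticAt_ev ?_
    obtain ⟨d, hd, hda⟩ := Polynomial.exists_eq_pow_rootMultiplicity_mul_and_not_dvd r.denom
      r.denom_ne_zero a
    set m := r.denom.rootMultiplicity a
    have hd0 : d ≠ 0 := fun h => by simp [h] at hda
    have hmq : m ≤ q := hr
    have hdvd : R.denom ∣ d := by
      rw [RatFunc.denom_dvd hd0]
      refine ⟨(Polynomial.X - Polynomial.C a) ^ (q - m) * r.num, ?_⟩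
      have h1 : algebraMap (Polynomial ℂ) (RatFunc ℂ) d ≠ 0 := RatFunc.algebraMap_ne_zero hd0
      have h2 : algebraMap (Polynomial ℂ) (RatFunc ℂ) (Polynomial.X - Polynomial.C a) ≠ 0 :=
        RatFunc.algebraMap_ne_zero (Polynomial.X_sub_C_ne_zero a)
      have h3 := RatFunc.num_div_denom r
      rw [hd, map_mul, map_pow] at h3
      rw [hR, map_mul, map_pow, map_pow, ← pow_sub_mul_pow _ hmq]
      nth_rewrite 1 [← h3]
      field_simp
    rw [mem_poles_iff]
    intro h0
    exact hda (Polynomial.dvd_iff_isRoot.mpr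
      (Polynomial.IsRoot.dvd (Polynomial.IsRoot.def.mpr h0) hdvd))
  · filter_upwards [eventually_notMem_poles r a, self_mem_nhdsWithin] with s hs hsa
    have hne : s - a ≠ 0 := sub_ne_zero.mpr hsa
    rw [hR, ev_algebraMap_mul _ hs]
    simp only [Polynomial.eval_pow, Polynomial.eval_sub, Polynomial.eval_X, Polynomial.eval_C]
    rw [inv_mul_cancel_left₀ (pow_ne_zero _ hne)]

lemma taylorCoeff_eq_taylor (r : RatFunc ℂ) (m : ℕ) (a : ℂ) :
    taylorCoeff r m a = taylor (ev r) a m := rfl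

/-- Cauchy's estimate on the disc of radius |a|/2 about a: each derivative gains a factor |a|⁻¹. For
|a| ≥ K the disc avoids all poles and lies where the bound at infinity holds. -/
lemma exists_norm_iteratedDeriv_ev_le {r : RatFunc ℂ} {j : ℕ}
    (hr : ev r =O[Bornology.cobounded ℂ] fun s => s ^ (-(j : ℤ))) (m : ℕ) :
    ∃ C K : ℝ, 0 < C ∧ 0 < K ∧ ∀ a : ℂ, K ≤ ‖a‖ →
      ‖iteratedDeriv m (ev r) a‖ ≤ C * (‖a‖ ^ (j + m))⁻¹ ∧ a ∉ poles r := by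
  obtain ⟨C, hC, hb⟩ := hr.exists_pos
  obtain ⟨K₁, -, hK₁⟩ := Filter.hasBasis_cobounded_norm.eventually_iff.mp hb.bound
  obtain ⟨K₂, hK₂⟩ := ((poles r).finite_toSet.isBounded).exists_norm_le
  have hreg : ∀ s : ℂ, max (max K₁ K₂) 0 + 1 ≤ ‖s‖ → s ∉ poles r := fun s hs hmem => by
    have := hK₂ s hmem
    linarith [le_max_left (max K₁ K₂) 0, le_max_right K₁ K₂]
  refine ⟨m.factorial * C * 2 ^ (j + m), 2 * (max (max K₁ K₂) 0 + 1), by positivity,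
    by positivity, fun a ha => ⟨?_, hreg a (by
      have : 0 ≤ max (max K₁ K₂) 0 := le_max_right _ _
      linarith)⟩⟩
  have hK0 : 0 ≤ max (max K₁ K₂) 0 := le_max_right _ _
  have ha0 : 0 < ‖a‖ := by linarith
  have hfar : ∀ s ∈ Metric.closedBall a (‖a‖ / 2), ‖a‖ / 2 ≤ ‖s‖ := fun s hs => by
    rw [Metric.mem_closedBall, dist_eq_norm, norm_sub_rev] at hs
    have := norm_sub_norm_le a s
    linarith
  have hd : DiffContOnCl ℂ (ev r) (Metric.ball a (‖a‖ / 2)) := by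
    refine DifferentiableOn.diffContOnCl fun s hs => ?_
    have hs' := hfar s (Metric.closure_ball_subset_closedBall hs)
    exact (analyticAt_ev (hreg s (by linarith))).differentiableAt.differentiableWithinAt
  have h := Complex.norm_iteratedDeriv_le_of_forall_mem_sphere_norm_le m (half_pos ha0) hd
    (C := C * ((‖a‖ / 2) ^ j)⁻¹) fun s hs => by
      have hs' := hfar s (Metric.sphere_subset_closedBall hs)
      have h1 := hK₁ (x := s) (by
        simp only [Set.mem_ofPred_eq]
        linarith [le_max_left (max K₁ K₂) 0, le_max_left K₁ K₂])
      refine h1.trans ?_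
      rw [norm_zpow, zpow_neg, zpow_natCast]
      gcongr
  refine h.trans_eq ?_
  rw [pow_add, pow_add, div_pow, div_pow]
  field_simp

lemma isBigO_taylorCoeff {r : RatFunc ℂ} {j : ℕ}
    (hr : ev r =O[Bornology.cobounded ℂ] fun s => s ^ (-(j : ℤ))) (m : ℕ) {c : ℕ → ℂ}
    (hc : ∀ n : ℕ, (n : ℝ) ≤ ‖c n‖) :
    (fun n => taylorCoeff r m (c n)) =O[atTop] fun n : ℕ => (n : ℝ) ^ (-(j : ℝ)) := by
  obtain ⟨C, K, hC, hK, h⟩ := exists_norm_iteratedDeriv_ev_le hr m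
  refine Asymptotics.IsBigO.of_bound C ?_
  filter_upwards [tendsto_natCast_atTop_atTop.eventually_ge_atTop K, eventually_ge_atTop 1]
    with n hn hn1
  have hn' : (1 : ℝ) ≤ n := by exact_mod_cast hn1
  have h1 := (h (c n) (hn.trans (hc n))).1
  rw [taylorCoeff, norm_div, Complex.norm_natCast, Real.norm_of_nonneg (by positivity),
    Real.rpow_neg (by positivity), Real.rpow_natCast]
  refine (div_le_self (norm_nonneg _) (by exact_mod_cast m.factorial_pos)).trans (h1.trans ?_)
  gcongr
  calc (n : ℝ) ^ j ≤ (n : ℝ) ^ (j + m) := pow_le_pow_right₀ hn' (by omega)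
    _ ≤ ‖c n‖ ^ (j + m) := by
      gcongr
      exact hc n

/-- Mean value inequality on the unit ball about c_n: already r = O(s⁻¹) makes every derivative of
positive order O(s⁻²). -/
lemma isBigO_taylorCoeff_sub {r : RatFunc ℂ}
    (hr : ev r =O[Bornology.cobounded ℂ] fun s => s ^ (-(1 : ℕ) : ℤ)) (m : ℕ) {c : ℕ → ℂ}
    (hc : ∀ n : ℕ, (n : ℝ) ≤ ‖c n‖) (hc' : ∀ n, ‖c (n + 1) - c n‖ ≤ 1) :
    (fun n => taylorCoeff r m (c (n + 1)) - taylorCoeff r m (c n))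
      =O[atTop] fun n : ℕ => (n : ℝ) ^ (-2 : ℝ) := by
  obtain ⟨C, K, hC, hK, h⟩ := exists_norm_iteratedDeriv_ev_le hr (m + 1)
  refine Asymptotics.IsBigO.of_bound (C * 4) ?_
  filter_upwards [tendsto_natCast_atTop_atTop.eventually_ge_atTop (K + 2)] with n hn
  have hfar : ∀ s ∈ Metric.closedBall (c n) 1, (n : ℝ) / 2 ≤ ‖s‖ ∧ K ≤ ‖s‖ := fun s hs => by
    rw [Metric.mem_closedBall, dist_eq_norm, norm_sub_rev] at hs
    have := norm_sub_norm_le (c n) s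
    have := hc n
    constructor <;> linarith
  have hn0 : (0 : ℝ) < n := by linarith
  have hm := (convex_closedBall (c n) 1).norm_image_sub_le_of_norm_deriv_le
    (f := iteratedDeriv m (ev r)) (C := C * (((n : ℝ) / 2) ^ 2)⁻¹) (x := c n) (y := c (n + 1))
    (fun s hs => (analyticAt_iteratedDeriv
      (analyticAt_ev (h s (hfar s hs).2).2) m).differentiableAt)
    (fun s hs => by
      rw [← iteratedDeriv_succ]
      refine (h s (hfar s hs).2).1.trans ?_
      have h2 := (hfar s hs).1
      have h3 : ((n : ℝ) / 2) ^ 2 ≤ ‖s‖ ^ (1 + (m + 1)) := by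
        calc ((n : ℝ) / 2) ^ 2 ≤ ((n : ℝ) / 2) ^ (1 + (m + 1)) :=
              pow_le_pow_right₀ (by linarith) (by omega)
          _ ≤ _ := by gcongr
      gcongr)
    (Metric.mem_closedBall_self zero_le_one)
    (by rw [Metric.mem_closedBall, dist_eq_norm]; exact hc' n)
  rw [taylorCoeff, taylorCoeff, ← sub_div, norm_div, Complex.norm_natCast,
    Real.norm_of_nonneg (by positivity), Real.rpow_neg hn0.le, Real.rpow_two]
  refine (div_le_self (norm_nonneg _) (by exact_mod_cast m.factorial_pos)).trans (hm.trans ?_)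
  refine (mul_le_of_le_one_right (by positivity) (hc' n)).trans_eq ?_
  field_simp
  norm_num

lemma tame_taylorCoeff {r : RatFunc ℂ} {z : ℂ} (hr : Decays r z) (m : ℕ) {c : ℕ → ℂ}
    (hc : ∀ n : ℕ, (n : ℝ) ≤ ‖c n‖) (hc' : ∀ n, ‖c (n + 1) - c n‖ ≤ 1) :
    Tame z fun n => taylorCoeff r m (c n) := by
  have h1 : ev r =O[Bornology.cobounded ℂ] fun s => s ^ (-(1 : ℕ) : ℤ) := by
    rcases hr with h | ⟨-, h⟩
    · refine h.trans (Asymptotics.IsBigO.of_bound 1 ?_)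
      rw [Filter.hasBasis_cobounded_norm.eventually_iff]
      refine ⟨1, trivial, fun s hs => ?_⟩
      have hs' : 1 ≤ ‖s‖ := hs
      rw [one_mul, norm_zpow, norm_zpow]
      exact zpow_le_zpow_right₀ hs' (by norm_num)
    · exact h
  refine ⟨?_, isBigO_taylorCoeff_sub h1 m hc hc', ?_⟩
  · simpa using isBigO_taylorCoeff h1 m hc
  · rcases hr with h | ⟨h, -⟩
    · right
      simpa using isBigO_taylorCoeff (j := 2) h m hc
    · exact Or.inl h

/-! ### The limit of the sums of residues -/

lemma exists_hasResidue_of_analyticAt_mul {g : ℂ → ℂ} {α : ℂ} (hg : AnalyticAt ℂ g α)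
    (r : RatFunc ℂ) : ∃ c, HasResidue (fun s => g s * ev r s) α c := by
  obtain ⟨hR, hloc⟩ := ev_local_form (r := r) (a := α) (q := r.denom.rootMultiplicity α)
    le_rfl rfl
  -- The additional factor s - α covers the case that r has no pole at α.
  refine ⟨_, hasResidue_of_eventuallyEq_inv_pow_mul (r.denom.rootMultiplicity α)
    ((analyticAt_id.sub (analyticAt_const (v := α))).mul (hg.mul hR)) ?_⟩
  filter_upwards [hloc, self_mem_nhdsWithin] with s hs hsα
  have hne : s - α ≠ 0 := sub_ne_zero.mpr hsα
  rw [hs]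
  simp only [Pi.mul_apply, Pi.sub_apply, id]
  field_simp
  ring

lemma sum_Icc_neg_natCast (g : ℤ → ℂ) (M : ℕ) :
    ∑ m ∈ Icc (-(M : ℤ)) M, g m
      = g 0 + (∑ n ∈ Ico 1 (M + 1), g n) + ∑ n ∈ Ico 1 (M + 1), g (-n) := by
  induction M with
  | zero => simp
  | succ M ih =>
    have h : Icc (-((M + 1 : ℕ) : ℤ)) ((M + 1 : ℕ) : ℤ)
        = insert (-((M + 1 : ℕ) : ℤ)) (insert ((M + 1 : ℕ) : ℤ) (Icc (-(M : ℤ)) M)) := by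
      ext m
      simp only [mem_Icc, mem_insert]
      push_cast
      omega
    rw [h, sum_insert, sum_insert, ih, sum_Ico_succ_top (b := M + 1) (by omega) fun n : ℕ => g n,
      sum_Ico_succ_top (b := M + 1) (by omega) fun n : ℕ => g (-n)]
    · ring
    · simp
    · simp only [mem_insert, mem_Icc]
      push_cast
      omega

section

variable {x : ℂ} {y : Fin 2 → ℂ} {p : Fin 2 → ℕ}

/-- The singularities in the disc fall into three disjoint sets: P (poles of r where the kernel is
analytic), the integers, and W M (poles of the shifted φ factors that are not integers, absent for h
= 0). -/
lemma tendsto_sum_residues (hx : ‖x‖ = 1) (hy : ∀ j, ‖y j‖ = 1) (hp : ∀ j, 1 ≤ p j) {h : ℝ}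
    (hh : h = 0 ∨ h = 1 / 2) {r : RatFunc ℂ} (hr : Decays r (x * y 0 * y 1)) (P : Finset ℂ)
    (W : ℕ → Finset ℂ) (hPint : ∀ α ∈ P, ∀ m : ℤ, α ≠ m) (hPdom : ∀ α ∈ P, α + h ∈ lerchDomain)
    (hpoles : ∀ α ∈ poles r, α ∈ P ∨ (∃ m : ℤ, α = m) ∨ ∃ k : ℕ, (k : ℂ) + (α + h) = 0)
    (hWint : ∀ M, ∀ α ∈ W M, ∀ m : ℤ, α ≠ m) (hWdom : ∀ M, ∀ α ∈ W M, ∃ k : ℕ, (k : ℂ) + (α + h) = 0)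
    (hWball : ∀ M, ∀ α ∈ W M, ‖α‖ < M + 1 / 4)
    (hWmem : ∀ (M : ℕ) (s : ℂ), ‖s‖ ≤ M + 1 / 4 → (∀ m : ℤ, s ≠ m) →
      (∃ k : ℕ, (k : ℂ) + (s + h) = 0) → s ∈ W M)
    (hint : ∀ m : ℤ, ∃ c, HasResidue (fun s => kernel h x p y s * ev r s) m c)
    (hW : ∀ M, ∀ α ∈ W M, ∃ c, HasResidue (fun s => kernel h x p y s * ev r s) α c) :
    Tendsto (fun M : ℕ => (∑ α ∈ P, residue (fun s => kernel h x p y s * ev r s) α)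
      + residue (fun s => kernel h x p y s * ev r s) 0
      + (∑ n ∈ Ico 1 (M + 1), residue (fun s => kernel h x p y s * ev r s) n)
      + (∑ n ∈ Ico 1 (M + 1), residue (fun s => kernel h x p y s * ev r s) (-(n : ℂ)))
      + ∑ α ∈ W M, residue (fun s => kernel h x p y s * ev r s) α) atTop (𝓝 0) := by
  classical
  set f : ℂ → ℂ := fun s => kernel h x p y s * ev r s with hf
  have hpi : (2 * (Real.pi : ℂ) * Complex.I) ≠ 0 := Complex.two_pi_I_ne_zero
  have hlim := (tendsto_circleIntegral_kernel hx hy hp hh hr).const_mul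
    (2 * (Real.pi : ℂ) * Complex.I)⁻¹
  rw [mul_zero] at hlim
  refine hlim.congr' ?_
  obtain ⟨K, hK⟩ := (P.finite_toSet.isBounded).exists_norm_le
  -- From here on all of P lies inside the circle.
  filter_upwards [tendsto_natCast_atTop_atTop.eventually_ge_atTop K] with M hM
  set Z : Finset ℂ := (Icc (-(M : ℤ)) M).image (fun m : ℤ => (m : ℂ)) with hZ
  have hres : ∀ α ∈ P ∪ Z ∪ W M, HasResidue f α (residue f α) := by
    have key : ∀ α, (∃ c, HasResidue f α c) → HasResidue f α (residue f α) := by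
      rintro α ⟨c, hc⟩
      rwa [hc.residue_eq]
    intro α hα
    refine key α ?_
    simp only [mem_union] at hα
    rcases hα with (hα | hα) | hα
    · exact exists_hasResidue_of_analyticAt_mul
        (analyticAt_kernel hx hy hp (hPint α hα) (hPdom α hα)) r
    · obtain ⟨m, -, rfl⟩ := mem_image.mp hα
      exact hint m
    · exact hW M α hα
  have hball : ∀ α ∈ P ∪ Z ∪ W M, α ∈ Metric.ball (0 : ℂ) ((M : ℝ) + 1 / 4) := by
    intro α hα
    rw [mem_ball_zero_iff]
    simp only [mem_union] at hα
    rcases hα with (hα | hα) | hα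
    · linarith [hK α hα]
    · obtain ⟨m, hm, rfl⟩ := mem_image.mp hα
      rw [mem_Icc] at hm
      have : |(m : ℝ)| ≤ M := abs_le.mpr ⟨by exact_mod_cast hm.1, by exact_mod_cast hm.2⟩
      rw [Complex.norm_intCast]
      linarith
    · exact hWball M α hα
  have hdiff : ∀ s ∈ Metric.closedBall (0 : ℂ) ((M : ℝ) + 1 / 4), s ∉ P ∪ Z ∪ W M →
      DifferentiableAt ℂ f s := by
    intro s hs hsn
    rw [mem_closedBall_zero_iff] at hs
    simp only [mem_union, not_or] at hsn
    obtain ⟨⟨hsP, hsZ⟩, hsW⟩ := hsn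
    have hsint : ∀ m : ℤ, s ≠ m := by
      rintro m rfl
      refine hsZ (mem_image.mpr ⟨m, ?_, rfl⟩)
      rw [Complex.norm_intCast] at hs
      have h1 : |(m : ℝ)| < M + 1 := by linarith
      have h2 : |m| < (M : ℤ) + 1 := by exact_mod_cast h1
      rw [mem_Icc, ← abs_le]
      omega
    have hsdom : ¬∃ k : ℕ, (k : ℂ) + (s + h) = 0 := fun hk => hsW (hWmem M s hs hsint hk)
    refine (AnalyticAt.differentiableAt ?_).mul (AnalyticAt.differentiableAt ?_)
    · exact analyticAt_kernel hx hy hp hsint fun k hk => hsdom ⟨k, hk⟩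
    · refine analyticAt_ev fun hmem => ?_
      rcases hpoles s hmem with hc | ⟨m, hm⟩ | hc
      · exact hsP hc
      · exact hsint m hm
      · exact hsdom hc
  rw [circleIntegral_eq_sum_residues (by positivity) (residue f) _ hball f hdiff hres,
    inv_mul_cancel_left₀ hpi, sum_union, sum_union, hZ, sum_image, sum_Icc_neg_natCast]
  · push_cast
    ring
  · intro a _ b _ hab
    exact Int.cast_injective hab
  · rw [disjoint_left]
    intro α hα hαZ
    obtain ⟨m, -, rfl⟩ := mem_image.mp hαZ
    exact hPint _ hα m rfl
  · rw [disjoint_left]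
    intro α hα hαW
    rcases mem_union.mp hα with hα | hα
    · obtain ⟨k, hk⟩ := hWdom M α hαW
      exact hPdom α hα k hk
    · obtain ⟨m, -, rfl⟩ := mem_image.mp hα
      exact hWint M _ hαW m rfl

/-- The limit of the sums of residues for the kernel without shift. -/
lemma tendsto_sum_residues_zero (hx : ‖x‖ = 1) (hy : ∀ j, ‖y j‖ = 1) (hp : ∀ j, 1 ≤ p j)
    {r : RatFunc ℂ} (hr : Decays r (x * y 0 * y 1)) (P : Finset ℂ)
    (hPint : ∀ α ∈ P, ∀ m : ℤ, α ≠ m) (hpoles : ∀ α ∈ poles r, α ∈ P ∨ (∃ m : ℤ, α = m))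
    (hint : ∀ m : ℤ, ∃ c, HasResidue (fun s => kernel 0 x p y s * ev r s) m c) :
    Tendsto (fun M : ℕ => (∑ α ∈ P, residue (fun s => kernel 0 x p y s * ev r s) α)
      + residue (fun s => kernel 0 x p y s * ev r s) 0
      + (∑ n ∈ Ico 1 (M + 1), residue (fun s => kernel 0 x p y s * ev r s) n)
      + ∑ n ∈ Ico 1 (M + 1), residue (fun s => kernel 0 x p y s * ev r s) (-(n : ℂ)))
      atTop (𝓝 0) := by
  have key := tendsto_sum_residues hx hy hp (h := 0) (Or.inl rfl) hr P (fun _ => ∅) hPint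
    (fun α hα => by
      rw [Complex.ofReal_zero, add_zero]
      exact mem_lerchDomain_of_forall_int (hPint α hα))
    (fun α hα => (hpoles α hα).imp_right Or.inl) (by simp) (by simp) (by simp)
    (fun M s _ hs ⟨k, hk⟩ => by
      rw [Complex.ofReal_zero, add_zero] at hk
      exact absurd hk (mem_lerchDomain_of_forall_int hs k))
    (by simpa using hint) (by simp)
  simpa using key

/-- The limit of the sums of residues for the kernel shifted by `1/2`. -/
lemma tendsto_sum_residues_half (hx : ‖x‖ = 1) (hy : ∀ j, ‖y j‖ = 1) (hp : ∀ j, 1 ≤ p j)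
    {r : RatFunc ℂ} (hr : Decays r (x * y 0 * y 1)) (P : Finset ℂ)
    (hPint : ∀ α ∈ P, ∀ m : ℤ, α ≠ m) (hPhalf : ∀ α ∈ P, ∀ k : ℕ, α ≠ -(k : ℂ) - 1 / 2)
    (hpoles : ∀ α ∈ poles r, α ∈ P ∨ (∃ m : ℤ, α = m) ∨ ∃ k : ℕ, α = -(k : ℂ) - 1 / 2)
    (hint : ∀ m : ℤ, ∃ c, HasResidue (fun s => kernel (1 / 2) x p y s * ev r s) m c)
    (hhalf : ∀ k : ℕ, ∃ c, HasResidue (fun s => kernel (1 / 2) x p y s * ev r s)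
      (-(k : ℂ) - 1 / 2) c) :
    Tendsto (fun M : ℕ => (∑ α ∈ P, residue (fun s => kernel (1 / 2) x p y s * ev r s) α)
      + residue (fun s => kernel (1 / 2) x p y s * ev r s) 0
      + (∑ n ∈ Ico 1 (M + 1), residue (fun s => kernel (1 / 2) x p y s * ev r s) n)
      + (∑ n ∈ Ico 1 (M + 1), residue (fun s => kernel (1 / 2) x p y s * ev r s) (-(n : ℂ)))
      + ∑ n ∈ Ico 0 M, residue (fun s => kernel (1 / 2) x p y s * ev r s) (-(n : ℂ) - 1 / 2))
      atTop (𝓝 0) := by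
  classical
  have hcast : (((1 / 2 : ℝ)) : ℂ) = 1 / 2 := by norm_num
  have hiff : ∀ (s : ℂ) (k : ℕ), (k : ℂ) + (s + ((1 / 2 : ℝ) : ℂ)) = 0 ↔ s = -(k : ℂ) - 1 / 2 := by
    intro s k
    rw [hcast]
    constructor <;> intro h <;> linear_combination h
  have hnorm : ∀ k : ℕ, ‖-(k : ℂ) - 1 / 2‖ = k + 1 / 2 := fun k => by
    have : -(k : ℂ) - 1 / 2 = ((-(k + 1 / 2) : ℝ) : ℂ) := by push_cast; ring
    rw [this, Complex.norm_real, norm_neg, Real.norm_of_nonneg (by positivity)]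
  have key := tendsto_sum_residues hx hy hp (h := 1 / 2) (Or.inr rfl) hr P
    -- The point -k - 1/2 lies inside |s| = M + 1/4 exactly for k < M, whereas the integers run up
    -- to M; hence the different upper limits of the sums.
    (fun M => (range M).image fun k : ℕ => -(k : ℂ) - 1 / 2) hPint
    (fun α hα k hk => hPhalf α hα k ((hiff α k).mp hk))
    (fun α hα => by simpa only [hiff] using hpoles α hα)
    (fun M α hα m => by
      obtain ⟨k, -, rfl⟩ := mem_image.mp hα
      exact half_add_natCast_ne_int k m)
    (fun M α hα => by
      obtain ⟨k, -, rfl⟩ := mem_image.mp hα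
      exact ⟨k, (hiff _ k).mpr rfl⟩)
    (fun M α hα => by
      obtain ⟨k, hk, rfl⟩ := mem_image.mp hα
      have : (k : ℝ) + 1 ≤ M := by exact_mod_cast mem_range.mp hk
      rw [hnorm]
      linarith)
    (fun M s hs _ ⟨k, hk⟩ => by
      rw [hiff] at hk
      rw [hk, hnorm] at hs
      have : (k : ℝ) < M := by linarith
      exact mem_image.mpr ⟨k, mem_range.mpr (by exact_mod_cast this), hk.symm⟩)
    (by rw [hcast]; exact hint)
    (fun M α hα => by
      obtain ⟨k, -, rfl⟩ := mem_image.mp hα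
      rw [hcast]
      exact hhalf k)
  rw [hcast] at key
  refine key.congr fun M => ?_
  rw [sum_image, range_eq_Ico]
  intro a _ b _ hab
  simpa using hab

end

/-! ### Values of the normalised derivatives of `φ` -/

/-- The tail of the series from the term n on. At a positive integer n it turns the value of a φ
factor into the difference in the formula, and x₁^(-n) x₂^(-n) joins x^(-n) from Φ to give z^(-n).
-/
lemma Li_sub_zetaFin {x : ℂ} (hx : ‖x‖ = 1) {p : ℕ} (hp : 1 ≤ p) {n : ℕ} (hn : 1 ≤ n) :
    Li p x - zetaFin (n - 1) p x = x ^ n * lerch p x n := by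
  obtain ⟨m, rfl⟩ := Nat.exists_eq_add_of_le' hn
  rw [Nat.add_sub_cancel, Li_eq hx hp, zetaFin_eq, lerch_eq_sum_add hx one_mem_lerchDomain hp m]
  push_cast
  rw [add_comm (1 : ℂ) m]
  ring

lemma ti_sub_tFin {x : ℂ} (hx : ‖x‖ = 1) {p : ℕ} (hp : 1 ≤ p) (n : ℕ) :
    ti p x - tFin n p x = x ^ (n + 1) * lerch p x (n + 1 / 2) := by
  rw [ti_eq hx hp, tFin_eq, lerch_eq_sum_add hx half_mem_lerchDomain hp n, add_comm (1 / 2 : ℂ)]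
  ring

lemma intCast_add_half_mem_lerchDomain (m : ℤ) : (m : ℂ) + 1 / 2 ∈ lerchDomain := fun k hk =>
  half_add_natCast_ne_int k m (by linear_combination -hk)

/-- The first n denominators are negative half-integers and, read backwards, form the finite sum at
x⁻¹; the rest is the series at 1/2. -/
lemma lerch_neg_add_half {x : ℂ} (hx : ‖x‖ = 1) {p : ℕ} (hp : 1 ≤ p) (n : ℕ) :
    lerch p x (-(n : ℂ) + 1 / 2) = x ^ n * (ti p x * x⁻¹ + (-1) ^ p * tFin n p x⁻¹) := by
  have hx0 := ne_zero_of_norm_eq_one hx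
  have hdom : -(n : ℂ) + 1 / 2 ∈ lerchDomain := by
    simpa using intCast_add_half_mem_lerchDomain (-n)
  rw [lerch_eq_sum_add hx hdom hp n, show -(n : ℂ) + 1 / 2 + n = 1 / 2 by ring, ti_eq hx hp,
    tFin_eq, mul_add, add_comm, mul_sum, mul_sum, mul_sum,
    ← sum_range_reflect fun k : ℕ => x ^ k / ((k : ℂ) + (-(n : ℂ) + 1 / 2)) ^ p]
  congr 1
  · field_simp
  · refine sum_congr rfl fun k hk => ?_
    obtain ⟨d, rfl⟩ := Nat.exists_eq_add_of_lt (mem_range.mp hk)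
    rw [show k + d + 1 - 1 - k = d by omega, show (d : ℂ) + (-((k + d + 1 : ℕ) : ℂ) + 1 / 2)
      = (-1) * ((k : ℂ) + 1 / 2) by push_cast; ring, mul_pow, inv_pow,
      show x ^ (k + d + 1) = x ^ d * x ^ k * x by ring]
    have h1 : (-1 : ℂ) ^ p * (-1) ^ p = 1 := neg_one_pow_mul_self p
    have h2 : ((-1 : ℂ) ^ p)⁻¹ = (-1) ^ p := inv_eq_of_mul_eq_one_left h1
    rw [div_eq_mul_inv, mul_inv, h2]
    field_simp

lemma sum_perm_fin_two (F : Equiv.Perm (Fin 2) → ℂ) :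
    ∑ σ, F σ = F 1 + F (Equiv.swap 0 1) := by
  have h : (univ : Finset (Equiv.Perm (Fin 2))) = {1, Equiv.swap 0 1} := by decide
  rw [h, sum_insert (by decide), sum_singleton]

lemma norm_eq_one_of_pow {x : ℂ} (hx : ∃ N : ℕ, 0 < N ∧ x ^ N = 1) : ‖x‖ = 1 := by
  obtain ⟨N, hN, h⟩ := hx
  exact Complex.norm_eq_one_of_pow_eq_one h hN.ne'

/-- The series over the positive integers carries z^(-n). -/
lemma Decays.inv {r : RatFunc ℂ} {z : ℂ} (h : Decays r z) : Decays r z⁻¹ :=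
  h.imp_right fun ⟨h1, h2⟩ => ⟨fun hz => h1 (inv_eq_one.mp hz), h2⟩

lemma SeriesFrom.tendsto_succ {n₀ : ℕ} {a : ℕ → ℂ} {S : ℂ} (h : SeriesFrom n₀ a S) :
    Tendsto (fun M => ∑ n ∈ Ico n₀ (M + 1), a n) atTop (𝓝 S) := by
  have h' : Tendsto (fun M => ∑ n ∈ Ico n₀ M, a n) atTop (𝓝 S) := h
  exact h'.comp (tendsto_add_atTop_nat 1)

lemma ev_eq_taylorCoeff_zero (r : RatFunc ℂ) (a : ℂ) : ev r a = taylorCoeff r 0 a := by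
  rw [taylorCoeff_eq_taylor, taylor_zero]

/-! ### Convergence of the series -/

lemma polarCoeff_eq (n p : ℕ) (x : ℂ) (i : ℕ) : polarCoeff n p x i
    = ((i + p - 1).choose (p - 1) : ℂ) * ((-1) ^ i * Li (i + p) x + (-1) ^ p * zetaFin n (i + p) x⁻¹) :=
  rfl

lemma polarCoeff_zero (p : ℕ) (x : ℂ) (i : ℕ) :
    polarCoeff 0 p x i = ((i + p - 1).choose (p - 1) : ℂ) * (-1) ^ i * Li (i + p) x := by
  simp [polarCoeff, zetaFin, mul_assoc]

lemma polarCoeff_index_zero {n p : ℕ} {x : ℂ} :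
    polarCoeff n p x 0 = Li p x + (-1) ^ p * zetaFin n p x⁻¹ := by
  simp [polarCoeff]

lemma slow_polarCoeff {x : ℂ} (hx : ‖x‖ = 1) {p : ℕ} (hp : 1 ≤ p) (i : ℕ) :
    Slow fun n => polarCoeff n p x i :=
  ((slow_const _).add ((slow_zetaFin (norm_inv_eq_one hx) (by omega)).const_mul _)).const_mul _

section

variable {r : RatFunc ℂ} {z : ℂ}

lemma tame_taylorCoeff_natCast (hr : Decays r z) (m : ℕ) : Tame z fun n => taylorCoeff r m n :=
  tame_taylorCoeff hr m (fun n => by simp) fun n => by simp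

lemma tame_taylorCoeff_neg_natCast (hr : Decays r z) (m : ℕ) :
    Tame z fun n => taylorCoeff r m (-n) :=
  tame_taylorCoeff hr m (fun n => by simp) fun n => by simp

lemma tame_taylorCoeff_half (hr : Decays r z) (m : ℕ) :
    Tame z fun n => taylorCoeff r m (-n - 1 / 2) := by
  refine tame_taylorCoeff hr m (fun n => ?_) fun n => ?_
  · have h : -(n : ℂ) - 1 / 2 = ((-(n + 1 / 2) : ℝ) : ℂ) := by push_cast; ring
    rw [h, Complex.norm_real, norm_neg, Real.norm_of_nonneg (by positivity)]
    linarith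
  · have h : -((n + 1 : ℕ) : ℂ) - 1 / 2 - (-(n : ℂ) - 1 / 2) = -1 := by push_cast; ring
    rw [h, norm_neg, norm_one]

variable {c : ℕ → ℂ}

lemma exists_seriesFrom_sum_mul (hz : ‖z‖ = 1) (hc : ∀ m, Tame z fun n => taylorCoeff r m (c n))
    (A : ℕ → ℂ) (N n₀ : ℕ) : ∃ T, SeriesFrom n₀ (fun n => ∑ k ∈ range N,
      z ^ n * (A k * taylorCoeff r (N - 1 - k) (c n))) T :=
  exists_seriesFrom_sum _ fun k _ =>
    exists_seriesFrom_slow_mul_tame hz (slow_const (A k)) (hc (N - 1 - k)) n₀ fun n => by ring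

lemma exists_seriesFrom_sum_polar (hz : ‖z‖ = 1) (hc : ∀ m, Tame z fun n => taylorCoeff r m (c n))
    {w : ℂ} (hw : ‖w‖ = 1) {p : ℕ} (hp : 1 ≤ p) (N n₀ : ℕ) :
    ∃ T, SeriesFrom n₀ (fun n => ∑ k ∈ range (N + 1),
      z ^ n * (polarCoeff n p w k * taylorCoeff r (N - k) (c n))) T :=
  exists_seriesFrom_sum _ fun k _ =>
    exists_seriesFrom_slow_mul_tame hz (slow_polarCoeff hw hp k) (hc (N - k)) n₀ fun n => by ring

lemma exists_seriesFrom_sum_sum_polar (hz : ‖z‖ = 1)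
    (hc : ∀ m, Tame z fun n => taylorCoeff r m (c n)) (A : ℕ → ℂ)
    {w : ℂ} (hw : ‖w‖ = 1) {p : ℕ} (hp : 1 ≤ p) (N n₀ : ℕ) :
    ∃ T, SeriesFrom n₀ (fun n => ∑ k₁ ∈ range N, ∑ k₂ ∈ range (N - k₁),
      z ^ n * (A k₁ * polarCoeff n p w k₂ * taylorCoeff r (N - 1 - k₁ - k₂) (c n))) T :=
  exists_seriesFrom_sum _ fun k₁ _ => exists_seriesFrom_sum _ fun k₂ _ =>
    exists_seriesFrom_slow_mul_tame hz ((slow_polarCoeff hw hp k₂).const_mul (A k₁))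
      (hc (N - 1 - k₁ - k₂)) n₀ fun n => by ring

end

/-! ### The residues of the three kernels -/

section

variable {x : ℂ} {y : Fin 2 → ℂ} {p : Fin 2 → ℕ} {r : RatFunc ℂ}

/-- A regular point counts as a pole of order q = 0, so the general residue lemmas apply. -/
lemma eventually_ev_eq_inv_pow_zero_mul (r : RatFunc ℂ) (a : ℂ) :
    ∀ᶠ s in 𝓝[≠] a, ev r s = ((s - a) ^ 0)⁻¹ * ev r s :=
  Eventually.of_forall fun s => by simp

lemma hasResidue_natCast (hx : ‖x‖ = 1) (hy : ∀ j, ‖y j‖ = 1) (hp : ∀ j, 1 ≤ p j) {n : ℕ}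
    (hn : 1 ≤ n) (hr : (n : ℂ) ∉ poles r) :
    HasResidue (fun s => kernel 0 x p y s * ev r s) n
      (((x * y 0 * y 1) ^ n)⁻¹ * (Li (p 0) (y 0) - zetaFin (n - 1) (p 0) (y 0))
          * (Li (p 1) (y 1) - zetaFin (n - 1) (p 1) (y 1)) * ev r n) := by
  have hdom : ((n : ℤ) : ℂ) + 0 ∈ lerchDomain := by
    refine mem_lerchDomain_of_re_pos ?_
    simpa using by omega
  have h := hasResidue_kernel_int hx hy hp n hdom (F := ev r) (ρ := ev r) (q := 0)
    (analyticAt_ev (by simpa using hr)) (eventually_ev_eq_inv_pow_zero_mul r _)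
    (B := fun j i => ((i + p j - 1).choose (p j - 1) : ℂ) * (-1) ^ i
      * lerch (i + p j) (y j) ((n : ℤ) + 0)) fun _ _ => rfl
  have hy0 := ne_zero_of_norm_eq_one (hy 0)
  have hy1 := ne_zero_of_norm_eq_one (hy 1)
  have hx0 := ne_zero_of_norm_eq_one hx
  simp only [Int.cast_natCast] at h
  convert h using 1
  rw [Li_sub_zetaFin (hy 0) (hp 0) hn, Li_sub_zetaFin (hy 1) (hp 1) hn]
  simp only [zpow_natCast, zero_add, range_one, sum_singleton, Nat.sub_zero, Nat.choose_self,
    pow_zero, taylor_zero, range_zero, sum_empty, add_zero, Nat.cast_one, mul_one, one_mul]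
  field_simp
  ring

lemma hasResidue_half_natCast (hx : ‖x‖ = 1) (hy : ∀ j, ‖y j‖ = 1) (hp : ∀ j, 1 ≤ p j) {n : ℕ}
    (hr : (n : ℂ) ∉ poles r) :
    HasResidue (fun s => kernel (1 / 2) x p y s * ev r s) n
      (((x * y 0 * y 1) ^ n)⁻¹ * (y 0 * y 1)⁻¹ * (ti (p 0) (y 0) - tFin n (p 0) (y 0))
          * (ti (p 1) (y 1) - tFin n (p 1) (y 1)) * ev r n) := by
  have h := hasResidue_kernel_int hx hy hp n (intCast_add_half_mem_lerchDomain n) (F := ev r)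
    (ρ := ev r) (q := 0)
    (analyticAt_ev (by simpa using hr)) (eventually_ev_eq_inv_pow_zero_mul r _)
    (B := fun j i => ((i + p j - 1).choose (p j - 1) : ℂ) * (-1) ^ i
      * lerch (i + p j) (y j) ((n : ℤ) + 1 / 2)) fun _ _ => rfl
  have hy0 := ne_zero_of_norm_eq_one (hy 0)
  have hy1 := ne_zero_of_norm_eq_one (hy 1)
  have hx0 := ne_zero_of_norm_eq_one hx
  simp only [Int.cast_natCast] at h
  convert h using 1
  rw [ti_sub_tFin (hy 0) (hp 0) n, ti_sub_tFin (hy 1) (hp 1) n]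
  simp only [zpow_natCast, zero_add, range_one, sum_singleton, Nat.sub_zero, Nat.choose_self,
    pow_zero, taylor_zero, range_zero, sum_empty, add_zero, Nat.cast_one, mul_one, one_mul]
  field_simp
  ring

lemma hasResidue_half_neg_natCast (hx : ‖x‖ = 1) (hy : ∀ j, ‖y j‖ = 1) (hp : ∀ j, 1 ≤ p j) {n : ℕ}
    (hr : -(n : ℂ) ∉ poles r) :
    HasResidue (fun s => kernel (1 / 2) x p y s * ev r s) (-(n : ℂ))
      ((x * y 0 * y 1) ^ n * (ti (p 0) (y 0) * (y 0)⁻¹ + (-1) ^ p 0 * tFin n (p 0) (y 0)⁻¹)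
          * (ti (p 1) (y 1) * (y 1)⁻¹ + (-1) ^ p 1 * tFin n (p 1) (y 1)⁻¹) * ev r (-n)) := by
  have h := hasResidue_kernel_int hx hy hp (-n) (intCast_add_half_mem_lerchDomain (-n)) (F := ev r)
    (ρ := ev r) (q := 0)
    (analyticAt_ev (by simpa using hr)) (eventually_ev_eq_inv_pow_zero_mul r _)
    (B := fun j i => ((i + p j - 1).choose (p j - 1) : ℂ) * (-1) ^ i
      * lerch (i + p j) (y j) ((-n : ℤ) + 1 / 2)) fun _ _ => rfl
  have hx0 := ne_zero_of_norm_eq_one hx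
  simp only [Int.cast_natCast, Int.cast_neg] at h
  convert h using 1
  simp only [zpow_natCast, zero_add, range_one, sum_singleton, Nat.sub_zero, Nat.choose_self,
    pow_zero, taylor_zero, range_zero, sum_empty, add_zero, Nat.cast_one, mul_one, one_mul,
    zpow_neg, inv_inv]
  rw [lerch_neg_add_half (hy 0) (hp 0) n, lerch_neg_add_half (hy 1) (hp 1) n]
  ring

lemma hasResidue_half_zero (hx : ‖x‖ = 1) (hy : ∀ j, ‖y j‖ = 1) (hp : ∀ j, 1 ≤ p j)
    {R : RatFunc ℂ} {q : ℕ} (hr : PoleOrderLE r 0 q) (hR : R = RatFunc.X ^ q * r) :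
    HasResidue (fun s => kernel (1 / 2) x p y s * ev r s) 0
      ((∑ k₁ ∈ range (q + 1), ∑ k₂ ∈ range (q + 1 - k₁),
          (y 0 * y 1)⁻¹
          * ((k₁ + p 0 - 1).choose (p 0 - 1) : ℂ) * ((k₂ + p 1 - 1).choose (p 1 - 1) : ℂ)
          * ti (k₁ + p 0) (y 0) * ti (k₂ + p 1) (y 1)
          * ((-1) ^ (k₁ + k₂) * taylorCoeff R (q - k₁ - k₂) 0))
        + ∑ k₁ ∈ range q, ∑ k₂ ∈ range (q - k₁), ∑ k₃ ∈ range (q - k₁ - k₂),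
          cLi x k₁
          * ((k₂ + p 0 - 1).choose (p 0 - 1) : ℂ) * ((k₃ + p 1 - 1).choose (p 1 - 1) : ℂ)
          * (-1) ^ (k₂ + k₃) * ti (k₂ + p 0) (y 0) * ti (k₃ + p 1) (y 1)
          * ((y 0 * y 1)⁻¹ * taylorCoeff R (q - 1 - k₁ - k₂ - k₃) 0)) := by
  obtain ⟨hRan, hloc⟩ := ev_local_form (R := R) hr (by simp [hR])
  have h := hasResidue_kernel_int hx hy hp 0 (intCast_add_half_mem_lerchDomain 0) (F := ev r)
    (ρ := ev R) (q := q) (by simpa using hRan) (by simpa using hloc)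
    (B := fun j i => ((i + p j - 1).choose (p j - 1) : ℂ) * (-1) ^ i
      * ((y j)⁻¹ * ti (i + p j) (y j))) fun j i => by
        have hy0 := ne_zero_of_norm_eq_one (hy j)
        have := hp j
        rw [ti_eq (hy j) (by omega), inv_mul_cancel_left₀ hy0, Int.cast_zero, zero_add]
  simp only [Int.cast_zero, zpow_zero, inv_one, one_mul] at h
  convert h using 2
  · refine sum_congr rfl fun k₁ _ => sum_congr rfl fun k₂ _ => ?_
    rw [taylorCoeff_eq_taylor, pow_add, mul_inv]
    ring
  · refine sum_congr rfl fun k₁ _ => sum_congr rfl fun k₂ _ => sum_congr rfl fun k₃ _ => ?_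
    rw [taylorCoeff_eq_taylor, pow_add, mul_inv]
    ring

/-- Kept general in n and q for two uses: n ≥ 1 with q = 0 and R = r, and the pole of r at 0, that
is n = 0, where ζ_0 = 0 leaves only the Li terms. -/
lemma hasResidue_neg_natCast (hx : ‖x‖ = 1) (hy : ∀ j, ‖y j‖ = 1) (hp : ∀ j, 1 ≤ p j) {n : ℕ}
    {R : RatFunc ℂ} {q : ℕ} (hR : AnalyticAt ℂ (ev R) (-(n : ℂ)))
    (hloc : ∀ᶠ s in 𝓝[≠] (-(n : ℂ)), ev r s = ((s - -(n : ℂ)) ^ q)⁻¹ * ev R s) :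
    HasResidue (fun s => kernel 0 x p y s * ev r s) (-(n : ℂ))
      ((x * y 0 * y 1) ^ n * (taylorCoeff R (p 0 + p 1 + q) (-n)
        + (∑ σ : Equiv.Perm (Fin 2), ∑ k ∈ range (p (σ 0) + q + 1),
            polarCoeff n (p (σ 1)) (y (σ 1)) k * taylorCoeff R (p (σ 0) + q - k) (-n))
        + (∑ k₁ ∈ range (q + 1), ∑ k₂ ∈ range (q + 1 - k₁),
            polarCoeff n (p 0) (y 0) k₁ * polarCoeff n (p 1) (y 1) k₂
              * taylorCoeff R (q - k₁ - k₂) (-n))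
        + (∑ k ∈ range (p 0 + p 1 + q), cLi x k * taylorCoeff R (p 0 + p 1 + q - 1 - k) (-n))
        + (∑ σ : Equiv.Perm (Fin 2), ∑ k₁ ∈ range (p (σ 0) + q), ∑ k₂ ∈ range (p (σ 0) + q - k₁),
            cLi x k₁ * polarCoeff n (p (σ 1)) (y (σ 1)) k₂
              * taylorCoeff R (p (σ 0) + q - 1 - k₁ - k₂) (-n))
        + ∑ k₁ ∈ range q, ∑ k₂ ∈ range (q - k₁), ∑ k₃ ∈ range (q - k₁ - k₂),
            cLi x k₁ * polarCoeff n (p 0) (y 0) k₂ * polarCoeff n (p 1) (y 1) k₃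
              * taylorCoeff R (q - 1 - k₁ - k₂ - k₃) (-n))) := by
  convert hasResidue_kernel_neg_nat hx hy hp n hR hloc using 2
  rw [coeff_polar_mul_polar]
  simp only [sum_perm_fin_two, Equiv.Perm.one_apply, Equiv.swap_apply_left,
    Equiv.swap_apply_right, taylorCoeff_eq_taylor]
  ring

lemma hasResidue_half_neg_half (hx : ‖x‖ = 1) (hy : ∀ j, ‖y j‖ = 1) (hp : ∀ j, 1 ≤ p j) {n : ℕ}
    {R : RatFunc ℂ} {q : ℕ} (hR : AnalyticAt ℂ (ev R) (-(n : ℂ) - 1 / 2))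
    (hloc : ∀ᶠ s in 𝓝[≠] (-(n : ℂ) - 1 / 2),
      ev r s = ((s - (-(n : ℂ) - 1 / 2)) ^ q)⁻¹ * ev R s) :
    HasResidue (fun s => kernel (1 / 2) x p y s * ev r s) (-(n : ℂ) - 1 / 2)
      ((x * y 0 * y 1) ^ n * (
        (∑ k ∈ range (p 0 + p 1 + q), cTi x k * taylorCoeff R (p 0 + p 1 + q - 1 - k) (-n - 1 / 2))
        + (∑ σ : Equiv.Perm (Fin 2), ∑ k₁ ∈ range (p (σ 0) + q), ∑ k₂ ∈ range (p (σ 0) + q - k₁),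
            cTi x k₁ * polarCoeff n (p (σ 1)) (y (σ 1)) k₂
              * taylorCoeff R (p (σ 0) + q - 1 - k₁ - k₂) (-n - 1 / 2))
        + ∑ k₁ ∈ range q, ∑ k₂ ∈ range (q - k₁), ∑ k₃ ∈ range (q - k₁ - k₂),
            cTi x k₁ * polarCoeff n (p 0) (y 0) k₂ * polarCoeff n (p 1) (y 1) k₃
              * taylorCoeff R (q - 1 - k₁ - k₂ - k₃) (-n - 1 / 2))) := by
  convert hasResidue_kernel_half hx hy hp n hR hloc using 2
  rw [coeff_X_mul_polar_mul_polar]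
  simp only [sum_perm_fin_two, Equiv.Perm.one_apply, Equiv.swap_apply_left,
    Equiv.swap_apply_right, taylorCoeff_eq_taylor]
  ring

lemma hasResidue_zero (hx : ‖x‖ = 1) (hy : ∀ j, ‖y j‖ = 1) (hp : ∀ j, 1 ≤ p j)
    {R : RatFunc ℂ} {q : ℕ} (hr : PoleOrderLE r 0 q) (hR : R = RatFunc.X ^ q * r) :
    HasResidue (fun s => kernel 0 x p y s * ev r s) 0
      (taylorCoeff R (p 0 + p 1 + q) 0
        + (∑ σ : Equiv.Perm (Fin 2), ∑ k ∈ range (p (σ 0) + q + 1),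
            ((k + p (σ 1) - 1).choose (p (σ 1) - 1) : ℂ) * (-1) ^ k
            * Li (k + p (σ 1)) (y (σ 1)) * taylorCoeff R (p (σ 0) + q - k) 0)
        + (∑ k₁ ∈ range (q + 1), ∑ k₂ ∈ range (q + 1 - k₁),
            ((k₁ + p 0 - 1).choose (p 0 - 1) : ℂ) * ((k₂ + p 1 - 1).choose (p 1 - 1) : ℂ)
            * (-1) ^ (k₁ + k₂) * Li (k₁ + p 0) (y 0) * Li (k₂ + p 1) (y 1)
            * taylorCoeff R (q - k₁ - k₂) 0)
        + (∑ k ∈ range (p 0 + p 1 + q), cLi x k * taylorCoeff R (p 0 + p 1 + q - 1 - k) 0)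
        + (∑ σ : Equiv.Perm (Fin 2), ∑ k₁ ∈ range (p (σ 0) + q), ∑ k₂ ∈ range (p (σ 0) + q - k₁),
            cLi x k₁ * ((k₂ + p (σ 1) - 1).choose (p (σ 1) - 1) : ℂ) * (-1) ^ k₂
            * Li (k₂ + p (σ 1)) (y (σ 1)) * taylorCoeff R (p (σ 0) + q - 1 - k₁ - k₂) 0)
        + ∑ k₁ ∈ range q, ∑ k₂ ∈ range (q - k₁), ∑ k₃ ∈ range (q - k₁ - k₂),
            cLi x k₁
            * ((k₂ + p 0 - 1).choose (p 0 - 1) : ℂ) * ((k₃ + p 1 - 1).choose (p 1 - 1) : ℂ)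
            * (-1) ^ (k₂ + k₃) * Li (k₂ + p 0) (y 0) * Li (k₃ + p 1) (y 1)
            * taylorCoeff R (q - 1 - k₁ - k₂ - k₃) 0) := by
  obtain ⟨hRan, hloc⟩ := ev_local_form (R := R) hr (by simp [hR])
  have h := hasResidue_neg_natCast (n := 0) (r := r) (R := R) (q := q) hx hy hp
    (by simpa using hRan) (by simpa using hloc)
  simp only [Nat.cast_zero, neg_zero, pow_zero, one_mul, polarCoeff_zero] at h
  convert h using 2
  · congr 1
    · congr 2
      refine sum_congr rfl fun k₁ _ => sum_congr rfl fun k₂ _ => ?_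
      rw [pow_add]
      ring
    · refine sum_congr rfl fun σ _ => sum_congr rfl fun k₁ _ => sum_congr rfl fun k₂ _ => ?_
      ring
  · refine sum_congr rfl fun k₁ _ => sum_congr rfl fun k₂ _ => sum_congr rfl fun k₃ _ => ?_
    rw [pow_add]
    ring

lemma hasResidue_half_neg_one_half (hx : ‖x‖ = 1) (hy : ∀ j, ‖y j‖ = 1) (hp : ∀ j, 1 ≤ p j)
    {R : RatFunc ℂ} {q : ℕ} (hr : PoleOrderLE r (-1 / 2) q)
    (hR : R = (RatFunc.X + RatFunc.C (1 / 2)) ^ q * r) :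
    HasResidue (fun s => kernel (1 / 2) x p y s * ev r s) (-((0 : ℕ) : ℂ) - 1 / 2)
      ((∑ k ∈ range (p 0 + p 1 + q), cTi x k * taylorCoeff R (p 0 + p 1 + q - 1 - k) (-1 / 2))
        + (∑ σ : Equiv.Perm (Fin 2), ∑ k₁ ∈ range (p (σ 0) + q), ∑ k₂ ∈ range (p (σ 0) + q - k₁),
            cTi x k₁ * ((k₂ + p (σ 1) - 1).choose (p (σ 1) - 1) : ℂ) * (-1) ^ k₂
            * Li (k₂ + p (σ 1)) (y (σ 1))
            * taylorCoeff R (p (σ 0) + q - 1 - k₁ - k₂) (-1 / 2))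
        + ∑ k₁ ∈ range q, ∑ k₂ ∈ range (q - k₁), ∑ k₃ ∈ range (q - k₁ - k₂),
            cTi x k₁
            * ((k₂ + p 0 - 1).choose (p 0 - 1) : ℂ) * ((k₃ + p 1 - 1).choose (p 1 - 1) : ℂ)
            * (-1) ^ (k₂ + k₃) * Li (k₂ + p 0) (y 0) * Li (k₃ + p 1) (y 1)
            * taylorCoeff R (q - 1 - k₁ - k₂ - k₃) (-1 / 2)) := by
  have h12 : -((0 : ℕ) : ℂ) - 1 / 2 = -1 / 2 := by norm_num
  obtain ⟨hRan, hloc⟩ := ev_local_form (R := R) hr (by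
    rw [hR, map_pow, map_sub, RatFunc.algebraMap_X, RatFunc.algebraMap_C, neg_div, map_neg,
      sub_neg_eq_add])
  have h := hasResidue_half_neg_half (n := 0) (r := r) (R := R) (q := q) hx hy hp
    (by rwa [h12]) (by rwa [h12])
  rw [h12] at h ⊢
  simp only [pow_zero, one_mul, polarCoeff_zero] at h
  convert h using 2
  · congr 1
    refine sum_congr rfl fun σ _ => sum_congr rfl fun k₁ _ => sum_congr rfl fun k₂ _ => ?_
    ring
  · refine sum_congr rfl fun k₁ _ => sum_congr rfl fun k₂ _ => sum_congr rfl fun k₃ _ => ?_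
    rw [pow_add]
    ring

end

/-! ### The three formulas -/

lemma SeriesFrom.congr {n₀ : ℕ} {a b : ℕ → ℂ} {S : ℂ} (h : SeriesFrom n₀ a S)
    (hab : ∀ n, n₀ ≤ n → a n = b n) : SeriesFrom n₀ b S := by
  refine Tendsto.congr (fun N => sum_congr rfl fun n hn => hab n (mem_Ico.mp hn).1) h

lemma SeriesFrom.add {n₀ : ℕ} {a b : ℕ → ℂ} {S T : ℂ} (ha : SeriesFrom n₀ a S)
    (hb : SeriesFrom n₀ b T) : SeriesFrom n₀ (fun n => a n + b n) (S + T) := by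
  refine (Tendsto.add ha hb).congr fun N => ?_
  rw [sum_add_distrib]

lemma SeriesFrom.finset_sum {ι : Type*} (I : Finset ι) {n₀ : ℕ} {a : ι → ℕ → ℂ} {S : ι → ℂ}
    (h : ∀ i, SeriesFrom n₀ (a i) (S i)) :
    SeriesFrom n₀ (fun n => ∑ i ∈ I, a i n) (∑ i ∈ I, S i) := by
  refine (tendsto_finsetSum I fun i _ => h i).congr fun N => ?_
  rw [sum_comm]

/-- Splitting off the first term of a series. -/
lemma SeriesFrom.one_of_zero {a : ℕ → ℂ} {S : ℂ} (h : SeriesFrom 0 a S) :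
    SeriesFrom 1 a (S - a 0) := by
  have h' : Tendsto (fun N => ∑ n ∈ Ico 0 N, a n) atTop (𝓝 S) := h
  refine (h'.sub_const (a 0)).congr' ?_
  filter_upwards [eventually_ge_atTop 1] with N hN
  rw [sum_eq_sum_Ico_succ_bot (by omega), add_sub_cancel_left]

lemma SeriesFrom.zero_of_one {a : ℕ → ℂ} {S : ℂ} (h : SeriesFrom 1 a S) :
    SeriesFrom 0 a (a 0 + S) := by
  have h' : Tendsto (fun N => ∑ n ∈ Ico 1 N, a n) atTop (𝓝 S) := h
  refine (h'.const_add (a 0)).congr' ?_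
  filter_upwards [eventually_ge_atTop 1] with N hN
  rw [sum_eq_sum_Ico_succ_bot (a := 0) (by omega)]

section

variable {x : ℂ} {y : Fin 2 → ℂ} {p : Fin 2 → ℕ}

/-- The formula for the kernel without shift. -/
theorem formula_zero (hx : ‖x‖ = 1) (hy : ∀ j, ‖y j‖ = 1) (hp : ∀ j, 1 ≤ p j)
    {r R : RatFunc ℂ} {q : ℕ} (hr : Decays r (x * y 0 * y 1))
    (hq : PoleOrderLE r 0 q) (hint : ∀ n : ℤ, n ≠ 0 → (n : ℂ) ∉ poles r)
    (hR : R = RatFunc.X ^ q * r) :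
    ∃ (T₁ T₂ : ℂ) (T₃ : Equiv.Perm (Fin 2) → ℂ) (T₄ : ℂ) (T₅ : Equiv.Perm (Fin 2) → ℂ) (T₆ : ℂ),
        SeriesFrom 1 (fun n => ((x * y 0 * y 1) ^ n)⁻¹
          * (Li (p 0) (y 0) - zetaFin (n - 1) (p 0) (y 0))
          * (Li (p 1) (y 1) - zetaFin (n - 1) (p 1) (y 1)) * ev r n) T₁ ∧
        SeriesFrom 1 (fun n => (x * y 0 * y 1) ^ n * taylorCoeff r (p 0 + p 1) (-n)) T₂ ∧
        (∀ σ : Equiv.Perm (Fin 2), SeriesFrom 1 (fun n =>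
          ∑ k ∈ range (p (σ 0) + 1),
            ((k + p (σ 1) - 1).choose (p (σ 1) - 1) : ℂ) * (x * y 0 * y 1) ^ n
            * ((-1) ^ k * Li (k + p (σ 1)) (y (σ 1))
                + (-1) ^ p (σ 1) * zetaFin n (k + p (σ 1)) (y (σ 1))⁻¹)
            * taylorCoeff r (p (σ 0) - k) (-n)) (T₃ σ)) ∧
        SeriesFrom 1 (fun n => (x * y 0 * y 1) ^ n
          * (Li (p 0) (y 0) + (-1) ^ p 0 * zetaFin n (p 0) (y 0)⁻¹)
          * (Li (p 1) (y 1) + (-1) ^ p 1 * zetaFin n (p 1) (y 1)⁻¹) * ev r (-n)) T₄ ∧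
        (∀ σ : Equiv.Perm (Fin 2), SeriesFrom 1 (fun n =>
          ∑ k₁ ∈ range (p (σ 0)), ∑ k₂ ∈ range (p (σ 0) - k₁),
            cLi x k₁ * ((k₂ + p (σ 1) - 1).choose (p (σ 1) - 1) : ℂ)
            * ((-1) ^ k₂ * Li (k₂ + p (σ 1)) (y (σ 1))
                + (-1) ^ p (σ 1) * zetaFin n (k₂ + p (σ 1)) (y (σ 1))⁻¹)
            * ((x * y 0 * y 1) ^ n * taylorCoeff r (p (σ 0) - 1 - k₁ - k₂) (-n))) (T₅ σ)) ∧
        SeriesFrom 1 (fun n => ∑ k ∈ range (p 0 + p 1),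
          cLi x k * ((x * y 0 * y 1) ^ n * taylorCoeff r (p 0 + p 1 - 1 - k) (-n))) T₆ ∧
        -(∑ α ∈ (poles r).erase 0, residue (fun s => kernel 0 x p y s * ev r s) α)
          = T₁ + T₂ + (∑ σ, T₃ σ) + T₄ + (∑ σ, T₅ σ) + T₆
            + taylorCoeff R (p 0 + p 1 + q) 0
            + (∑ σ : Equiv.Perm (Fin 2), ∑ k ∈ range (p (σ 0) + q + 1),
                ((k + p (σ 1) - 1).choose (p (σ 1) - 1) : ℂ) * (-1) ^ k
                * Li (k + p (σ 1)) (y (σ 1)) * taylorCoeff R (p (σ 0) + q - k) 0)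
            + (∑ k₁ ∈ range (q + 1), ∑ k₂ ∈ range (q + 1 - k₁),
                ((k₁ + p 0 - 1).choose (p 0 - 1) : ℂ) * ((k₂ + p 1 - 1).choose (p 1 - 1) : ℂ)
                * (-1) ^ (k₁ + k₂) * Li (k₁ + p 0) (y 0) * Li (k₂ + p 1) (y 1)
                * taylorCoeff R (q - k₁ - k₂) 0)
            + (∑ k ∈ range (p 0 + p 1 + q), cLi x k * taylorCoeff R (p 0 + p 1 + q - 1 - k) 0)
            + (∑ σ : Equiv.Perm (Fin 2), ∑ k₁ ∈ range (p (σ 0) + q),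
                ∑ k₂ ∈ range (p (σ 0) + q - k₁),
                cLi x k₁ * ((k₂ + p (σ 1) - 1).choose (p (σ 1) - 1) : ℂ) * (-1) ^ k₂
                * Li (k₂ + p (σ 1)) (y (σ 1)) * taylorCoeff R (p (σ 0) + q - 1 - k₁ - k₂) 0)
            + (∑ k₁ ∈ range q, ∑ k₂ ∈ range (q - k₁), ∑ k₃ ∈ range (q - k₁ - k₂),
                cLi x k₁
                * ((k₂ + p 0 - 1).choose (p 0 - 1) : ℂ) * ((k₃ + p 1 - 1).choose (p 1 - 1) : ℂ)
                * (-1) ^ (k₂ + k₃) * Li (k₂ + p 0) (y 0) * Li (k₃ + p 1) (y 1)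
                * taylorCoeff R (q - 1 - k₁ - k₂ - k₃) 0) := by
  have hz : ‖x * y 0 * y 1‖ = 1 := by simp [hx, hy]
  obtain ⟨T₁, h₁⟩ := exists_seriesFrom_slow_mul_tame (norm_inv_eq_one hz)
    (((slow_const (Li (p 0) (y 0))).add ((slow_zetaFin_pred (hy 0) (hp 0)).const_mul (-1))).mul
      ((slow_const (Li (p 1) (y 1))).add ((slow_zetaFin_pred (hy 1) (hp 1)).const_mul (-1))))
    (tame_taylorCoeff_natCast hr.inv 0) 1
    (a := fun n => ((x * y 0 * y 1) ^ n)⁻¹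
      * (Li (p 0) (y 0) - zetaFin (n - 1) (p 0) (y 0))
      * (Li (p 1) (y 1) - zetaFin (n - 1) (p 1) (y 1)) * ev r n) fun n => by
    rw [ev_eq_taylorCoeff_zero, inv_pow]
    ring
  obtain ⟨T₂, h₂⟩ := exists_seriesFrom_slow_mul_tame hz (slow_const 1)
    (tame_taylorCoeff_neg_natCast hr (p 0 + p 1)) 1
    (a := fun n => (x * y 0 * y 1) ^ n * taylorCoeff r (p 0 + p 1) (-n)) fun n => by ring
  choose T₃ h₃ using fun σ : Equiv.Perm (Fin 2) =>
    exists_seriesFrom_sum_polar hz (tame_taylorCoeff_neg_natCast hr) (hy (σ 1)) (hp (σ 1))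
      (p (σ 0)) 1
  obtain ⟨T₄, h₄⟩ := exists_seriesFrom_slow_mul_tame hz
    ((slow_polarCoeff (hy 0) (hp 0) 0).mul (slow_polarCoeff (hy 1) (hp 1) 0))
    (tame_taylorCoeff_neg_natCast hr 0) 1
    (a := fun n => (x * y 0 * y 1) ^ n
      * (Li (p 0) (y 0) + (-1) ^ p 0 * zetaFin n (p 0) (y 0)⁻¹)
      * (Li (p 1) (y 1) + (-1) ^ p 1 * zetaFin n (p 1) (y 1)⁻¹) * ev r (-n)) fun n => by
    rw [ev_eq_taylorCoeff_zero, polarCoeff_index_zero, polarCoeff_index_zero]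
    ring
  choose T₅ h₅ using fun σ : Equiv.Perm (Fin 2) =>
    exists_seriesFrom_sum_sum_polar hz (tame_taylorCoeff_neg_natCast hr) (cLi x) (hy (σ 1))
      (hp (σ 1)) (p (σ 0)) 1
  obtain ⟨T₆, h₆⟩ := exists_seriesFrom_sum_mul hz (tame_taylorCoeff_neg_natCast hr) (cLi x)
    (p 0 + p 1) 1
  refine ⟨T₁, T₂, T₃, T₄, T₅, T₆, h₁, h₂, fun σ => (h₃ σ).congr fun n _ => ?_, h₄,
    fun σ => (h₅ σ).congr fun n _ => ?_, h₆.congr fun n _ => ?_, ?_⟩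
  · exact sum_congr rfl fun k _ => by rw [polarCoeff_eq]; ring
  · exact sum_congr rfl fun k₁ _ => sum_congr rfl fun k₂ _ => by rw [polarCoeff_eq]; ring
  · exact sum_congr rfl fun k _ => by ring
  have hpos : ∀ n : ℕ, 1 ≤ n → (n : ℂ) ∉ poles r := fun n hn => by
    simpa using hint n (by omega)
  have hneg : ∀ n : ℕ, 1 ≤ n → -(n : ℂ) ∉ poles r := fun n hn => by
    simpa using hint (-n) (by omega)
  have hresneg := fun (n : ℕ) (hn : 1 ≤ n) => hasResidue_neg_natCast (r := r) hx hy hp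
    (q := 0) (analyticAt_ev (hneg n hn)) (eventually_ev_eq_inv_pow_zero_mul r _)
  have hreszero := hasResidue_zero hx hy hp hq hR
  have hlim := tendsto_sum_residues_zero hx hy hp hr ((poles r).erase 0)
    (fun α hα m hm => by
      obtain ⟨h0, hα⟩ := mem_erase.mp hα
      rw [hm] at h0 hα
      exact hint m (by simpa using h0) hα)
    (fun α hα => by
      by_cases h0 : α = 0
      · exact Or.inr ⟨0, by simpa using h0⟩
      · exact Or.inl (mem_erase.mpr ⟨h0, hα⟩))
    (fun m => by
      rcases lt_trichotomy m 0 with hm | rfl | hm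
      · obtain ⟨n, rfl⟩ := Int.exists_eq_neg_ofNat hm.le
        exact ⟨_, by simpa using hresneg n (by omega)⟩
      · exact ⟨_, by simpa using hreszero⟩
      · lift m to ℕ using hm.le
        exact ⟨_, by simpa using hasResidue_natCast hx hy hp (by omega) (hpos m (by omega))⟩)
  have hs₁ := (h₁.congr fun n hn =>
    (hasResidue_natCast (r := r) hx hy hp hn (hpos n hn)).residue_eq.symm).tendsto_succ
  -- For q = 0 the triple sum is empty and the double sum over both φ factors is a single term, so
  -- the residue at -n splits into exactly the terms of T₂, …, T₆.
  have hs₂ : SeriesFrom 1 (fun n : ℕ => residue (fun s => kernel 0 x p y s * ev r s) (-(n : ℂ)))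
      (T₂ + ∑ σ, T₃ σ + T₄ + ∑ σ, T₅ σ + T₆) :=
    ((((h₂.add (SeriesFrom.finset_sum univ h₃)).add h₄).add
      (SeriesFrom.finset_sum univ h₅)).add h₆).congr fun n hn => by
        rw [(hresneg n hn).residue_eq]
        simp only [add_zero, zero_add, range_one, sum_singleton, range_zero, sum_empty,
          Nat.sub_zero, polarCoeff_index_zero, ← ev_eq_taylorCoeff_zero, mul_sum, mul_add]
        ring
  -- The sum of all residues has the limit 0 and also the limit computed from the individual series.
  have key := tendsto_nhds_unique hlim (((tendsto_const_nhds.add tendsto_const_nhds).add hs₁).add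
    hs₂.tendsto_succ)
  rw [hreszero.residue_eq] at key
  linear_combination key


/-- The formula for the kernel shifted by `1/2` and a pole at `-1/2`. -/
theorem formula_half_pole_half (hx : ‖x‖ = 1) (hy : ∀ j, ‖y j‖ = 1) (hp : ∀ j, 1 ≤ p j)
    {r R : RatFunc ℂ} {q : ℕ} (hr : Decays r (x * y 0 * y 1))
    (hq : PoleOrderLE r (-1 / 2) q) (hint : ∀ n : ℤ, (n : ℂ) ∉ poles r)
    (hhalf : ∀ n : ℕ, 1 ≤ n → (-n - 1 / 2 : ℂ) ∉ poles r)
    (hR : R = (RatFunc.X + RatFunc.C (1 / 2)) ^ q * r) :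
    ∃ (T₁ T₂ T₃ : ℂ) (T₄ : Equiv.Perm (Fin 2) → ℂ),
        SeriesFrom 1 (fun n => ((x * y 0 * y 1) ^ n)⁻¹ * (y 0 * y 1)⁻¹
          * (ti (p 0) (y 0) - tFin n (p 0) (y 0))
          * (ti (p 1) (y 1) - tFin n (p 1) (y 1)) * ev r n) T₁ ∧
        SeriesFrom 0 (fun n => (x * y 0 * y 1) ^ n
          * (ti (p 0) (y 0) * (y 0)⁻¹ + (-1) ^ p 0 * tFin n (p 0) (y 0)⁻¹)
          * (ti (p 1) (y 1) * (y 1)⁻¹ + (-1) ^ p 1 * tFin n (p 1) (y 1)⁻¹) * ev r (-n)) T₂ ∧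
        SeriesFrom 1 (fun n => ∑ k ∈ range (p 0 + p 1),
          cTi x k * ((x * y 0 * y 1) ^ n * taylorCoeff r (p 0 + p 1 - 1 - k) (-n - 1 / 2))) T₃ ∧
        (∀ σ : Equiv.Perm (Fin 2), SeriesFrom 1 (fun n =>
          ∑ k₁ ∈ range (p (σ 0)), ∑ k₂ ∈ range (p (σ 0) - k₁),
            cTi x k₁ * ((k₂ + p (σ 1) - 1).choose (p (σ 1) - 1) : ℂ) * (x * y 0 * y 1) ^ n
            * ((-1) ^ k₂ * Li (k₂ + p (σ 1)) (y (σ 1))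
                + (-1) ^ p (σ 1) * zetaFin n (k₂ + p (σ 1)) (y (σ 1))⁻¹)
            * taylorCoeff r (p (σ 0) - 1 - k₁ - k₂) (-n - 1 / 2)) (T₄ σ)) ∧
        -(∑ α ∈ (poles r).erase (-1 / 2), residue (fun s => kernel (1 / 2) x p y s * ev r s) α)
          = T₁ + T₂ + T₃ + (∑ σ, T₄ σ)
            + (∑ k ∈ range (p 0 + p 1 + q),
                cTi x k * taylorCoeff R (p 0 + p 1 + q - 1 - k) (-1 / 2))
            + (∑ σ : Equiv.Perm (Fin 2), ∑ k₁ ∈ range (p (σ 0) + q),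
                ∑ k₂ ∈ range (p (σ 0) + q - k₁),
                cTi x k₁ * ((k₂ + p (σ 1) - 1).choose (p (σ 1) - 1) : ℂ) * (-1) ^ k₂
                * Li (k₂ + p (σ 1)) (y (σ 1))
                * taylorCoeff R (p (σ 0) + q - 1 - k₁ - k₂) (-1 / 2))
            + (∑ k₁ ∈ range q, ∑ k₂ ∈ range (q - k₁), ∑ k₃ ∈ range (q - k₁ - k₂),
                cTi x k₁
                * ((k₂ + p 0 - 1).choose (p 0 - 1) : ℂ) * ((k₃ + p 1 - 1).choose (p 1 - 1) : ℂ)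
                * (-1) ^ (k₂ + k₃) * Li (k₂ + p 0) (y 0) * Li (k₃ + p 1) (y 1)
                * taylorCoeff R (q - 1 - k₁ - k₂ - k₃) (-1 / 2)) := by
  have hz : ‖x * y 0 * y 1‖ = 1 := by simp [hx, hy]
  obtain ⟨T₁, h₁⟩ := exists_seriesFrom_slow_mul_tame (norm_inv_eq_one hz)
    ((((slow_const (ti (p 0) (y 0))).add ((slow_tFin (hy 0) (hp 0)).const_mul (-1))).mul
      ((slow_const (ti (p 1) (y 1))).add ((slow_tFin (hy 1) (hp 1)).const_mul (-1)))).const_mul (y 0 * y 1)⁻¹)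
    (tame_taylorCoeff_natCast hr.inv 0) 1
    (a := fun n => ((x * y 0 * y 1) ^ n)⁻¹ * (y 0 * y 1)⁻¹
      * (ti (p 0) (y 0) - tFin n (p 0) (y 0))
      * (ti (p 1) (y 1) - tFin n (p 1) (y 1)) * ev r n) fun n => by
    rw [ev_eq_taylorCoeff_zero, inv_pow]
    ring
  obtain ⟨T₂, h₂⟩ := exists_seriesFrom_slow_mul_tame hz
    (((slow_const (ti (p 0) (y 0) * (y 0)⁻¹)).add
        ((slow_tFin (norm_inv_eq_one (hy 0)) (hp 0)).const_mul ((-1) ^ p 0))).mul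
      ((slow_const (ti (p 1) (y 1) * (y 1)⁻¹)).add
        ((slow_tFin (norm_inv_eq_one (hy 1)) (hp 1)).const_mul ((-1) ^ p 1))))
    (tame_taylorCoeff_neg_natCast hr 0) 0
    (a := fun n => (x * y 0 * y 1) ^ n
      * (ti (p 0) (y 0) * (y 0)⁻¹ + (-1) ^ p 0 * tFin n (p 0) (y 0)⁻¹)
      * (ti (p 1) (y 1) * (y 1)⁻¹ + (-1) ^ p 1 * tFin n (p 1) (y 1)⁻¹) * ev r (-n)) fun n => by
    rw [ev_eq_taylorCoeff_zero]
    ring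
  obtain ⟨T₃, h₃⟩ := exists_seriesFrom_sum_mul hz (tame_taylorCoeff_half hr) (cTi x) (p 0 + p 1) 1
  choose T₄ h₄ using fun σ : Equiv.Perm (Fin 2) =>
    exists_seriesFrom_sum_sum_polar hz (tame_taylorCoeff_half hr) (cTi x) (hy (σ 1)) (hp (σ 1))
      (p (σ 0)) 1
  refine ⟨T₁, T₂, T₃, T₄, h₁, h₂, h₃.congr fun n _ => ?_,
    fun σ => (h₄ σ).congr fun n _ => ?_, ?_⟩
  · exact sum_congr rfl fun k _ => by ring
  · exact sum_congr rfl fun k₁ _ => sum_congr rfl fun k₂ _ => by rw [polarCoeff_eq]; ring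
  have hpos : ∀ n : ℕ, (n : ℂ) ∉ poles r := fun n => by simpa using hint n
  have hneg : ∀ n : ℕ, -(n : ℂ) ∉ poles r := fun n => by simpa using hint (-n)
  have hrespos := fun n : ℕ => hasResidue_half_natCast (r := r) hx hy hp (hpos n)
  have hresneg := fun n : ℕ => hasResidue_half_neg_natCast (r := r) hx hy hp (hneg n)
  have hreshalf := fun (n : ℕ) (hn : 1 ≤ n) => hasResidue_half_neg_half (r := r) hx hy hp
    (q := 0) (analyticAt_ev (hhalf n hn)) (eventually_ev_eq_inv_pow_zero_mul r _)
  have h12 : -((0 : ℕ) : ℂ) - 1 / 2 = -1 / 2 := by norm_num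
  have hreszero := hasResidue_half_neg_one_half hx hy hp hq hR
  have hlim := tendsto_sum_residues_half hx hy hp hr ((poles r).erase (-1 / 2))
    (fun α hα m hm => hint m (hm ▸ mem_of_mem_erase hα))
    (fun α hα k hk => by
      obtain ⟨h0, hα⟩ := mem_erase.mp hα
      rcases Nat.eq_zero_or_pos k with rfl | hk'
      · exact h0 (hk.trans h12)
      · exact hhalf k hk' (hk ▸ hα))
    (fun α hα => by
      by_cases h0 : α = -1 / 2
      · exact Or.inr (Or.inr ⟨0, h0.trans h12.symm⟩)
      · exact Or.inl (mem_erase.mpr ⟨h0, hα⟩))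
    (fun m => by
      obtain ⟨n, rfl | rfl⟩ := Int.eq_nat_or_neg m
      · exact ⟨_, by simpa using hrespos n⟩
      · exact ⟨_, by simpa using hresneg n⟩)
    (fun k => by
      rcases Nat.eq_zero_or_pos k with rfl | hk
      · exact ⟨_, hreszero⟩
      · exact ⟨_, hreshalf k hk⟩)
  have hs₁ := (h₁.congr fun n _ => (hrespos n).residue_eq.symm).tendsto_succ
  -- The series T₂ begins at n = 0, but the residue at 0 appears separately in
  -- `tendsto_sum_residues_half`; its term is split off here.
  have hs₂ := (h₂.congr fun n _ => (hresneg n).residue_eq.symm).one_of_zero.tendsto_succ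
  have hs₃ : SeriesFrom 1 (fun n : ℕ => residue (fun s => kernel (1 / 2) x p y s * ev r s) (-(n : ℂ) - 1 / 2))
      (T₃ + ∑ σ, T₄ σ) :=
    (h₃.add (SeriesFrom.finset_sum univ h₄)).congr fun n hn => by
        rw [(hreshalf n hn).residue_eq]
        simp only [add_zero, range_zero, sum_empty, mul_sum, mul_add]
  -- Conversely, the residue at -1/2, where r may have a pole, is put back in front of the series
  -- over -n - 1/2 with n ≥ 1.
  have key := tendsto_nhds_unique hlim
    ((((tendsto_const_nhds.add tendsto_const_nhds).add hs₁).add hs₂).add hs₃.zero_of_one)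
  rw [hreszero.residue_eq] at key
  simp only [Nat.cast_zero, neg_zero] at key
  linear_combination key


/-- The formula for the kernel shifted by `1/2` and a pole at `0`. -/
theorem formula_half_pole_zero (hx : ‖x‖ = 1) (hy : ∀ j, ‖y j‖ = 1) (hp : ∀ j, 1 ≤ p j)
    {r R : RatFunc ℂ} {q : ℕ} (hr : Decays r (x * y 0 * y 1))
    (hq : PoleOrderLE r 0 q) (hint : ∀ n : ℤ, n ≠ 0 → (n : ℂ) ∉ poles r)
    (hhalf : ∀ n : ℕ, (-n - 1 / 2 : ℂ) ∉ poles r) (hR : R = RatFunc.X ^ q * r) :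
    ∃ (T₁ T₂ T₃ : ℂ) (T₄ : Equiv.Perm (Fin 2) → ℂ),
        SeriesFrom 1 (fun n => ((x * y 0 * y 1) ^ n)⁻¹ * (y 0 * y 1)⁻¹
          * (ti (p 0) (y 0) - tFin n (p 0) (y 0))
          * (ti (p 1) (y 1) - tFin n (p 1) (y 1)) * ev r n) T₁ ∧
        SeriesFrom 1 (fun n => (x * y 0 * y 1) ^ n
          * (ti (p 0) (y 0) * (y 0)⁻¹ + (-1) ^ p 0 * tFin n (p 0) (y 0)⁻¹)
          * (ti (p 1) (y 1) * (y 1)⁻¹ + (-1) ^ p 1 * tFin n (p 1) (y 1)⁻¹) * ev r (-n)) T₂ ∧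
        SeriesFrom 0 (fun n => ∑ k ∈ range (p 0 + p 1),
          cTi x k * ((x * y 0 * y 1) ^ n * taylorCoeff r (p 0 + p 1 - 1 - k) (-n - 1 / 2))) T₃ ∧
        (∀ σ : Equiv.Perm (Fin 2), SeriesFrom 0 (fun n =>
          ∑ k₁ ∈ range (p (σ 0)), ∑ k₂ ∈ range (p (σ 0) - k₁),
            cTi x k₁ * ((k₂ + p (σ 1) - 1).choose (p (σ 1) - 1) : ℂ)
            * ((-1) ^ k₂ * Li (k₂ + p (σ 1)) (y (σ 1))
                + (-1) ^ p (σ 1) * zetaFin n (k₂ + p (σ 1)) (y (σ 1))⁻¹)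
            * ((x * y 0 * y 1) ^ n
                * taylorCoeff r (p (σ 0) - 1 - k₁ - k₂) (-n - 1 / 2))) (T₄ σ)) ∧
        -(∑ α ∈ (poles r).erase 0, residue (fun s => kernel (1 / 2) x p y s * ev r s) α)
          = T₁ + T₂ + T₃ + (∑ σ, T₄ σ)
            + (∑ k₁ ∈ range (q + 1), ∑ k₂ ∈ range (q + 1 - k₁),
                (y 0 * y 1)⁻¹
                * ((k₁ + p 0 - 1).choose (p 0 - 1) : ℂ) * ((k₂ + p 1 - 1).choose (p 1 - 1) : ℂ)
                * ti (k₁ + p 0) (y 0) * ti (k₂ + p 1) (y 1)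
                * ((-1) ^ (k₁ + k₂) * taylorCoeff R (q - k₁ - k₂) 0))
            + (∑ k₁ ∈ range q, ∑ k₂ ∈ range (q - k₁), ∑ k₃ ∈ range (q - k₁ - k₂),
                cLi x k₁
                * ((k₂ + p 0 - 1).choose (p 0 - 1) : ℂ) * ((k₃ + p 1 - 1).choose (p 1 - 1) : ℂ)
                * (-1) ^ (k₂ + k₃) * ti (k₂ + p 0) (y 0) * ti (k₃ + p 1) (y 1)
                * ((y 0 * y 1)⁻¹ * taylorCoeff R (q - 1 - k₁ - k₂ - k₃) 0)) := by
  have hz : ‖x * y 0 * y 1‖ = 1 := by simp [hx, hy]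
  obtain ⟨T₁, h₁⟩ := exists_seriesFrom_slow_mul_tame (norm_inv_eq_one hz)
    ((((slow_const (ti (p 0) (y 0))).add ((slow_tFin (hy 0) (hp 0)).const_mul (-1))).mul
      ((slow_const (ti (p 1) (y 1))).add ((slow_tFin (hy 1) (hp 1)).const_mul (-1)))).const_mul (y 0 * y 1)⁻¹)
    (tame_taylorCoeff_natCast hr.inv 0) 1
    (a := fun n => ((x * y 0 * y 1) ^ n)⁻¹ * (y 0 * y 1)⁻¹
      * (ti (p 0) (y 0) - tFin n (p 0) (y 0))
      * (ti (p 1) (y 1) - tFin n (p 1) (y 1)) * ev r n) fun n => by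
    rw [ev_eq_taylorCoeff_zero, inv_pow]
    ring
  obtain ⟨T₂, h₂⟩ := exists_seriesFrom_slow_mul_tame hz
    (((slow_const (ti (p 0) (y 0) * (y 0)⁻¹)).add
        ((slow_tFin (norm_inv_eq_one (hy 0)) (hp 0)).const_mul ((-1) ^ p 0))).mul
      ((slow_const (ti (p 1) (y 1) * (y 1)⁻¹)).add
        ((slow_tFin (norm_inv_eq_one (hy 1)) (hp 1)).const_mul ((-1) ^ p 1))))
    (tame_taylorCoeff_neg_natCast hr 0) 1
    (a := fun n => (x * y 0 * y 1) ^ n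
      * (ti (p 0) (y 0) * (y 0)⁻¹ + (-1) ^ p 0 * tFin n (p 0) (y 0)⁻¹)
      * (ti (p 1) (y 1) * (y 1)⁻¹ + (-1) ^ p 1 * tFin n (p 1) (y 1)⁻¹) * ev r (-n)) fun n => by
    rw [ev_eq_taylorCoeff_zero]
    ring
  obtain ⟨T₃, h₃⟩ := exists_seriesFrom_sum_mul hz (tame_taylorCoeff_half hr) (cTi x) (p 0 + p 1) 0
  choose T₄ h₄ using fun σ : Equiv.Perm (Fin 2) =>
    exists_seriesFrom_sum_sum_polar hz (tame_taylorCoeff_half hr) (cTi x) (hy (σ 1)) (hp (σ 1))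
      (p (σ 0)) 0
  refine ⟨T₁, T₂, T₃, T₄, h₁, h₂, h₃.congr fun n _ => ?_,
    fun σ => (h₄ σ).congr fun n _ => ?_, ?_⟩
  · exact sum_congr rfl fun k _ => by ring
  · exact sum_congr rfl fun k₁ _ => sum_congr rfl fun k₂ _ => by rw [polarCoeff_eq]; ring
  have hpos : ∀ n : ℕ, 1 ≤ n → (n : ℂ) ∉ poles r := fun n hn => by
    simpa using hint n (by omega)
  have hneg : ∀ n : ℕ, 1 ≤ n → -(n : ℂ) ∉ poles r := fun n hn => by
    simpa using hint (-n) (by omega)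
  have hrespos := fun (n : ℕ) (hn : 1 ≤ n) =>
    hasResidue_half_natCast (r := r) hx hy hp (hpos n hn)
  have hresneg := fun (n : ℕ) (hn : 1 ≤ n) =>
    hasResidue_half_neg_natCast (r := r) hx hy hp (hneg n hn)
  have hreshalf := fun n : ℕ => hasResidue_half_neg_half (r := r) hx hy hp
    (q := 0) (analyticAt_ev (hhalf n)) (eventually_ev_eq_inv_pow_zero_mul r _)
  -- At 0 the φ factors are regular with values at 1/2; hence ti and the prefactor (x₁x₂)⁻¹.
  have hreszero := hasResidue_half_zero hx hy hp hq hR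
  have hlim := tendsto_sum_residues_half hx hy hp hr ((poles r).erase 0)
    (fun α hα m hm => by
      obtain ⟨h0, hα⟩ := mem_erase.mp hα
      rw [hm] at h0 hα
      exact hint m (by simpa using h0) hα)
    (fun α hα k hk => hhalf k (hk ▸ mem_of_mem_erase hα))
    (fun α hα => by
      by_cases h0 : α = 0
      · exact Or.inr (Or.inl ⟨0, by simpa using h0⟩)
      · exact Or.inl (mem_erase.mpr ⟨h0, hα⟩))
    (fun m => by
      rcases lt_trichotomy m 0 with hm | rfl | hm
      · obtain ⟨n, rfl⟩ := Int.exists_eq_neg_ofNat hm.le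
        exact ⟨_, by simpa using hresneg n (by omega)⟩
      · exact ⟨_, by simpa using hreszero⟩
      · lift m to ℕ using hm.le
        exact ⟨_, by simpa using hrespos m (by omega)⟩)
    (fun k => ⟨_, hreshalf k⟩)
  have hs₁ := (h₁.congr fun n hn => (hrespos n hn).residue_eq.symm).tendsto_succ
  have hs₂ := (h₂.congr fun n hn => (hresneg n hn).residue_eq.symm).tendsto_succ
  have hs₃ : SeriesFrom 0 (fun n : ℕ => residue (fun s => kernel (1 / 2) x p y s * ev r s) (-(n : ℂ) - 1 / 2))
      (T₃ + ∑ σ, T₄ σ) :=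
    (h₃.add (SeriesFrom.finset_sum univ h₄)).congr fun n _ => by
        rw [(hreshalf n).residue_eq]
        simp only [add_zero, range_zero, sum_empty, mul_sum, mul_add]
  have key := tendsto_nhds_unique hlim
    ((((tendsto_const_nhds.add tendsto_const_nhds).add hs₁).add hs₂).add hs₃)
  rw [hreszero.residue_eq] at key
  linear_combination key


end

end CyclotomicResidue

theorem mainTheorem12 (x : ℂ) (y : Fin 2 → ℂ) (p : Fin 2 → ℕ)
    (hx : ∃ N : ℕ, 0 < N ∧ x ^ N = 1)
    (hy : ∀ j, ∃ N : ℕ, 0 < N ∧ y j ^ N = 1)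
    (hp : ∀ j, 1 ≤ p j) :
    -- first formula: kernel without shift, `r₁` with a pole at `0`
    (∀ (r R : RatFunc ℂ) (q : ℕ),
      Decays r (x * y 0 * y 1) →
      PoleOrderLE r 0 q →
      (∀ n : ℤ, n ≠ 0 → (n : ℂ) ∉ poles r) →
      R = RatFunc.X ^ q * r →
      ∃ (T₁ T₂ : ℂ) (T₃ : Equiv.Perm (Fin 2) → ℂ) (T₄ : ℂ) (T₅ : Equiv.Perm (Fin 2) → ℂ) (T₆ : ℂ),
        SeriesFrom 1 (fun n => ((x * y 0 * y 1) ^ n)⁻¹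
          * (Li (p 0) (y 0) - zetaFin (n - 1) (p 0) (y 0))
          * (Li (p 1) (y 1) - zetaFin (n - 1) (p 1) (y 1)) * ev r n) T₁ ∧
        SeriesFrom 1 (fun n => (x * y 0 * y 1) ^ n * taylorCoeff r (p 0 + p 1) (-n)) T₂ ∧
        (∀ σ : Equiv.Perm (Fin 2), SeriesFrom 1 (fun n =>
          ∑ k ∈ range (p (σ 0) + 1),
            ((k + p (σ 1) - 1).choose (p (σ 1) - 1) : ℂ) * (x * y 0 * y 1) ^ n
            * ((-1) ^ k * Li (k + p (σ 1)) (y (σ 1))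
                + (-1) ^ p (σ 1) * zetaFin n (k + p (σ 1)) (y (σ 1))⁻¹)
            * taylorCoeff r (p (σ 0) - k) (-n)) (T₃ σ)) ∧
        SeriesFrom 1 (fun n => (x * y 0 * y 1) ^ n
          * (Li (p 0) (y 0) + (-1) ^ p 0 * zetaFin n (p 0) (y 0)⁻¹)
          * (Li (p 1) (y 1) + (-1) ^ p 1 * zetaFin n (p 1) (y 1)⁻¹) * ev r (-n)) T₄ ∧
        (∀ σ : Equiv.Perm (Fin 2), SeriesFrom 1 (fun n =>
          ∑ k₁ ∈ range (p (σ 0)), ∑ k₂ ∈ range (p (σ 0) - k₁),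
            cLi x k₁ * ((k₂ + p (σ 1) - 1).choose (p (σ 1) - 1) : ℂ)
            * ((-1) ^ k₂ * Li (k₂ + p (σ 1)) (y (σ 1))
                + (-1) ^ p (σ 1) * zetaFin n (k₂ + p (σ 1)) (y (σ 1))⁻¹)
            * ((x * y 0 * y 1) ^ n * taylorCoeff r (p (σ 0) - 1 - k₁ - k₂) (-n))) (T₅ σ)) ∧
        SeriesFrom 1 (fun n => ∑ k ∈ range (p 0 + p 1),
          cLi x k * ((x * y 0 * y 1) ^ n * taylorCoeff r (p 0 + p 1 - 1 - k) (-n))) T₆ ∧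
        -(∑ α ∈ (poles r).erase 0, residue (fun s => kernel 0 x p y s * ev r s) α)
          = T₁ + T₂ + (∑ σ, T₃ σ) + T₄ + (∑ σ, T₅ σ) + T₆
            + taylorCoeff R (p 0 + p 1 + q) 0
            + (∑ σ : Equiv.Perm (Fin 2), ∑ k ∈ range (p (σ 0) + q + 1),
                ((k + p (σ 1) - 1).choose (p (σ 1) - 1) : ℂ) * (-1) ^ k
                * Li (k + p (σ 1)) (y (σ 1)) * taylorCoeff R (p (σ 0) + q - k) 0)
            + (∑ k₁ ∈ range (q + 1), ∑ k₂ ∈ range (q + 1 - k₁),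
                ((k₁ + p 0 - 1).choose (p 0 - 1) : ℂ) * ((k₂ + p 1 - 1).choose (p 1 - 1) : ℂ)
                * (-1) ^ (k₁ + k₂) * Li (k₁ + p 0) (y 0) * Li (k₂ + p 1) (y 1)
                * taylorCoeff R (q - k₁ - k₂) 0)
            + (∑ k ∈ range (p 0 + p 1 + q), cLi x k * taylorCoeff R (p 0 + p 1 + q - 1 - k) 0)
            + (∑ σ : Equiv.Perm (Fin 2), ∑ k₁ ∈ range (p (σ 0) + q),
                ∑ k₂ ∈ range (p (σ 0) + q - k₁),
                cLi x k₁ * ((k₂ + p (σ 1) - 1).choose (p (σ 1) - 1) : ℂ) * (-1) ^ k₂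
                * Li (k₂ + p (σ 1)) (y (σ 1)) * taylorCoeff R (p (σ 0) + q - 1 - k₁ - k₂) 0)
            + (∑ k₁ ∈ range q, ∑ k₂ ∈ range (q - k₁), ∑ k₃ ∈ range (q - k₁ - k₂),
                cLi x k₁
                * ((k₂ + p 0 - 1).choose (p 0 - 1) : ℂ) * ((k₃ + p 1 - 1).choose (p 1 - 1) : ℂ)
                * (-1) ^ (k₂ + k₃) * Li (k₂ + p 0) (y 0) * Li (k₃ + p 1) (y 1)
                * taylorCoeff R (q - 1 - k₁ - k₂ - k₃) 0)) ∧
    -- second formula: kernel shifted by `1/2`, `r₂` with a pole at `-1/2`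
    (∀ (r R : RatFunc ℂ) (q : ℕ),
      Decays r (x * y 0 * y 1) →
      PoleOrderLE r (-1 / 2) q →
      (∀ n : ℤ, (n : ℂ) ∉ poles r) →
      (∀ n : ℕ, 1 ≤ n → (-n - 1 / 2 : ℂ) ∉ poles r) →
      R = (RatFunc.X + RatFunc.C (1 / 2)) ^ q * r →
      ∃ (T₁ T₂ T₃ : ℂ) (T₄ : Equiv.Perm (Fin 2) → ℂ),
        SeriesFrom 1 (fun n => ((x * y 0 * y 1) ^ n)⁻¹ * (y 0 * y 1)⁻¹
          * (ti (p 0) (y 0) - tFin n (p 0) (y 0))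
          * (ti (p 1) (y 1) - tFin n (p 1) (y 1)) * ev r n) T₁ ∧
        SeriesFrom 0 (fun n => (x * y 0 * y 1) ^ n
          * (ti (p 0) (y 0) * (y 0)⁻¹ + (-1) ^ p 0 * tFin n (p 0) (y 0)⁻¹)
          * (ti (p 1) (y 1) * (y 1)⁻¹ + (-1) ^ p 1 * tFin n (p 1) (y 1)⁻¹) * ev r (-n)) T₂ ∧
        SeriesFrom 1 (fun n => ∑ k ∈ range (p 0 + p 1),
          cTi x k * ((x * y 0 * y 1) ^ n * taylorCoeff r (p 0 + p 1 - 1 - k) (-n - 1 / 2))) T₃ ∧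
        (∀ σ : Equiv.Perm (Fin 2), SeriesFrom 1 (fun n =>
          ∑ k₁ ∈ range (p (σ 0)), ∑ k₂ ∈ range (p (σ 0) - k₁),
            cTi x k₁ * ((k₂ + p (σ 1) - 1).choose (p (σ 1) - 1) : ℂ) * (x * y 0 * y 1) ^ n
            * ((-1) ^ k₂ * Li (k₂ + p (σ 1)) (y (σ 1))
                + (-1) ^ p (σ 1) * zetaFin n (k₂ + p (σ 1)) (y (σ 1))⁻¹)
            * taylorCoeff r (p (σ 0) - 1 - k₁ - k₂) (-n - 1 / 2)) (T₄ σ)) ∧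
        -(∑ α ∈ (poles r).erase (-1 / 2), residue (fun s => kernel (1 / 2) x p y s * ev r s) α)
          = T₁ + T₂ + T₃ + (∑ σ, T₄ σ)
            + (∑ k ∈ range (p 0 + p 1 + q),
                cTi x k * taylorCoeff R (p 0 + p 1 + q - 1 - k) (-1 / 2))
            + (∑ σ : Equiv.Perm (Fin 2), ∑ k₁ ∈ range (p (σ 0) + q),
                ∑ k₂ ∈ range (p (σ 0) + q - k₁),
                cTi x k₁ * ((k₂ + p (σ 1) - 1).choose (p (σ 1) - 1) : ℂ) * (-1) ^ k₂
                * Li (k₂ + p (σ 1)) (y (σ 1))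
                * taylorCoeff R (p (σ 0) + q - 1 - k₁ - k₂) (-1 / 2))
            + (∑ k₁ ∈ range q, ∑ k₂ ∈ range (q - k₁), ∑ k₃ ∈ range (q - k₁ - k₂),
                cTi x k₁
                * ((k₂ + p 0 - 1).choose (p 0 - 1) : ℂ) * ((k₃ + p 1 - 1).choose (p 1 - 1) : ℂ)
                * (-1) ^ (k₂ + k₃) * Li (k₂ + p 0) (y 0) * Li (k₃ + p 1) (y 1)
                * taylorCoeff R (q - 1 - k₁ - k₂ - k₃) (-1 / 2))) ∧
    -- third formula: kernel shifted by `1/2`, `r₃` with a pole at `0`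
    (∀ (r R : RatFunc ℂ) (q : ℕ),
      Decays r (x * y 0 * y 1) →
      PoleOrderLE r 0 q →
      (∀ n : ℤ, n ≠ 0 → (n : ℂ) ∉ poles r) →
      (∀ n : ℕ, (-n - 1 / 2 : ℂ) ∉ poles r) →
      R = RatFunc.X ^ q * r →
      ∃ (T₁ T₂ T₃ : ℂ) (T₄ : Equiv.Perm (Fin 2) → ℂ),
        SeriesFrom 1 (fun n => ((x * y 0 * y 1) ^ n)⁻¹ * (y 0 * y 1)⁻¹
          * (ti (p 0) (y 0) - tFin n (p 0) (y 0))
          * (ti (p 1) (y 1) - tFin n (p 1) (y 1)) * ev r n) T₁ ∧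
        SeriesFrom 1 (fun n => (x * y 0 * y 1) ^ n
          * (ti (p 0) (y 0) * (y 0)⁻¹ + (-1) ^ p 0 * tFin n (p 0) (y 0)⁻¹)
          * (ti (p 1) (y 1) * (y 1)⁻¹ + (-1) ^ p 1 * tFin n (p 1) (y 1)⁻¹) * ev r (-n)) T₂ ∧
        SeriesFrom 0 (fun n => ∑ k ∈ range (p 0 + p 1),
          cTi x k * ((x * y 0 * y 1) ^ n * taylorCoeff r (p 0 + p 1 - 1 - k) (-n - 1 / 2))) T₃ ∧
        (∀ σ : Equiv.Perm (Fin 2), SeriesFrom 0 (fun n =>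
          ∑ k₁ ∈ range (p (σ 0)), ∑ k₂ ∈ range (p (σ 0) - k₁),
            cTi x k₁ * ((k₂ + p (σ 1) - 1).choose (p (σ 1) - 1) : ℂ)
            * ((-1) ^ k₂ * Li (k₂ + p (σ 1)) (y (σ 1))
                + (-1) ^ p (σ 1) * zetaFin n (k₂ + p (σ 1)) (y (σ 1))⁻¹)
            * ((x * y 0 * y 1) ^ n
                * taylorCoeff r (p (σ 0) - 1 - k₁ - k₂) (-n - 1 / 2))) (T₄ σ)) ∧
        -(∑ α ∈ (poles r).erase 0, residue (fun s => kernel (1 / 2) x p y s * ev r s) α)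
          = T₁ + T₂ + T₃ + (∑ σ, T₄ σ)
            + (∑ k₁ ∈ range (q + 1), ∑ k₂ ∈ range (q + 1 - k₁),
                (y 0 * y 1)⁻¹
                * ((k₁ + p 0 - 1).choose (p 0 - 1) : ℂ) * ((k₂ + p 1 - 1).choose (p 1 - 1) : ℂ)
                * ti (k₁ + p 0) (y 0) * ti (k₂ + p 1) (y 1)
                * ((-1) ^ (k₁ + k₂) * taylorCoeff R (q - k₁ - k₂) 0))
            + (∑ k₁ ∈ range q, ∑ k₂ ∈ range (q - k₁), ∑ k₃ ∈ range (q - k₁ - k₂),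
                cLi x k₁
                * ((k₂ + p 0 - 1).choose (p 0 - 1) : ℂ) * ((k₃ + p 1 - 1).choose (p 1 - 1) : ℂ)
                * (-1) ^ (k₂ + k₃) * ti (k₂ + p 0) (y 0) * ti (k₃ + p 1) (y 1)
                * ((y 0 * y 1)⁻¹ * taylorCoeff R (q - 1 - k₁ - k₂ - k₃) 0))) := by
  -- Of the roots of unity only the absolute value 1 is used.
  have hx' := norm_eq_one_of_pow hx
  have hy' := fun j => norm_eq_one_of_pow (hy j)
  exact ⟨fun _ _ _ hr hq hint hR => formula_zero hx' hy' hp hr hq hint hR,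
    fun _ _ _ hr hq hint hhalf hR => formula_half_pole_half hx' hy' hp hr hq hint hhalf hR,
    fun _ _ _ hr hq hint hhalf hR => formula_half_pole_zero hx' hy' hp hr hq hint hhalf hR⟩
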